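/- Consider the spherical pendulum of mass $m>0$ and length $l>0$ in the gravity field $g>0$, that is, the Hamiltonian system on $T^*S^2=\{(\mathbf r,\mathbf p)\in\mathbb R^3\times\mathbb R^3 : (\mathbf r,\mathbf r)=l^2,\ (\mathbf r,\mathbf p)=0\}$ with the symplectic form induced by $d\mathbf r\wedge d\mathbf p$ and $$H=\frac{1}{2ml^2}(\mathbf L,\mathbf L)+mgl\Big(\frac{(\mathbf r,\mathbf e_z)}{\|\mathbf r\|}-1\Big),\qquad \mathbf L=\mathbf r\times\mathbf p .$$ Its focus-focus point is the upper equilibrium $\mathbf r=l\mathbf e_z$, $\mathbf p=0$. Put $\nu=\sqrt{g/l}$, $1/\kappa=ml^2\nu$, and on $\mathbb R^4$ with the symplectic form $dq_1\wedge dp_1+dq_2\wedge dp_2$ put $J_1=q_1p_1+q_2p_2$, $J_2=q_1p_2-q_2p_1$. A function $B(j_1,j_2)$, real-analytic near $0\in\mathbb R^2$, is a Birkhoff normal form up to order $N$ at the focus-focus point if $\partial B/\partial j_1(0,0)=\nu$ and there are real-analytic symplectic coordinates $(q_1,q_2,p_1,p_2)$ of $T^*S^2$ centred at the focus-focus point in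 which $L_z=J_2$ and $H=B(J_1,J_2)+O(|(q,p)|^{2N+1})$; it is a Birkhoff normal form if this holds for every $N$ (with coordinates that may depend on $N$). For real $(h,j_2)$ near $(0,0)$ let $$\tilde J_1(h,j_2)=\frac{1}{2\pi \mathrm i}\oint_\alpha\frac{w}{1-\zeta^2}\,d\zeta,\qquad w^2=2(1-\zeta^2)(h+1-\zeta)-j_2^2,$$ where $\alpha$ runs twice counterclockwise along the circle $|\zeta-1|=1$ (it encloses the two branch points that coalesce at $\zeta=1$ as $(h,j_2)\to(0,0)$, so that $\alpha$ is the cycle that vanishes at the equilibrium), with the branch of $w$ that is positive at $\zeta=2$. In the original units put $J_1(h,j_2)=\kappa^{-1}\tilde J_1(\kappa h/\nu,\kappa j_2)$. **Theorem.** The integral $\tilde J_1$ is real for $(h,j_2)$ near $(0,0)$. There is a function $H(j_1,j_2)$, real-analytic near $(0,0)$, that is a Birkhoff normal form of the spherical pendulum at the focus-focus point. It is unique: every real-analytic Birkhoff normal form up to order $N$ agrees with it up to an error $O(|(j_1,j_2)|^{N+1})$. It is the inverse of $J_1$ with respect to the first argument: $$H(J_1(h,j_2),j_2)=h\quad\text{and}\quad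 J_1(H(j_1,j_2),j_2)=j_1$$ for all $(h,j_2)$, respectively $(j_1,j_2)$, near $(0,0)$. -/

import Mathlib

open Filter Topology Asymptotics
open scoped Matrix

noncomputable section

namespace SphericalPendulum

/-- The phase space `ℝⁿ × ℝⁿ` of pairs (position, momentum). -/
abbrev Phase (n : ℕ) : Type := (Fin n → ℝ) × (Fin n → ℝ)

/-- The canonical symplectic form `∑ dqᵢ ∧ dpᵢ` on `ℝⁿ × ℝⁿ`. -/
def canonicalForm {n : ℕ} (u v : Phase n) : ℝ := u.1 ⬝ᵥ v.2 - v.1 ⬝ᵥ u.2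

/-- `T*S²` for the sphere of radius `l`, realised in `ℝ³ × ℝ³` by `(r, r) = l²`, `(r, p) = 0`;
its symplectic form is the restriction of the canonical form `dr ∧ dp` of `ℝ³ × ℝ³`. -/
def cotangentSphere (l : ℝ) : Set (Phase 3) := {x | x.1 ⬝ᵥ x.1 = l ^ 2 ∧ x.1 ⬝ᵥ x.2 = 0}

/-- Angular momentum `L = r × p`. -/
def angularMomentum (x : Phase 3) : Fin 3 → ℝ := x.1 ⨯₃ x.2

/-- The component `L_z` of the angular momentum. -/
def angularMomentumZ (x : Phase 3) : ℝ := angularMomentum x 2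

/-- The Hamiltonian of the spherical pendulum of mass `m` and length `l` in the gravity field `g`,
shifted so that the upper equilibrium has energy zero:
`H = (L, L) / (2 m l²) + m g l ((r, e_z) / ‖r‖ - 1)`. -/
def hamiltonian (m g l : ℝ) (x : Phase 3) : ℝ :=
  1 / (2 * m * l ^ 2) * (angularMomentum x ⬝ᵥ angularMomentum x)
    + m * g * l * (x.1 2 / √(x.1 ⬝ᵥ x.1) - 1)

/-- The unstable upper equilibrium (the focus-focus point): `r = l e_z`, `p = 0`. -/
def upperEquilibrium (l : ℝ) : Phase 3 := (![0, 0, l], 0)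

/-- `ν = √(g / l)`. -/
def frequency (g l : ℝ) : ℝ := √(g / l)

/-- The constant `κ` with `1 / κ = m l² ν`. -/
def kappa (m g l : ℝ) : ℝ := 1 / (m * l ^ 2 * frequency g l)

/-- The quadratic integral `J₁ = q₁ p₁ + q₂ p₂`. -/
def quadJ₁ (z : Phase 2) : ℝ := z.1 0 * z.2 0 + z.1 1 * z.2 1

/-- The quadratic integral `J₂ = q₁ p₂ - q₂ p₁`. -/
def quadJ₂ (z : Phase 2) : ℝ := z.1 0 * z.2 1 - z.1 1 * z.2 0

/-- `Φ` is (the inverse of) a real-analytic symplectic coordinate system `(q₁, q₂, p₁, p₂)` of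
`T*S²` centred at the focus-focus point. (It is a local diffeomorphism onto `T*S²`, because it
pulls the symplectic form of `T*S²` back to the canonical one and the dimensions agree.) -/
structure IsSymplecticCoordinates (l : ℝ) (Φ : Phase 2 → Phase 3) : Prop where
  analytic : AnalyticAt ℝ Φ 0
  map_zero : Φ 0 = upperEquilibrium l
  mem : ∀ᶠ z in 𝓝 (0 : Phase 2), Φ z ∈ cotangentSphere l
  symplectic : ∀ᶠ z in 𝓝 (0 : Phase 2), ∀ u v : Phase 2,
    canonicalForm (fderiv ℝ Φ z u) (fderiv ℝ Φ z v) = canonicalForm u v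

/-- `B(j₁, j₂)` is a Birkhoff normal form up to order `N` in `(j₁, j₂)` (order `2 N` in the phase
space variables) of the spherical pendulum at the focus-focus point: the quadratic part of
`B(J₁, J₂)` is in Williamson normal form with leading term `ν J₁`, and there are real-analytic
symplectic coordinates in which `L_z = J₂` and
`H = B(J₁, J₂) + O(|(q, p)| ^ (2 N + 1))`. -/
def IsNormalFormUpTo (m g l : ℝ) (N : ℕ) (B : ℝ × ℝ → ℝ) : Prop :=
  fderiv ℝ B 0 (1, 0) = frequency g l ∧
  ∃ Φ : Phase 2 → Phase 3, IsSymplecticCoordinates l Φ ∧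
    (∀ᶠ z in 𝓝 (0 : Phase 2), angularMomentumZ (Φ z) = quadJ₂ z) ∧
    (fun z : Phase 2 => hamiltonian m g l (Φ z) - B (quadJ₁ z, quadJ₂ z))
      =O[𝓝 0] fun z => ‖z‖ ^ (2 * N + 1)

/-- The analytic germ `B` at the origin is a Birkhoff normal form of the spherical pendulum at the
focus-focus point: `H` is brought to the form `B(J₁, J₂)` up to terms of arbitrarily high order. -/
def IsBirkhoffNormalForm (m g l : ℝ) (B : ℝ × ℝ → ℝ) : Prop :=
  AnalyticAt ℝ B 0 ∧ ∀ N : ℕ, IsNormalFormUpTo m g l N B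

/-- The polynomial `P(ζ) = 2 (1 - ζ²) (h + 1 - ζ) - j₂²` of the elliptic curve `w² = P(ζ)`. -/
def curvePoly (h j₂ : ℝ) (ζ : ℂ) : ℂ := 2 * (1 - ζ ^ 2) * (h + 1 - ζ) - (j₂ : ℂ) ^ 2

/-- The branch of `w = √P(ζ)` used on the circle `|ζ - 1| = 1`, which for `h`, `j₂` near `0`
encloses the two roots of `P` that coalesce at `1`, and not the third one, which is near `-1`.
It is positive at `ζ = 2`. -/
def curveW (h j₂ : ℝ) (ζ : ℂ) : ℂ :=
  (ζ - 1) * (curvePoly h j₂ ζ / (ζ - 1) ^ 2) ^ (1 / 2 : ℂ)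

theorem curveW_sq (h j₂ : ℝ) {ζ : ℂ} (hζ : ζ ≠ 1) : curveW h j₂ ζ ^ 2 = curvePoly h j₂ ζ := by
  have h1 : (ζ - 1) ^ 2 ≠ 0 := pow_ne_zero _ (sub_ne_zero.mpr hζ)
  rw [curveW, mul_pow, ← Complex.cpow_nat_mul]
  norm_num
  field_simp

/-- For small `h`, `j₂` the branch is continuous along the whole circle, so that the circle with
this branch is a closed cycle on the curve. -/
theorem continuousOn_curveW {h j₂ : ℝ} (hs : 6 * |h| + j₂ ^ 2 < 2) :
    ContinuousOn (curveW h j₂) (Metric.sphere 1 1) := by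
  have hne : ∀ ζ ∈ Metric.sphere (1 : ℂ) 1, (ζ - 1) ^ 2 ≠ 0 := by
    intro ζ hζ h0
    have h1 : ‖ζ - 1‖ = 1 := by simpa [dist_eq_norm] using hζ
    rw [pow_eq_zero_iff two_ne_zero] at h0
    simp [h0] at h1
  have hc : ContinuousOn (fun ζ : ℂ => curvePoly h j₂ ζ / (ζ - 1) ^ 2) (Metric.sphere 1 1) := by
    apply ContinuousOn.div _ (by fun_prop) hne
    unfold curvePoly
    fun_prop
  apply ContinuousOn.mul (by fun_prop)
  refine hc.cpow_const fun ζ hζ => Or.inl ?_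
  have h1 : ‖ζ - 1‖ = 1 := by simpa [dist_eq_norm] using hζ
  have hz : ζ - 1 ≠ 0 := by
    intro h0
    simp [h0] at h1
  have key : curvePoly h j₂ ζ / (ζ - 1) ^ 2
      = 2 * (ζ - 1) + 4 - (2 * h * (ζ + 1) / (ζ - 1) + (j₂ : ℂ) ^ 2 / (ζ - 1) ^ 2) := by
    unfold curvePoly
    field_simp
    ring
  have hre : -1 ≤ (ζ - 1).re := by
    have := Complex.abs_re_le_norm (ζ - 1)
    rw [h1] at this
    exact (abs_le.mp this).1
  have hb : ‖ζ + 1‖ ≤ 3 := by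
    have h2 : ζ + 1 = (ζ - 1) + 2 := by ring
    rw [h2]
    refine (norm_add_le _ _).trans ?_
    rw [h1]
    norm_num
  have hn : ‖2 * h * (ζ + 1) / (ζ - 1) + (j₂ : ℂ) ^ 2 / (ζ - 1) ^ 2‖ ≤ 6 * |h| + j₂ ^ 2 := by
    refine (norm_add_le _ _).trans ?_
    simp only [norm_div, norm_mul, norm_pow, h1, Complex.norm_real, Real.norm_eq_abs, sq_abs]
    norm_num
    nlinarith [abs_nonneg h]
  have hle := (Complex.re_le_norm _).trans hn
  rw [key, Complex.sub_re]
  have : (2 * (ζ - 1) + 4 : ℂ).re = 2 * (ζ - 1).re + 4 := by simp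
  rw [this]
  linarith

/-- The dimensionless complete elliptic integral `(1 / 2πi) ∮_α w / (1 - ζ²) dζ`. The vanishing
cycle `α` runs twice around the two roots of `P` near `1`, which gives the factor `2`. -/
def ellipticIntegral (h j₂ : ℝ) : ℂ :=
  2 * ((2 * Real.pi * Complex.I)⁻¹ * ∮ ζ in C(1, 1), curveW h j₂ ζ / (1 - ζ ^ 2))

/-- The imaginary action `J₁(h, j₂)` in the original units: `κ J₁` is the elliptic integral at the
dimensionless energy `κ h / ν` and angular momentum `κ j₂`. -/
def imaginaryAction (m g l h j₂ : ℝ) : ℝ :=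
  (ellipticIntegral (kappa m g l * h / frequency g l) (kappa m g l * j₂)).re / kappa m g l

end SphericalPendulum

end

/-! In imaginary time the flow of `J₁` is periodic, `(q, p) ↦ (e^{iθ} q, e^{-iθ} p)`, and its
complex orbits are the vanishing cycles of the focus-focus point. The integral of `p dr` over such a
cycle is a symplectic invariant: in normal form coordinates it is a multiple of `J₁`, while on the
pendulum separation of variables turns it into the elliptic integral. Hence a normal form inverts
the action, and one of finite order inverts it to that order.

The loop is replaced by algebra with Taylor coefficients. On the surface `testSurface α β` with
coordinates `(s, τ)` one has `J₁ = α t` and `J₂ = β t`, where `t = s² τ`. The imaginary flow becomes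
`(s, τ) ↦ (e^{iθ} s, e^{-2iθ} τ)`, with generator `eulerD`, that is `s ∂ₛ - 2 τ ∂_τ`, and averaging
over it keeps exactly the monomials `(s² τ)ⁿ`, the coefficients `jet (2 * n) n`. "A closed form has
no period" becomes `jet_closed`, and `jet_action_form` gives the period `α t` of `p dr`. On the
pendulum `action_identity` and `curve_identity` write `κ p dr` as the integrand of the elliptic
integral plus `κ β t dφ`. The variable `y = ζ - 1` equals `s² Y` with `Y(0) < 0`, so the only period
comes from `dy / y`, and it counts twice (`jet_residue_monomial`); this matches the double contour.
The residue calculus of `exists_residue_expansion` and `jet_realBranch` identifies the result with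
the elliptic integral. Comparing both sides (`jet_action`) yields
`imaginaryAction_of_isNormalFormUpTo`: `J₁(B(j₁, j₂), j₂) = j₁` up to order `N`.

Normal forms of each finite order exist by Birkhoff's scheme in the rotation invariants `|q|²`,
`|p|²`, `(q, p)`: a Darboux chart (`isNormalisable_two`), the homological equation
(`exists_homological_solution`), and midpoint maps in place of time-one flows
(`exists_midpoint_map`, `IsNormalisable.succ`). Convergence of the normalising maps is never needed.
The analytic `H` is the inverse function of the analytic action; it agrees with every finite-order
normal form to the relevant order, which gives uniqueness and shows that `H` is itself a normal form
of every order. -/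

noncomputable section

namespace SphericalPendulum

/-! ### Analytic germs: Hadamard's lemma, orders of vanishing, leading parts, inverse functions. -/

section AnalyticTools

variable {𝕜 E F : Type*} [RCLike 𝕜] [NormedAddCommGroup E] [NormedSpace 𝕜 E]
  [NormedAddCommGroup F] [NormedSpace 𝕜 F]

@[fun_prop]
theorem analyticAt_fst_comp {G : Type*} [NormedAddCommGroup G] [NormedSpace 𝕜 G] {f : E → F × G}
    {x : E} (hf : AnalyticAt 𝕜 f x) : AnalyticAt 𝕜 (fun y => (f y).1) x :=
  analyticAt_fst.comp hf

@[fun_prop]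
theorem analyticAt_snd_comp {G : Type*} [NormedAddCommGroup G] [NormedSpace 𝕜 G] {f : E → F × G}
    {x : E} (hf : AnalyticAt 𝕜 f x) : AnalyticAt 𝕜 (fun y => (f y).2) x :=
  analyticAt_snd.comp hf

/-- Hadamard's lemma for analytic functions. -/
theorem hadamard [CompleteSpace F] {f : E → F} (hf : AnalyticAt 𝕜 f 0) :
    ∃ L : E → E →L[𝕜] F, AnalyticAt 𝕜 L 0 ∧ L 0 = fderiv 𝕜 f 0 ∧
      ∀ᶠ z in 𝓝 (0 : E), f z = f 0 + L z z := by
  obtain ⟨p, hp⟩ := hf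
  have hp' := hp
  obtain ⟨r, hr⟩ := hp'
  have hrad : 0 < p.shift.radius := by
    rw [FormalMultilinearSeries.radius_shift]; exact lt_of_lt_of_le hr.r_pos hr.r_le
  have hs := p.shift.hasFPowerSeriesOnBall hrad
  refine ⟨p.shift.sum, ⟨p.shift, hs.hasFPowerSeriesAt⟩, ?_, ?_⟩
  · have h1 := hs.hasFPowerSeriesAt.coeff_zero ![]
    rw [← h1, hp.fderiv_eq]
    ext v
    simp [FormalMultilinearSeries.shift, continuousMultilinearCurryFin1]
  · have h2 := hp.eventually_hasSum
    have h3 := hs.hasFPowerSeriesAt.eventually_hasSum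
    filter_upwards [h2, h3] with z hz hz'
    rw [zero_add] at hz hz'
    have h4 := (hasSum_nat_add_iff' 1).mpr hz
    have h5 := (ContinuousLinearMap.apply 𝕜 F z).hasSum hz'
    have h6 : (fun n => p (n + 1) fun _ => z) =
        ⇑(ContinuousLinearMap.apply 𝕜 F z) ∘ fun n => (p.shift n) fun _ => z := by
      ext n
      simp only [Function.comp_apply, ContinuousLinearMap.apply_apply,
        FormalMultilinearSeries.shift, ContinuousMultilinearMap.curryRight_apply]
      congr 1
      ext i
      refine Fin.lastCases ?_ (fun i => ?_) i <;> simp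
    rw [h6] at h4
    have h7 := h4.unique h5
    rw [ContinuousLinearMap.apply_apply] at h7
    rw [← h7]
    have : (p 0 fun _ => z) = f 0 := hp.coeff_zero _
    simp [this]

theorem eq_zero_of_isBigO_norm_pow {f : E → F} {k : ℕ} (h : f =O[𝓝 0] fun x => ‖x‖ ^ k)
    (hk : k ≠ 0) : f 0 = 0 := by
  obtain ⟨C, hC⟩ := h.bound
  simpa [hk] using hC.self_of_nhds

theorem isBigO_norm_pow_le {m n : ℕ} (h : m ≤ n) :
    (fun x : E => ‖x‖ ^ n) =O[𝓝 0] fun x => ‖x‖ ^ m := by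
  obtain ⟨k, rfl⟩ := Nat.exists_eq_add_of_le h
  have h1 : (fun x : E => ‖x‖ ^ k) =O[𝓝 0] fun _ => (1 : ℝ) := by
    apply ContinuousAt.isBigO
    fun_prop
  simpa [pow_add] using (isBigO_refl (fun x : E => ‖x‖ ^ m) (𝓝 0)).mul h1

theorem sub_partialSum_succ {p : FormalMultilinearSeries 𝕜 E F} {i : ℕ}
    (ih : ∀ j < i, ∀ x : E, p j (fun _ => x) = 0) (y : E) :
    p.partialSum (i + 1) y = p i fun _ => y := by
  rw [FormalMultilinearSeries.partialSum, Finset.sum_range_succ,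
    Finset.sum_eq_zero, zero_add]
  intro j hj
  rw [Finset.mem_range] at hj
  exact ih j hj y

/-- The lowest surviving term is homogeneous of some degree `i < k` and is also `O(‖x‖ ^ (i + 1))`,
which forces it to vanish. Only diagonal values are controlled, since the coefficients of `p` need
not be symmetric. -/
theorem coeff_diag_eq_zero {f : E → F} {p : FormalMultilinearSeries 𝕜 E F}
    (hp : HasFPowerSeriesAt f p 0) {k : ℕ} (h : f =O[𝓝 0] fun x => ‖x‖ ^ k) :
    ∀ i < k, ∀ x : E, p i (fun _ => x) = 0 := by
  intro i
  induction i using Nat.strong_induction_on with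
  | _ i ih =>
    intro hi
    apply IsBigO.continuousMultilinearMap_apply_eq_zero
    have h1 := hp.isBigO_sub_partialSum_pow (i + 1)
    simp only [zero_add] at h1
    have h2 : (fun y => f y - (f y - p.partialSum (i + 1) y)) =O[𝓝 0] fun x => ‖x‖ ^ (i + 1) :=
      IsBigO.sub (h.trans (isBigO_norm_pow_le hi)) h1
    refine h2.congr_left fun y => ?_
    rw [sub_sub_cancel, sub_partialSum_succ (fun j hj => ih j hj (by omega))]

theorem isBigO_of_coeff_diag_eq_zero {f : E → F} {p : FormalMultilinearSeries 𝕜 E F}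
    (hp : HasFPowerSeriesAt f p 0) {k : ℕ} (h : ∀ i < k, ∀ x : E, p i (fun _ => x) = 0) :
    f =O[𝓝 0] fun x => ‖x‖ ^ k := by
  have h1 := hp.isBigO_sub_partialSum_pow k
  simp only [zero_add] at h1
  refine h1.congr_left fun y => ?_
  rw [FormalMultilinearSeries.partialSum, Finset.sum_eq_zero, sub_zero]
  intro j hj
  exact h j (Finset.mem_range.mp hj) y

theorem isBigO_fderiv [CompleteSpace F] {f : E → F} (hf : AnalyticAt 𝕜 f 0) {k : ℕ}
    (h : f =O[𝓝 0] fun x => ‖x‖ ^ (k + 1)) : fderiv 𝕜 f =O[𝓝 0] fun x => ‖x‖ ^ k := by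
  obtain ⟨p, hp⟩ := hf
  have hz := coeff_diag_eq_zero hp h
  obtain ⟨r, hr⟩ := hp
  -- Vanishing on the diagonal does not make `p n` zero as a multilinear map. Replacing the low
  -- coefficients by `0` leaves the sum unchanged, and the differentiated series then starts at
  -- degree `k`.
  let q : FormalMultilinearSeries 𝕜 E F := fun n => if n < k + 1 then 0 else p n
  have hq : HasFPowerSeriesOnBall f q 0 r := by
    refine ⟨hr.r_le.trans ?_, hr.r_pos, ?_⟩
    · refine ENNReal.le_of_forall_nnreal_lt fun s hs => ?_
      obtain ⟨C, hC, hb⟩ := p.norm_mul_pow_le_of_lt_radius hs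
      refine q.le_radius_of_bound C fun n => ?_
      by_cases hn : n < k + 1
      · simp only [q, if_pos hn, norm_zero, zero_mul, hC.le]
      · simpa only [q, if_neg hn] using hb n
    · intro y hy
      convert hr.hasSum hy using 2 with n
      by_cases hn : n < k + 1
      · simp only [q, if_pos hn, hz n hn]
        rfl
      · simp only [q, if_neg hn]
  have hd := hq.fderiv
  refine isBigO_of_coeff_diag_eq_zero hd.hasFPowerSeriesAt fun i hi x => ?_
  rw [FormalMultilinearSeries.derivSeries_eq_zero]
  · rfl
  · simp [q]; omega

/-- A nonzero homogeneous leading part is nonzero at some point, hence already visible on the line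
through that point. Analyticity makes the bounds on single lines uniform. -/
theorem isBigO_of_lines {E F : Type*} [NormedAddCommGroup E] [NormedSpace ℝ E]
    [NormedAddCommGroup F] [NormedSpace ℝ F] {f : E → F} (hf : AnalyticAt ℝ f 0) {k : ℕ}
    (h : ∀ x : E, (fun t : ℝ => f (t • x)) =O[𝓝 0] fun t => |t| ^ k) :
    f =O[𝓝 0] fun x => ‖x‖ ^ k := by
  obtain ⟨p, hp⟩ := hf
  refine isBigO_of_coeff_diag_eq_zero hp fun i => ?_
  induction i using Nat.strong_induction_on with
  | _ i ih =>
    intro hi x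
    have h1 := hp.isBigO_sub_partialSum_pow (i + 1)
    simp only [zero_add] at h1
    have ht : Tendsto (fun t : ℝ => t • x) (𝓝 0) (𝓝 0) := by
      have : ContinuousAt (fun t : ℝ => t • x) 0 := by fun_prop
      simpa [ContinuousAt] using this
    have h2 := h1.comp_tendsto ht
    have h3 : (fun t : ℝ => ‖t • x‖ ^ (i + 1)) =O[𝓝 0] fun t : ℝ => |t| ^ (i + 1) := by
      refine IsBigO.of_bound (‖x‖ ^ (i + 1)) (Eventually.of_forall fun t => ?_)
      simp [norm_smul, mul_pow, mul_comm]
    have h4 : (fun t : ℝ => |t| ^ k) =O[𝓝 0] fun t : ℝ => |t| ^ (i + 1) :=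
      isBigO_norm_pow_le (E := ℝ) hi
    have h5 := ((h x).trans h4).sub (h2.trans h3)
    have h6 : (fun t : ℝ => t ^ i • p i fun _ => x) =O[𝓝 0] fun t : ℝ => |t| ^ (i + 1) := by
      refine h5.congr_left fun t => ?_
      simp only [Function.comp_apply]
      rw [sub_sub_cancel, sub_partialSum_succ (fun j hj => ih j hj (by omega)),
        (p i).map_smul_univ (fun _ => t) (fun _ => x)]
      simp
    by_contra hne
    have h7 : (fun t : ℝ => t ^ i) =O[𝓝 0] fun t : ℝ => |t| ^ (i + 1) := by
      refine IsBigO.trans ?_ h6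
      refine IsBigO.of_bound (‖p i fun _ => x‖⁻¹) (Eventually.of_forall fun t => ?_)
      rw [norm_smul, mul_comm, mul_assoc, mul_inv_cancel₀ (norm_ne_zero_iff.mpr hne), mul_one]
    have h8 := IsBigO.continuousMultilinearMap_apply_eq_zero
      (p := ContinuousMultilinearMap.mkPiAlgebraFin ℝ i ℝ) (by simpa using h7) 1
    simp at h8

/-- The homogeneous leading part of an analytic function of finitely many scalar variables. -/
theorem exists_homogeneous_part {ι : Type*} [Fintype ι] {f : (ι → 𝕜) → 𝕜}
    (hf : AnalyticAt 𝕜 f 0) {d : ℕ} (h : f =O[𝓝 0] fun x => ‖x‖ ^ d) :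
    ∃ P : MvPolynomial ι 𝕜, P.IsHomogeneous d ∧
      (fun x => f x - MvPolynomial.eval x P) =O[𝓝 0] fun x => ‖x‖ ^ (d + 1) := by
  classical
  obtain ⟨p, hp⟩ := hf
  have hz := coeff_diag_eq_zero hp h
  have h1 := hp.isBigO_sub_partialSum_pow (d + 1)
  simp only [zero_add] at h1
  refine ⟨∑ σ : Fin d → ι, MvPolynomial.C (p d fun i => Pi.single (σ i) 1) *
    ∏ i, MvPolynomial.X (σ i), ?_, ?_⟩
  · refine MvPolynomial.IsHomogeneous.sum _ _ _ fun σ _ => ?_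
    have h2 := (MvPolynomial.isHomogeneous_C ι (p d fun i => Pi.single (σ i) (1 : 𝕜))).mul
      (MvPolynomial.IsHomogeneous.prod Finset.univ (fun i => MvPolynomial.X (R := 𝕜) (σ i))
        (fun _ => 1) fun i _ => MvPolynomial.isHomogeneous_X 𝕜 _)
    simpa using h2
  · refine h1.congr_left fun x => ?_
    rw [sub_partialSum_succ hz]
    congr 1
    have hx : x = ∑ j, x j • (Pi.single j 1 : ι → 𝕜) := by
      ext i; simp [Pi.single_apply]
    conv_lhs => rw [hx]
    rw [(p d).map_sum (fun _ j => x j • (Pi.single j 1 : ι → 𝕜))]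
    simp only [map_sum, map_mul, MvPolynomial.eval_C, map_prod, MvPolynomial.eval_X]
    refine Finset.sum_congr rfl fun σ _ => ?_
    rw [(p d).map_smul_univ (fun i => x (σ i)) (fun i => (Pi.single (σ i) 1 : ι → 𝕜))]
    simp [mul_comm]

theorem exists_taylor {ι : Type*} [Fintype ι] {f : (ι → 𝕜) → 𝕜}
    (hf : AnalyticAt 𝕜 f 0) (d : ℕ) :
    ∃ P : MvPolynomial ι 𝕜,
      (fun x => f x - MvPolynomial.eval x P) =O[𝓝 0] fun x => ‖x‖ ^ d := by
  induction d with
  | zero =>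
    refine ⟨0, ?_⟩
    simpa using hf.continuousAt.isBigO_one ℝ
  | succ d ih =>
    obtain ⟨P, hP⟩ := ih
    have ha : AnalyticAt 𝕜 (fun x => f x - MvPolynomial.eval x P) 0 :=
      hf.sub (AnalyticOnNhd.eval_mvPolynomial P 0 trivial)
    obtain ⟨Q, -, hQ⟩ := exists_homogeneous_part ha hP
    refine ⟨P + Q, hQ.congr_left fun x => ?_⟩
    simp; ring

/-- The inverse function theorem in the analytic category. -/
theorem exists_analytic_inverse [CompleteSpace E] [CompleteSpace F] {f : E → F}
    (hf : AnalyticAt 𝕜 f 0) (h0 : f 0 = 0) (e : E ≃L[𝕜] F) (he : fderiv 𝕜 f 0 = e) :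
    ∃ g : F → E, AnalyticAt 𝕜 g 0 ∧ g 0 = 0 ∧ (∀ᶠ x in 𝓝 (0 : E), g (f x) = x) ∧
      ∀ᶠ y in 𝓝 (0 : F), f (g y) = y := by
  have hs : HasStrictFDerivAt f (e : E →L[𝕜] F) 0 := he ▸ hf.hasStrictFDerivAt
  let φ := hs.toOpenPartialHomeomorph f
  have hsrc : (0 : E) ∈ φ.source := hs.mem_toOpenPartialHomeomorph_source
  have hφ : ∀ x, φ x = f x := fun x => rfl
  have h1 := φ.analyticAt_symm' hsrc hf he
  have h00 : φ 0 = 0 := h0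
  rw [h00] at h1
  refine ⟨φ.symm, h1, ?_, ?_, ?_⟩
  · rw [← h00, φ.left_inv hsrc]
  · exact hs.eventually_left_inverse
  · have := hs.eventually_right_inverse
    rw [h0] at this
    exact this

end AnalyticTools

/-! ### Mixed Taylor coefficients in the plane `(s, τ)` and the resonant ones among them. -/

/-- The partial derivative with respect to the first variable. -/
def pd₁ (F : ℝ × ℝ → ℝ) (x : ℝ × ℝ) : ℝ := fderiv ℝ F x ((1, 0) : ℝ × ℝ)

/-- The partial derivative with respect to the second variable. -/
def pd₂ (F : ℝ × ℝ → ℝ) (x : ℝ × ℝ) : ℝ := fderiv ℝ F x (0, 1)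

/-- The mixed partial derivative `∂₂ⁿ ∂₁ᵐ F` at the origin. -/
def jet (m n : ℕ) (F : ℝ × ℝ → ℝ) : ℝ := (pd₂^[n] (pd₁^[m] F)) 0

section Jets

variable {F G M K : ℝ × ℝ → ℝ}

theorem pd₁_congr {x : ℝ × ℝ} (h : F =ᶠ[𝓝 x] G) : pd₁ F =ᶠ[𝓝 x] pd₁ G := by
  filter_upwards [h.fderiv (𝕜 := ℝ)] with y hy
  simp only [pd₁, hy]

theorem pd₂_congr {x : ℝ × ℝ} (h : F =ᶠ[𝓝 x] G) : pd₂ F =ᶠ[𝓝 x] pd₂ G := by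
  filter_upwards [h.fderiv (𝕜 := ℝ)] with y hy
  simp only [pd₂, hy]

theorem analyticAt_pd₁ {x : ℝ × ℝ} (h : AnalyticAt ℝ F x) : AnalyticAt ℝ (pd₁ F) x :=
  ((ContinuousLinearMap.apply ℝ ℝ ((1, 0) : ℝ × ℝ)).analyticAt _).comp (AnalyticAt.fderiv h)

theorem analyticAt_pd₂ {x : ℝ × ℝ} (h : AnalyticAt ℝ F x) : AnalyticAt ℝ (pd₂ F) x :=
  ((ContinuousLinearMap.apply ℝ ℝ ((0, 1) : ℝ × ℝ)).analyticAt _).comp (AnalyticAt.fderiv h)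

theorem iterate_pd₁_congr (h : F =ᶠ[𝓝 0] G) (m : ℕ) : pd₁^[m] F =ᶠ[𝓝 0] pd₁^[m] G := by
  induction m generalizing F G with
  | zero => exact h
  | succ m ih => exact ih (pd₁_congr h)

theorem iterate_pd₂_congr (h : F =ᶠ[𝓝 0] G) (m : ℕ) : pd₂^[m] F =ᶠ[𝓝 0] pd₂^[m] G := by
  induction m generalizing F G with
  | zero => exact h
  | succ m ih => exact ih (pd₂_congr h)

theorem jet_congr (h : F =ᶠ[𝓝 0] G) (m n : ℕ) : jet m n F = jet m n G :=
  (iterate_pd₂_congr (iterate_pd₁_congr h m) n).eq_of_nhds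

theorem pd₂_pd₁_comm (h : AnalyticAt ℝ F 0) : pd₂ (pd₁ F) =ᶠ[𝓝 0] pd₁ (pd₂ F) := by
  filter_upwards [h.eventually_analyticAt] with x hx
  have hd : DifferentiableAt ℝ (fderiv ℝ F) x := hx.fderiv.differentiableAt
  have h1 : ∀ u v : ℝ × ℝ, fderiv ℝ (fun y => fderiv ℝ F y u) x v = fderiv ℝ (fderiv ℝ F) x v u := by
    intro u v
    rw [fderiv_clm_apply hd (by fun_prop)]
    simp
  have hs : IsSymmSndFDerivAt ℝ F x := by
    apply ContDiffAt.isSymmSndFDerivAt (n := 2) hx.contDiffAt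
    simp
  change fderiv ℝ (fun y => fderiv ℝ F y (1, 0)) x (0, 1) =
    fderiv ℝ (fun y => fderiv ℝ F y (0, 1)) x (1, 0)
  rw [h1, h1, hs.eq]

theorem pd₂_iterate_pd₁_comm (h : AnalyticAt ℝ F 0) (m : ℕ) :
    pd₂ (pd₁^[m] F) =ᶠ[𝓝 0] pd₁^[m] (pd₂ F) := by
  induction m generalizing F with
  | zero => rfl
  | succ m ih =>
    rw [Function.iterate_succ_apply, Function.iterate_succ_apply]
    exact (ih (analyticAt_pd₁ h)).trans (iterate_pd₁_congr (pd₂_pd₁_comm h) m)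

theorem jet_succ_left (m n : ℕ) : jet (m + 1) n F = jet m n (pd₁ F) := rfl

theorem jet_succ_right (h : AnalyticAt ℝ F 0) (m n : ℕ) : jet m (n + 1) F = jet m n (pd₂ F) :=
  (iterate_pd₂_congr (pd₂_iterate_pd₁_comm h m) n).eq_of_nhds

theorem pd₁_add (hF : AnalyticAt ℝ F 0) (hG : AnalyticAt ℝ G 0) :
    pd₁ (fun x => F x + G x) =ᶠ[𝓝 0] fun x => pd₁ F x + pd₁ G x := by
  filter_upwards [hF.eventually_analyticAt, hG.eventually_analyticAt] with x h1 h2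
  simp [pd₁, fderiv_fun_add h1.differentiableAt h2.differentiableAt]

theorem pd₂_add (hF : AnalyticAt ℝ F 0) (hG : AnalyticAt ℝ G 0) :
    pd₂ (fun x => F x + G x) =ᶠ[𝓝 0] fun x => pd₂ F x + pd₂ G x := by
  filter_upwards [hF.eventually_analyticAt, hG.eventually_analyticAt] with x h1 h2
  simp [pd₂, fderiv_fun_add h1.differentiableAt h2.differentiableAt]

theorem jet_add (hF : AnalyticAt ℝ F 0) (hG : AnalyticAt ℝ G 0) (m n : ℕ) :
    jet m n (fun x => F x + G x) = jet m n F + jet m n G := by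
  induction m generalizing F G with
  | zero =>
    induction n generalizing F G with
    | zero => rfl
    | succ n ih =>
      rw [jet_succ_right (hF.fun_add hG), jet_succ_right hF, jet_succ_right hG,
        ← ih (analyticAt_pd₂ hF) (analyticAt_pd₂ hG)]
      exact jet_congr (pd₂_add hF hG) _ _
  | succ m ih =>
    rw [jet_succ_left, jet_succ_left, jet_succ_left, ← ih (analyticAt_pd₁ hF) (analyticAt_pd₁ hG)]
    exact jet_congr (pd₁_add hF hG) _ _

theorem pd₁_const_mul (c : ℝ) (hF : AnalyticAt ℝ F 0) :
    pd₁ (fun x => c * F x) =ᶠ[𝓝 0] fun x => c * pd₁ F x := by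
  filter_upwards [hF.eventually_analyticAt] with x h1
  simp [pd₁, fderiv_const_mul h1.differentiableAt]

theorem pd₂_const_mul (c : ℝ) (hF : AnalyticAt ℝ F 0) :
    pd₂ (fun x => c * F x) =ᶠ[𝓝 0] fun x => c * pd₂ F x := by
  filter_upwards [hF.eventually_analyticAt] with x h1
  simp [pd₂, fderiv_const_mul h1.differentiableAt]

theorem jet_const_mul (c : ℝ) (hF : AnalyticAt ℝ F 0) (m n : ℕ) :
    jet m n (fun x => c * F x) = c * jet m n F := by
  induction m generalizing F with
  | zero =>
    induction n generalizing F with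
    | zero => rfl
    | succ n ih =>
      rw [jet_succ_right (analyticAt_const.fun_mul hF), jet_succ_right hF, ← ih (analyticAt_pd₂ hF)]
      exact jet_congr (pd₂_const_mul c hF) _ _
  | succ m ih =>
    rw [jet_succ_left, jet_succ_left, ← ih (analyticAt_pd₁ hF)]
    exact jet_congr (pd₁_const_mul c hF) _ _

theorem jet_sub (hF : AnalyticAt ℝ F 0) (hG : AnalyticAt ℝ G 0) (m n : ℕ) :
    jet m n (fun x => F x - G x) = jet m n F - jet m n G := by
  have h := jet_add hF (analyticAt_const.fun_mul hG : AnalyticAt ℝ (fun x => (-1 : ℝ) * G x) 0) m n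
  rw [jet_const_mul _ hG] at h
  rw [sub_eq_add_neg, neg_eq_neg_one_mul, ← h]
  congr 1
  ext x
  ring

theorem jet_sum {ι : Type*} (s : Finset ι) {F : ι → ℝ × ℝ → ℝ}
    (hF : ∀ i ∈ s, AnalyticAt ℝ (F i) 0) (m n : ℕ) :
    jet m n (fun x => ∑ i ∈ s, F i x) = ∑ i ∈ s, jet m n (F i) := by
  classical
  induction s using Finset.induction_on with
  | empty =>
    have := jet_const_mul 0 (analyticAt_const : AnalyticAt ℝ (fun _ : ℝ × ℝ => (0 : ℝ)) 0) m n
    simpa using this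
  | insert i s hi ih =>
    have h1 : AnalyticAt ℝ (fun x => ∑ i ∈ s, F i x) 0 :=
      Finset.analyticAt_fun_sum _ fun j hj => hF j (Finset.mem_insert_of_mem hj)
    simp only [Finset.sum_insert hi]
    rw [jet_add (hF i (Finset.mem_insert_self _ _)) h1,
      ih fun j hj => hF j (Finset.mem_insert_of_mem hj)]

theorem pd₁_mul {x : ℝ × ℝ} (hF : DifferentiableAt ℝ F x) (hG : DifferentiableAt ℝ G x) :
    pd₁ (fun x => F x * G x) x = pd₁ F x * G x + F x * pd₁ G x := by
  simp [pd₁, fderiv_fun_mul hF hG]; ring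

theorem pd₂_mul {x : ℝ × ℝ} (hF : DifferentiableAt ℝ F x) (hG : DifferentiableAt ℝ G x) :
    pd₂ (fun x => F x * G x) x = pd₂ F x * G x + F x * pd₂ G x := by
  simp [pd₂, fderiv_fun_mul hF hG]; ring

@[simp] theorem pd₁_fst (x : ℝ × ℝ) : pd₁ (fun x => x.1) x = 1 := by
  simp [pd₁, fderiv_fst]

@[simp] theorem pd₁_snd (x : ℝ × ℝ) : pd₁ (fun x => x.2) x = 0 := by
  simp [pd₁, fderiv_snd]

@[simp] theorem pd₂_fst (x : ℝ × ℝ) : pd₂ (fun x => x.1) x = 0 := by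
  simp [pd₂, fderiv_fst]

@[simp] theorem pd₂_snd (x : ℝ × ℝ) : pd₂ (fun x => x.2) x = 1 := by
  simp [pd₂, fderiv_snd]

theorem pd₁_fst_mul (hM : AnalyticAt ℝ M 0) :
    pd₁ (fun x => x.1 * M x) =ᶠ[𝓝 0] fun x => M x + x.1 * pd₁ M x := by
  filter_upwards [hM.eventually_analyticAt] with x h1
  rw [pd₁_mul differentiableAt_fst h1.differentiableAt]
  simp

theorem pd₂_fst_mul (hM : AnalyticAt ℝ M 0) :
    pd₂ (fun x => x.1 * M x) =ᶠ[𝓝 0] fun x => x.1 * pd₂ M x := by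
  filter_upwards [hM.eventually_analyticAt] with x h1
  rw [pd₂_mul differentiableAt_fst h1.differentiableAt]
  simp

theorem pd₁_snd_mul (hM : AnalyticAt ℝ M 0) :
    pd₁ (fun x => x.2 * M x) =ᶠ[𝓝 0] fun x => x.2 * pd₁ M x := by
  filter_upwards [hM.eventually_analyticAt] with x h1
  rw [pd₁_mul differentiableAt_snd h1.differentiableAt]
  simp

theorem pd₂_snd_mul (hM : AnalyticAt ℝ M 0) :
    pd₂ (fun x => x.2 * M x) =ᶠ[𝓝 0] fun x => M x + x.2 * pd₂ M x := by
  filter_upwards [hM.eventually_analyticAt] with x h1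
  rw [pd₂_mul differentiableAt_snd h1.differentiableAt]
  simp

theorem jet_zero_fst_mul (hM : AnalyticAt ℝ M 0) (n : ℕ) :
    jet 0 n (fun x => x.1 * M x) = 0 := by
  induction n generalizing M with
  | zero => simp [jet]
  | succ n ih =>
    rw [jet_succ_right (analyticAt_fst.fun_mul hM), jet_congr (pd₂_fst_mul hM), ih (analyticAt_pd₂ hM)]

theorem jet_succ_fst_mul (hM : AnalyticAt ℝ M 0) (m n : ℕ) :
    jet (m + 1) n (fun x => x.1 * M x) = (m + 1) * jet m n M := by
  induction m generalizing M with
  | zero =>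
    rw [jet_succ_left, jet_congr (pd₁_fst_mul hM),
      jet_add hM (analyticAt_fst.fun_mul (analyticAt_pd₁ hM)), jet_zero_fst_mul (analyticAt_pd₁ hM)]
    simp
  | succ m ih =>
    rw [jet_succ_left, jet_congr (pd₁_fst_mul hM),
      jet_add hM (analyticAt_fst.fun_mul (analyticAt_pd₁ hM)), ih (analyticAt_pd₁ hM),
      ← jet_succ_left]
    push_cast
    ring

theorem jet_zero_snd_mul (hM : AnalyticAt ℝ M 0) (m : ℕ) :
    jet m 0 (fun x => x.2 * M x) = 0 := by
  induction m generalizing M with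
  | zero => simp [jet]
  | succ n ih =>
    rw [jet_succ_left, jet_congr (pd₁_snd_mul hM), ih (analyticAt_pd₁ hM)]

theorem jet_succ_snd_mul (hM : AnalyticAt ℝ M 0) (m n : ℕ) :
    jet m (n + 1) (fun x => x.2 * M x) = (n + 1) * jet m n M := by
  induction n generalizing M with
  | zero =>
    rw [jet_succ_right (analyticAt_snd.fun_mul hM), jet_congr (pd₂_snd_mul hM),
      jet_add hM (analyticAt_snd.fun_mul (analyticAt_pd₂ hM)), jet_zero_snd_mul (analyticAt_pd₂ hM)]
    simp
  | succ n ih =>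
    rw [jet_succ_right (analyticAt_snd.fun_mul hM), jet_congr (pd₂_snd_mul hM),
      jet_add hM (analyticAt_snd.fun_mul (analyticAt_pd₂ hM)), ih (analyticAt_pd₂ hM),
      ← jet_succ_right hM]
    push_cast
    ring

/-- The contraction of a closed 1-form `M ds + K dτ` with the vector field `s ∂ₛ - 2 τ ∂_τ` has no
resonant Taylor coefficients. -/
theorem jet_closed (hM : AnalyticAt ℝ M 0) (hK : AnalyticAt ℝ K 0)
    (h : pd₂ M =ᶠ[𝓝 0] pd₁ K) (n : ℕ) :
    jet (2 * n) n (fun x => x.1 * M x - 2 * (x.2 * K x)) = 0 := by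
  rw [jet_sub (analyticAt_fst.fun_mul hM) (analyticAt_const.fun_mul (analyticAt_snd.fun_mul hK)),
    jet_const_mul _ (analyticAt_snd.fun_mul hK)]
  cases n with
  | zero => simp [jet]
  | succ n =>
    -- Multiplication by `s` and by `τ` brings out the degrees `2 n + 2` and `n + 1`. The weights
    -- `1` and `-2` make the two factors equal, leaving a derivative of `∂_τ M - ∂ₛ K`, which
    -- vanishes.
    rw [show 2 * (n + 1) = (2 * n + 1) + 1 by ring, jet_succ_fst_mul hM, jet_succ_snd_mul hK,
      jet_succ_right hM, jet_congr h, jet_succ_left (F := K)]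
    push_cast
    ring

/-- The derivative along the vector field `s ∂ₛ - 2 τ ∂_τ`. -/
def eulerD (F : ℝ × ℝ → ℝ) (x : ℝ × ℝ) : ℝ := x.1 * pd₁ F x - 2 * (x.2 * pd₂ F x)

theorem jet_eulerD (hF : AnalyticAt ℝ F 0) (n : ℕ) : jet (2 * n) n (eulerD F) = 0 :=
  jet_closed (analyticAt_pd₁ hF) (analyticAt_pd₂ hF) (pd₂_pd₁_comm hF) n

theorem analyticAt_eulerD {x : ℝ × ℝ} (hF : AnalyticAt ℝ F x) : AnalyticAt ℝ (eulerD F) x :=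
  (analyticAt_fst.fun_mul (analyticAt_pd₁ hF)).sub
    (analyticAt_const.fun_mul (analyticAt_snd.fun_mul (analyticAt_pd₂ hF)))

theorem isBigO_clm_apply {E : Type*} [NormedAddCommGroup E] [NormedSpace ℝ E]
    {D : E → E →L[ℝ] ℝ} {g : E → ℝ} (h : D =O[𝓝 0] g) (v : E) : (fun x => D x v) =O[𝓝 0] g := by
  refine IsBigO.trans (IsBigO.of_bound ‖v‖ (Eventually.of_forall fun x => ?_)) h
  rw [mul_comm]
  exact (D x).le_opNorm v

theorem jet_eq_zero_of_isBigO (hF : AnalyticAt ℝ F 0) {k m n : ℕ} (hk : m + n < k)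
    (h : F =O[𝓝 0] fun x => ‖x‖ ^ k) : jet m n F = 0 := by
  induction m generalizing F k with
  | zero =>
    induction n generalizing F k with
    | zero =>
      have := eq_zero_of_isBigO_norm_pow h (by omega)
      exact this
    | succ n ih =>
      obtain ⟨k, rfl⟩ : ∃ j, k = j + 1 := ⟨k - 1, by omega⟩
      rw [jet_succ_right hF]
      exact ih (analyticAt_pd₂ hF) (by omega) (isBigO_clm_apply (isBigO_fderiv hF h) _)
  | succ m ih =>
    obtain ⟨k, rfl⟩ : ∃ j, k = j + 1 := ⟨k - 1, by omega⟩
    rw [jet_succ_left]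
    exact ih (analyticAt_pd₁ hF) (by omega) (isBigO_clm_apply (isBigO_fderiv hF h) _)

theorem pd₁_eq_fderiv {x : ℝ × ℝ} (h : DifferentiableAt ℝ F x) :
    pd₁ F x = fderiv ℝ (fun s => F (s, x.2)) x.1 1 := by
  have h1 : HasFDerivAt (fun s : ℝ => (s, x.2)) (ContinuousLinearMap.inl ℝ ℝ ℝ) x.1 :=
    hasFDerivAt_prodMk_left _ _
  have h2 : HasFDerivAt F (fderiv ℝ F x) ((fun s : ℝ => (s, x.2)) x.1) := h.hasFDerivAt
  have := (h2.comp x.1 h1).fderiv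
  rw [Function.comp_def] at this
  rw [this]
  simp [pd₁]

theorem pd₂_eq_fderiv {x : ℝ × ℝ} (h : DifferentiableAt ℝ F x) :
    pd₂ F x = fderiv ℝ (fun s => F (x.1, s)) x.2 1 := by
  have h1 : HasFDerivAt (fun s : ℝ => (x.1, s)) (ContinuousLinearMap.inr ℝ ℝ ℝ) x.2 :=
    hasFDerivAt_prodMk_right _ _
  have h2 : HasFDerivAt F (fderiv ℝ F x) ((fun s : ℝ => (x.1, s)) x.2) := h.hasFDerivAt
  have := (h2.comp x.2 h1).fderiv
  rw [Function.comp_def] at this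
  rw [this]
  simp [pd₂]

theorem jet_eq_zero_of_eventually (hF : AnalyticAt ℝ F 0)
    (h : ∀ᶠ τ in 𝓝 (0 : ℝ), F (0, τ) = 0) (n : ℕ) : jet 0 n F = 0 := by
  induction n generalizing F with
  | zero => exact h.self_of_nhds
  | succ n ih =>
    rw [jet_succ_right hF]
    refine ih (analyticAt_pd₂ hF) ?_
    have ht : Tendsto (fun τ : ℝ => ((0, τ) : ℝ × ℝ)) (𝓝 0) (𝓝 0) := by
      have : Continuous (fun τ : ℝ => ((0, τ) : ℝ × ℝ)) := by fun_prop
      exact this.tendsto' _ _ rfl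
    filter_upwards [h.eventually_nhds, ht.eventually hF.eventually_analyticAt] with τ h1 h2
    rw [pd₂_eq_fderiv h2.differentiableAt]
    have h3 : (fun s : ℝ => F (0, s)) =ᶠ[𝓝 τ] fun _ => 0 := h1
    simp [h3.fderiv_eq]

/-- Errors in this file are small in `s` but not in `τ`. The bound holds on each slice of constant
`τ` near `0`, so every coefficient of `s`-degree below `k` vanishes, whatever its `τ`-degree. -/
theorem jet_eq_zero_of_isBigO_fst (hF : AnalyticAt ℝ F 0) {k m n : ℕ} (hk : m < k)
    (h : F =O[𝓝 0] fun x => |x.1| ^ k) : jet m n F = 0 := by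
  have ht : Tendsto (fun τ : ℝ => ((0, τ) : ℝ × ℝ)) (𝓝 0) (𝓝 0) := by
    have : Continuous (fun τ : ℝ => ((0, τ) : ℝ × ℝ)) := by fun_prop
    exact this.tendsto' _ _ rfl
  have h' : ∀ᶠ τ in 𝓝 (0 : ℝ), (fun s => F (s, τ)) =O[𝓝 0] fun s => ‖s‖ ^ k := by
    obtain ⟨C, hC⟩ := h.bound
    filter_upwards [ht.eventually hC.eventually_nhds] with τ h1
    have h2 : Tendsto (fun s : ℝ => (s, τ)) (𝓝 0) (𝓝 (0, τ)) := by
      have : Continuous (fun s : ℝ => (s, τ)) := by fun_prop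
      exact this.tendsto' _ _ rfl
    refine IsBigO.of_bound C ?_
    filter_upwards [h2.eventually h1] with s hs
    simpa using hs
  clear h
  induction m generalizing F k with
  | zero =>
    refine jet_eq_zero_of_eventually hF ?_ n
    filter_upwards [h'] with τ h1
    exact eq_zero_of_isBigO_norm_pow h1 (by omega)
  | succ m ih =>
    obtain ⟨k, rfl⟩ : ∃ j, k = j + 1 := ⟨k - 1, by omega⟩
    rw [jet_succ_left]
    refine ih (analyticAt_pd₁ hF) (k := k) (by omega) ?_
    filter_upwards [h', ht.eventually hF.eventually_analyticAt] with τ h1 h2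
    have h3 : Tendsto (fun s : ℝ => (s, τ)) (𝓝 0) (𝓝 (0, τ)) := by
      have : Continuous (fun s : ℝ => (s, τ)) := by fun_prop
      exact this.tendsto' _ _ rfl
    have h4 : AnalyticAt ℝ (fun s : ℝ => F (s, τ)) 0 :=
      h2.fun_comp (f := fun s : ℝ => (s, τ)) (by fun_prop)
    refine (isBigO_clm_apply (isBigO_fderiv h4 h1) 1).congr' ?_ EventuallyEq.rfl
    filter_upwards [h3.eventually h2.eventually_analyticAt] with s hs
    rw [pd₁_eq_fderiv hs.differentiableAt]

theorem jet_monomial (m n : ℕ) :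
    jet m n (fun x => x.1 ^ m * x.2 ^ n) = m.factorial * n.factorial := by
  induction m with
  | zero =>
    induction n with
    | zero => simp [jet]
    | succ n ih =>
      have h1 : AnalyticAt ℝ (fun x : ℝ × ℝ => x.1 ^ 0 * x.2 ^ n) 0 := by fun_prop
      have h2 := jet_succ_snd_mul h1 0 n
      rw [ih] at h2
      rw [show (fun x : ℝ × ℝ => x.1 ^ 0 * x.2 ^ (n + 1)) =
        fun x => x.2 * (x.1 ^ 0 * x.2 ^ n) by ext x; ring, h2, Nat.factorial_succ]
      push_cast
      ring
  | succ m ih =>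
    have h1 : AnalyticAt ℝ (fun x : ℝ × ℝ => x.1 ^ m * x.2 ^ n) 0 := by fun_prop
    have h2 := jet_succ_fst_mul h1 m n
    rw [ih] at h2
    rw [show (fun x : ℝ × ℝ => x.1 ^ (m + 1) * x.2 ^ n) =
      fun x => x.1 * (x.1 ^ m * x.2 ^ n) by ext x; ring, h2, Nat.factorial_succ m]
    push_cast
    ring

theorem exists_leading_coeff {f : ℝ → ℝ} (hf : AnalyticAt ℝ f 0) {k : ℕ}
    (h : f =O[𝓝 0] fun t => |t| ^ k) :
    ∃ c : ℝ, (fun t => f t - c * t ^ k) =O[𝓝 0] fun t => |t| ^ (k + 1) := by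
  obtain ⟨p, hp⟩ := hf
  have h1 := hp.isBigO_sub_partialSum_pow (k + 1)
  simp only [zero_add] at h1
  refine ⟨p k fun _ => 1, h1.congr_left fun t => ?_⟩
  rw [sub_partialSum_succ (coeff_diag_eq_zero hp h)]
  have := (p k).map_smul_univ (fun _ => t) (fun _ => 1)
  simp only [smul_eq_mul, mul_one, Finset.prod_const, Finset.card_univ, Fintype.card_fin] at this
  rw [this]
  ring

theorem isBigO_fst_of_comp {f : ℝ → ℝ} {k : ℕ} (h : f =O[𝓝 0] fun t => |t| ^ k) :
    (fun x : ℝ × ℝ => f (x.1 ^ 2 * x.2)) =O[𝓝 0] fun x => |x.1| ^ (2 * k) := by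
  have ht : Tendsto (fun x : ℝ × ℝ => x.1 ^ 2 * x.2) (𝓝 0) (𝓝 0) := by
    have : Continuous (fun x : ℝ × ℝ => x.1 ^ 2 * x.2) := by fun_prop
    exact this.tendsto' _ _ (by simp)
  refine (h.comp_tendsto ht).trans ?_
  refine IsBigO.of_bound 1 ?_
  have h1 : ∀ᶠ x : ℝ × ℝ in 𝓝 0, |x.2| < 1 := by
    have : ContinuousAt (fun x : ℝ × ℝ => |x.2|) 0 := by fun_prop
    exact this.eventually_lt continuousAt_const (by simp)
  filter_upwards [h1] with x hx
  simp only [Function.comp_apply, Real.norm_eq_abs, abs_pow, abs_abs, abs_mul, mul_pow, ← pow_mul]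
  rw [one_mul]
  exact mul_le_of_le_one_right (by positivity) (pow_le_one₀ (abs_nonneg _) hx.le)

/-- Under `t = s² τ` the monomial `tⁿ` becomes `s^{2n} τⁿ`, so the resonant coefficients of the
composite are the Taylor coefficients of `f` times `(2n)! n! / n!` and a further `n!`-free
normalisation is unnecessary: only their vanishing is used. -/
theorem isBigO_of_jet_eq_zero {f : ℝ → ℝ} (hf : AnalyticAt ℝ f 0) {N : ℕ}
    (h : ∀ n < N, jet (2 * n) n (fun x => f (x.1 ^ 2 * x.2)) = 0) :
    f =O[𝓝 0] fun t => |t| ^ N := by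
  induction N with
  | zero => simpa using hf.continuousAt.isBigO_one ℝ
  | succ k ih =>
    obtain ⟨c, hc⟩ := exists_leading_coeff hf (ih fun n hn => h n (by omega))
    have hg : AnalyticAt ℝ (fun t : ℝ => c * t ^ k) 0 := by fun_prop
    have ha : ∀ {f : ℝ → ℝ}, AnalyticAt ℝ f 0 →
        AnalyticAt ℝ (fun x : ℝ × ℝ => f (x.1 ^ 2 * x.2)) 0 := by
      intro f hf
      refine AnalyticAt.fun_comp (f := fun x : ℝ × ℝ => x.1 ^ 2 * x.2) ?_ (by fun_prop)
      simpa using hf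
    have h1 := jet_eq_zero_of_isBigO_fst (ha (hf.fun_sub hg)) (m := 2 * k) (n := k) (by omega)
      (isBigO_fst_of_comp hc)
    have h2 := jet_sub (ha hf) (ha hg) (2 * k) k
    rw [h k (by omega)] at h2
    have h3 := jet_const_mul c (by fun_prop : AnalyticAt ℝ
      (fun x : ℝ × ℝ => x.1 ^ (2 * k) * x.2 ^ k) 0) (2 * k) k
    rw [jet_monomial] at h3
    have h4 : (fun x : ℝ × ℝ => c * (x.1 ^ (2 * k) * x.2 ^ k)) =
        fun x => c * (x.1 ^ 2 * x.2) ^ k := by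
      ext x; rw [mul_pow, pow_mul]
    rw [h4] at h3
    have h5 : c = 0 := by
      have h6 : c * ((2 * k).factorial * k.factorial : ℝ) = 0 := by
        rw [← h3]
        change jet (2 * k) k (fun x => f (x.1 ^ 2 * x.2) - c * (x.1 ^ 2 * x.2) ^ k) = 0 at h1
        rw [h1] at h2
        linarith
      have : ((2 * k).factorial * k.factorial : ℝ) ≠ 0 := by positivity
      exact (mul_eq_zero.mp h6).resolve_right this
    simpa [h5] using hc

end Jets

/-! ### The elliptic integral in the variables `y`, `h / y`, `j₂ / y`, and its residues. -/

/-- The integrand `w / (1 - ζ²)` in the variables `y = ζ - 1`, `u = h / y`, `v = j₂ / y`. -/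
def branch (x : Fin 3 → ℂ) : ℂ :=
  -((4 + 2 * x 0) * (1 - x 1) - x 2 ^ 2) ^ (1 / 2 : ℂ) / (2 + x 0)

/-- The restriction of `branch` to real arguments. -/
def realBranch (x : Fin 3 → ℝ) : ℝ :=
  -√((4 + 2 * x 0) * (1 - x 1) - x 2 ^ 2) / (2 + x 0)

@[fun_prop]
theorem analyticAt_apply {𝕜 ι : Type*} [RCLike 𝕜] [Fintype ι] (i : ι) (x : ι → 𝕜) :
    AnalyticAt 𝕜 (fun x : ι → 𝕜 => x i) x :=
  (ContinuousLinearMap.proj (R := 𝕜) (φ := fun _ : ι => 𝕜) i).analyticAt x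

theorem analyticAt_branch : AnalyticAt ℂ branch 0 := by
  unfold branch
  refine AnalyticAt.fun_div (AnalyticAt.fun_neg (AnalyticAt.cpow (by fun_prop) (by fun_prop) ?_))
    (by fun_prop) ?_
  · left; simp
  · simp

theorem branch_ofReal {x : Fin 3 → ℝ} (hx : 0 < (4 + 2 * x 0) * (1 - x 1) - x 2 ^ 2) :
    branch (fun i => (x i : ℂ)) = realBranch x := by
  have h : ((4 + 2 * (x 0 : ℂ)) * (1 - x 1) - (x 2 : ℂ) ^ 2) =
      (((4 + 2 * x 0) * (1 - x 1) - x 2 ^ 2 : ℝ) : ℂ) := by push_cast; ring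
  rw [branch, realBranch, h, Real.sqrt_eq_rpow, Complex.ofReal_div, Complex.ofReal_neg,
    Complex.ofReal_cpow hx.le]
  push_cast
  rfl

/-- The factor `ζ - 1` of `curveW` cancels against `1 - ζ² = -(ζ - 1)(ζ + 1)`, which is the origin
of the minus sign in `branch`. The radicands coincide, so no choice of root is involved. -/
theorem curveW_div_eq {h j : ℝ} {ζ : ℂ} (h1 : ζ ≠ 1) :
    curveW h j ζ / (1 - ζ ^ 2) = branch ![ζ - 1, h / (ζ - 1), j / (ζ - 1)] := by
  have h1' : ζ - 1 ≠ 0 := sub_ne_zero.mpr h1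
  have hP : curvePoly h j ζ / (ζ - 1) ^ 2 =
      (4 + 2 * (ζ - 1)) * (1 - h / (ζ - 1)) - (j / (ζ - 1)) ^ 2 := by
    unfold curvePoly
    field_simp
    ring
  simp only [curveW, branch, hP, Matrix.cons_val_zero, Matrix.cons_val_one, Matrix.cons_val]
  -- The point `ζ = -1` lies off the contours; there both denominators vanish and both quotients are
  -- `0` by convention.
  by_cases h2 : ζ + 1 = 0
  · have h3 : 1 - ζ ^ 2 = 0 := by linear_combination (1 - ζ) * h2
    have h4 : 2 + (ζ - 1) = 0 := by linear_combination h2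
    rw [h3, h4]; simp
  · have h3 : 1 - ζ ^ 2 ≠ 0 := by
      rw [show 1 - ζ ^ 2 = -((ζ - 1) * (ζ + 1)) by ring]
      exact neg_ne_zero.mpr (mul_ne_zero h1' h2)
    have h4 : 2 + (ζ - 1) ≠ 0 := by rwa [show 2 + (ζ - 1) = ζ + 1 by ring]
    rw [div_eq_div_iff h3 h4]
    ring

/-- From `Re y ≥ -1` the term `4 + 2 y` has real part at least `2`. Since `|h / y|` and `|j / y|`
are at most `ρ`, the rest is at most `6 ρ + ρ² ≤ 25 / 16`. The principal root is therefore
holomorphic on the whole annulus between the radii `ρ` and `1`. -/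
theorem re_radicand_pos {ρ : ℝ} (h0 : 0 < ρ) (hρ : ρ ≤ 1 / 4) {h j : ℝ} (hh : |h| ≤ ρ ^ 2)
    (hj : |j| ≤ ρ ^ 2) {y : ℂ} (h1 : ρ ≤ ‖y‖) (h2 : ‖y‖ ≤ 1) :
    0 < ((4 + 2 * y) * (1 - h / y) - (j / y) ^ 2).re := by
  have hq : ∀ t : ℝ, |t| ≤ ρ ^ 2 → ‖(t / y : ℂ)‖ ≤ ρ := by
    intro t ht
    rw [norm_div, Complex.norm_real, Real.norm_eq_abs, div_le_iff₀ (h0.trans_le h1)]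
    nlinarith
  have e : (4 + 2 * y) * (1 - h / y) - (j / y) ^ 2 =
      4 + (2 * y - ((4 + 2 * y) * (h / y) + (j / y) ^ 2)) := by ring
  rw [e, Complex.add_re, Complex.sub_re]
  have hn : ‖(4 + 2 * y) * (h / y) + (j / y) ^ 2‖ ≤ 6 * ρ + ρ ^ 2 := by
    refine (norm_add_le _ _).trans (add_le_add ?_ ?_)
    · rw [norm_mul]
      refine mul_le_mul ?_ (hq h hh) (norm_nonneg _) (by norm_num)
      refine (norm_add_le _ _).trans ?_
      rw [norm_mul]
      norm_num
      linarith
    · rw [norm_pow]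
      exact pow_le_pow_left₀ (norm_nonneg _) (hq j hj) 2
  have hle := (Complex.re_le_norm _).trans hn
  have hre := (abs_le.mp ((Complex.abs_re_le_norm y).trans h2)).1
  have : (2 * y : ℂ).re = 2 * y.re := by simp
  rw [this]
  have : (4 : ℂ).re = 4 := rfl
  rw [this]
  nlinarith

theorem differentiableAt_branch {ρ : ℝ} (h0 : 0 < ρ) (hρ : ρ ≤ 1 / 4) {h j : ℝ}
    (hh : |h| ≤ ρ ^ 2) (hj : |j| ≤ ρ ^ 2) (ζ : ℂ) (h1 : ρ ≤ ‖ζ - 1‖) (h2 : ‖ζ - 1‖ ≤ 1) :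
    DifferentiableAt ℂ (fun ζ : ℂ => branch ![ζ - 1, h / (ζ - 1), j / (ζ - 1)]) ζ := by
  have hne : ζ - 1 ≠ 0 := norm_pos_iff.mp (h0.trans_le h1)
  simp only [branch, Matrix.cons_val_zero, Matrix.cons_val_one, Matrix.cons_val]
  refine DifferentiableAt.fun_div (DifferentiableAt.fun_neg (DifferentiableAt.cpow ?_ ?_ ?_)) ?_ ?_
  · fun_prop (disch := exact hne)
  · fun_prop
  · exact Or.inl (re_radicand_pos h0 hρ hh hj h1 h2)
  · fun_prop
  · intro hz
    have : ‖ζ - 1‖ = 2 := by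
      rw [show ζ - 1 = -2 by linear_combination hz]; simp
    linarith

/-- The contour of the elliptic integral may be shrunk. -/
theorem ellipticIntegral_eq {ρ : ℝ} (h0 : 0 < ρ) (hρ : ρ ≤ 1 / 4) {h j : ℝ} (hh : |h| ≤ ρ ^ 2)
    (hj : |j| ≤ ρ ^ 2) :
    ellipticIntegral h j = 2 * ((2 * Real.pi * Complex.I)⁻¹ *
      ∮ ζ in C(1, ρ), branch ![ζ - 1, h / (ζ - 1), j / (ζ - 1)]) := by
  have hd := differentiableAt_branch h0 hρ hh hj
  rw [ellipticIntegral]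
  congr 2
  rw [← Complex.circleIntegral_eq_of_differentiable_on_annulus_off_countable h0
    (by linarith : ρ ≤ 1) Set.countable_empty]
  · refine circleIntegral.integral_congr zero_le_one fun ζ hζ => curveW_div_eq ?_
    rintro rfl
    simp at hζ
  · intro ζ hζ
    simp only [Set.mem_sdiff, Metric.mem_closedBall, Metric.mem_ball, dist_eq_norm, not_lt] at hζ
    exact (hd ζ hζ.2 hζ.1).continuousAt.continuousWithinAt
  · intro ζ hζ
    simp only [Set.mem_sdiff, Metric.mem_closedBall, Metric.mem_ball, dist_eq_norm, not_le] at hζ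
    exact hd ζ hζ.1.2.le hζ.1.1.le

theorem circleIntegral_zpow {ρ : ℝ} (h0 : ρ ≠ 0) (n : ℤ) :
    (∮ ζ in C(1, ρ), (ζ - 1) ^ n) = if n = -1 then 2 * Real.pi * Complex.I else 0 := by
  split_ifs with hn
  · subst hn
    simp only [zpow_neg_one]
    exact circleIntegral.integral_sub_center_inv _ h0
  · exact circleIntegral.integral_sub_zpow_of_ne hn _ _ _

theorem circleIntegral_monomial {ρ : ℝ} (h0 : 0 < ρ) (h j : ℂ) (a b c : ℕ) :
    (∮ ζ in C(1, ρ), (ζ - 1) ^ a * (h / (ζ - 1)) ^ b * (j / (ζ - 1)) ^ c) =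
      if a + 1 = b + c then h ^ b * j ^ c * (2 * Real.pi * Complex.I) else 0 := by
  have e : Set.EqOn (fun ζ : ℂ => (ζ - 1) ^ a * (h / (ζ - 1)) ^ b * (j / (ζ - 1)) ^ c)
      (fun ζ => h ^ b * j ^ c * (ζ - 1) ^ ((a : ℤ) - b - c)) (Metric.sphere 1 ρ) := by
    intro ζ hζ
    have hne : ζ - 1 ≠ 0 := by
      intro h1
      rw [mem_sphere_iff_norm, h1, norm_zero] at hζ
      exact h0.ne hζ
    simp only [zpow_sub₀ hne, zpow_natCast, div_pow]
    field_simp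
  rw [circleIntegral.integral_congr h0.le e, circleIntegral.integral_const_mul,
    circleIntegral_zpow h0.ne']
  by_cases hk : a + 1 = b + c
  · rw [if_pos (by omega), if_pos hk]
  · rw [if_neg (by omega), if_neg hk, mul_zero]

theorem circleIntegrable_monomial {ρ : ℝ} (h0 : 0 < ρ) (h j : ℂ) (a b c : ℕ) :
    CircleIntegrable (fun ζ => (ζ - 1) ^ a * (h / (ζ - 1)) ^ b * (j / (ζ - 1)) ^ c) 1 ρ := by
  refine ContinuousOn.circleIntegrable h0.le fun ζ hζ => ContinuousAt.continuousWithinAt ?_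
  have hne : ζ - 1 ≠ 0 := by
    intro h1
    rw [mem_sphere_iff_norm, h1, norm_zero] at hζ
    exact h0.ne hζ
  fun_prop (disch := exact hne)

open Classical in
/-- The sum of the terms of `P(y, h / y, j / y)` that contribute to its residue at `y = 0`. -/
def residueSum {R : Type*} [CommSemiring R] (s : Finset (Fin 3 →₀ ℕ)) (c : (Fin 3 →₀ ℕ) → R)
    (h j : R) : R :=
  ∑ μ ∈ s with μ 0 + 1 = μ 1 + μ 2, c μ * (h ^ μ 1 * j ^ μ 2)

/-- Giving `h` and `j` the size `ρ²` makes all three arguments `y`, `h / y`, `j / y` of size at most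
`ρ` on the circle of radius `ρ`, so a Taylor remainder of order `M` is `O(ρ ^ M)` there; the length
of the circle supplies one more power. The Taylor polynomial itself is integrated by residues. -/
theorem ellipticIntegral_estimate {P : MvPolynomial (Fin 3) ℂ} {M : ℕ}
    (hP : (fun x => branch x - MvPolynomial.eval x P) =O[𝓝 0] fun x => ‖x‖ ^ M) :
    ∃ C ρ₀ : ℝ, 0 ≤ C ∧ 0 < ρ₀ ∧ ∀ ρ, 0 < ρ → ρ < ρ₀ → ∀ h j : ℝ, |h| ≤ ρ ^ 2 → |j| ≤ ρ ^ 2 →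
      ‖ellipticIntegral h j - 2 * residueSum P.support (fun μ => P.coeff μ) (h : ℂ) (j : ℂ)‖ ≤
        C * ρ ^ (M + 1) := by
  classical
  obtain ⟨C, hC0, hC⟩ := hP.exists_pos
  obtain ⟨δ, hδ, hball⟩ := Metric.eventually_nhds_iff_ball.mp hC.bound
  refine ⟨2 * C, min δ (1 / 4), by positivity, by positivity, fun ρ h0 hρ h j hh hj => ?_⟩
  have hρ1 : ρ < 1 / 4 := hρ.trans_le (min_le_right _ _)
  have hρ2 : ρ < δ := hρ.trans_le (min_le_left _ _)
  rw [ellipticIntegral_eq h0 hρ1.le hh hj]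
  have hpt : ∀ ζ ∈ Metric.sphere (1 : ℂ) ρ, ‖branch ![ζ - 1, h / (ζ - 1), j / (ζ - 1)] -
      MvPolynomial.eval ![ζ - 1, h / (ζ - 1), j / (ζ - 1)] P‖ ≤ C * ρ ^ M := by
    intro ζ hζ
    rw [mem_sphere_iff_norm] at hζ
    have hn : ‖![ζ - 1, h / (ζ - 1), j / (ζ - 1)]‖ ≤ ρ := by
      have hq : ∀ t : ℝ, |t| ≤ ρ ^ 2 → ‖(t / (ζ - 1) : ℂ)‖ ≤ ρ := by
        intro t ht
        rw [norm_div, Complex.norm_real, Real.norm_eq_abs, hζ, div_le_iff₀ h0]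
        nlinarith
      rw [pi_norm_le_iff_of_nonneg h0.le]
      intro i
      fin_cases i
      · exact hζ.le
      · exact hq h hh
      · exact hq j hj
    refine (hball _ (by simpa using hn.trans_lt hρ2)).trans ?_
    rw [Real.norm_eq_abs, abs_of_nonneg (by positivity)]
    gcongr
  have hcP : ∀ ζ : ℂ, MvPolynomial.eval ![ζ - 1, h / (ζ - 1), j / (ζ - 1)] P =
      ∑ μ ∈ P.support, P.coeff μ * ((ζ - 1) ^ μ 0 * (h / (ζ - 1)) ^ μ 1 * (j / (ζ - 1)) ^ μ 2) := by
    intro ζ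
    rw [MvPolynomial.eval_eq']
    simp [Fin.prod_univ_three]
  have hi : ∀ μ ∈ P.support, CircleIntegrable (fun ζ => P.coeff μ * ((ζ - 1) ^ μ 0 *
      (h / (ζ - 1)) ^ μ 1 * (j / (ζ - 1)) ^ μ 2)) 1 ρ := fun μ _ =>
    (circleIntegrable_monomial h0 h j _ _ _).const_mul _
  have hsum : (∮ ζ in C(1, ρ), MvPolynomial.eval ![ζ - 1, h / (ζ - 1), j / (ζ - 1)] P) =
      2 * Real.pi * Complex.I * residueSum P.support (fun μ => P.coeff μ) (h : ℂ) (j : ℂ) := by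
    simp only [hcP]
    rw [circleIntegral.integral_fun_sum hi, residueSum, Finset.sum_filter, Finset.mul_sum]
    refine Finset.sum_congr rfl fun μ _ => ?_
    rw [circleIntegral.integral_const_mul, circleIntegral_monomial h0]
    split_ifs <;> ring
  have hbi : CircleIntegrable (fun ζ => branch ![ζ - 1, h / (ζ - 1), j / (ζ - 1)]) 1 ρ := by
    refine ContinuousOn.circleIntegrable h0.le fun ζ hζ => ContinuousAt.continuousWithinAt ?_
    rw [mem_sphere_iff_norm] at hζ
    exact (differentiableAt_branch h0 hρ1.le hh hj ζ hζ.ge (by linarith)).continuousAt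
  have hPi : CircleIntegrable
      (fun ζ => MvPolynomial.eval ![ζ - 1, h / (ζ - 1), j / (ζ - 1)] P) 1 ρ := by
    simp only [hcP]
    exact CircleIntegrable.fun_sum _ hi
  have hpi : (2 * Real.pi * Complex.I : ℂ) ≠ 0 := Complex.two_pi_I_ne_zero
  have hres : residueSum P.support (fun μ => P.coeff μ) (h : ℂ) (j : ℂ) =
      (2 * Real.pi * Complex.I)⁻¹ *
        ∮ ζ in C(1, ρ), MvPolynomial.eval ![ζ - 1, h / (ζ - 1), j / (ζ - 1)] P := by
    rw [hsum, inv_mul_cancel_left₀ hpi]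
  rw [hres, ← mul_sub, ← mul_sub, ← circleIntegral.integral_sub hbi hPi, norm_mul, norm_mul]
  have hfin := circleIntegral.norm_integral_le_of_norm_le_const h0.le hpt
  have hn : ‖(2 * Real.pi * Complex.I : ℂ)⁻¹‖ = (2 * Real.pi)⁻¹ := by
    simp [abs_of_pos Real.pi_pos]
  rw [hn]
  calc ‖(2 : ℂ)‖ * ((2 * Real.pi)⁻¹ * _) ≤ 2 * ((2 * Real.pi)⁻¹ * (2 * Real.pi * ρ * (C * ρ ^ M))) := by
        rw [Complex.norm_ofNat]
        gcongr
    _ = 2 * C * ρ ^ (M + 1) := by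
        field_simp
        try ring

/-! ### Analyticity and reality of the elliptic integral. -/

/-- Integration over a circle as a continuous linear functional on the continuous functions. -/
theorem exists_circleIntegral_clm (c : ℂ) {ρ : ℝ} (h0 : 0 ≤ ρ) :
    ∃ l : C(Metric.sphere c ρ, ℂ) →L[ℝ] ℂ, ∀ (f : C(Metric.sphere c ρ, ℂ)) (F : ℂ → ℂ),
      (∀ z : Metric.sphere c ρ, F z = f z) → l f = ∮ ζ in C(c, ρ), F ζ := by
  classical
  let ext : C(Metric.sphere c ρ, ℂ) → ℂ → ℂ := fun f => Function.extend Subtype.val f 0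
  have hext : ∀ f (z : Metric.sphere c ρ), ext f z = f z := fun f z =>
    Subtype.val_injective.extend_apply _ _ _
  have hcont : ∀ f, CircleIntegrable (ext f) c ρ := by
    intro f
    refine ContinuousOn.circleIntegrable h0 ?_
    rw [continuousOn_iff_continuous_domRestrict]
    have : (Metric.sphere c ρ).domRestrict (ext f) = f := by
      ext z; exact hext f z
    rw [this]
    exact f.continuous
  let l₀ : C(Metric.sphere c ρ, ℂ) →ₗ[ℝ] ℂ :=
    { toFun := fun f => ∮ ζ in C(c, ρ), ext f ζ
      map_add' := by
        intro f g
        rw [← circleIntegral.integral_add (hcont f) (hcont g)]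
        refine circleIntegral.integral_congr h0 fun ζ hζ => ?_
        have := hext (f + g) ⟨ζ, hζ⟩
        have h1 := hext f ⟨ζ, hζ⟩
        have h2 := hext g ⟨ζ, hζ⟩
        simp only at this h1 h2
        simp only [this, h1, h2, ContinuousMap.add_apply]
      map_smul' := by
        intro a f
        rw [RingHom.id_apply, ← circleIntegral.integral_smul]
        refine circleIntegral.integral_congr h0 fun ζ hζ => ?_
        have := hext (a • f) ⟨ζ, hζ⟩
        have h1 := hext f ⟨ζ, hζ⟩
        simp only at this h1
        simp only [this, h1, ContinuousMap.smul_apply] }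
  refine ⟨l₀.mkContinuous (2 * Real.pi * ρ) fun f => ?_, fun f F hF => ?_⟩
  · refine circleIntegral.norm_integral_le_of_norm_le_const h0 fun ζ hζ => ?_
    have h1 := hext f ⟨ζ, hζ⟩
    simp only at h1
    change ‖ext f ζ‖ ≤ _
    rw [h1]
    exact f.norm_coe_le_norm _
  · rw [LinearMap.mkContinuous_apply]
    refine circleIntegral.integral_congr h0 fun ζ hζ => ?_
    have h1 := hext f ⟨ζ, hζ⟩
    have h2 := hF ⟨ζ, hζ⟩
    simp only at h1 h2
    change ext f ζ = F ζ
    rw [h1, h2]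

/-- Square roots depend analytically on the radicand in a commutative Banach algebra. -/
theorem exists_analytic_sqrt {A : Type*} [NormedCommRing A] [NormedAlgebra ℝ A] [CompleteSpace A]
    {g : A} (hg : IsUnit g) : ∃ s : A → A, AnalyticAt ℝ s 0 ∧ s 0 = 0 ∧
      ∀ᶠ t in 𝓝 (0 : A), (g + s t) ^ 2 = g ^ 2 + t := by
  obtain ⟨u, rfl⟩ := hg
  -- For `k = s t` the equation `(u + k)² = u² + t` reads `2 u k + k² = t`; its linear part `2 u` is
  -- invertible, so the inverse function theorem applies.
  let f : A → A := fun k => 2 * (u : A) * k + k ^ 2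
  have hf : AnalyticAt ℝ f 0 := by fun_prop
  let L : A →L[ℝ] A := (2 : ℝ) • ContinuousLinearMap.mul ℝ A (u : A)
  let L' : A →L[ℝ] A := (2 : ℝ)⁻¹ • ContinuousLinearMap.mul ℝ A (↑u⁻¹ : A)
  let e : A ≃L[ℝ] A := ContinuousLinearEquiv.equivOfInverse L L'
    (fun x => by simp [L, L', smul_smul]) (fun x => by simp [L, L', smul_smul])
  have he : fderiv ℝ f 0 = e := by
    have h1 : HasFDerivAt (fun k : A => k ^ 2) (0 : A →L[ℝ] A) 0 := by
      have := (hasFDerivAt_id (𝕜 := ℝ) (0 : A)).pow 2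
      simpa using this
    have h2 : HasFDerivAt f (L + 0) 0 := by
      have h3 : f = fun k => L k + k ^ 2 := by
        ext k
        simp [f, L, two_smul, two_mul, add_mul]
      rw [h3]
      exact L.hasFDerivAt.add h1
    rw [h2.fderiv, add_zero]
    rfl
  obtain ⟨s, hs, hs0, -, hs2⟩ := exists_analytic_inverse hf (by simp [f]) e he
  refine ⟨s, hs, hs0, ?_⟩
  filter_upwards [hs2] with t ht
  calc ((u : A) + s t) ^ 2 = (u : A) ^ 2 + f (s t) := by simp only [f]; ring
    _ = _ := by rw [ht]

theorem sqrt_eq_of_sq {w a : ℂ} (h : w ^ 2 = a) (hw : 0 < w.re) : a ^ (1 / 2 : ℂ) = w := by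
  rw [← h, one_div, Complex.sq_cpow_two_inv hw]

theorem re_sqrt_pos {a : ℂ} (ha : 0 < a.re) : 0 < (a ^ (1 / 2 : ℂ)).re := by
  have h0 : a ≠ 0 := by rintro rfl; simp at ha
  rw [Complex.cpow_def_of_ne_zero h0, Complex.exp_re]
  have harg := Complex.abs_arg_lt_pi_div_two_iff.mpr (Or.inl ha)
  have him : (Complex.log a * (1 / 2)).im = a.arg / 2 := by
    rw [show (1 / 2 : ℂ) = ((1 / 2 : ℝ) : ℂ) by push_cast; rfl, Complex.im_mul_ofReal,
      Complex.log_im]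
    ring
  rw [him]
  refine mul_pos (Real.exp_pos _) (Real.cos_pos_of_mem_Ioo ?_)
  rw [abs_lt] at harg
  constructor <;> linarith [harg.1, harg.2, Real.pi_pos]

theorem eventually_abs_le {ε : ℝ} (hε : 0 < ε) :
    ∀ᶠ x : ℝ × ℝ in 𝓝 0, |x.1| ≤ ε ∧ |x.2| ≤ ε := by
  filter_upwards [Metric.ball_mem_nhds (0 : ℝ × ℝ) hε] with x hx
  rw [mem_ball_zero_iff] at hx
  exact ⟨(norm_fst_le x).trans hx.le, (norm_snd_le x).trans hx.le⟩

/-- The integrand is treated as an element of the Banach algebra of continuous functions on a fixed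
circle. The radicand is polynomial in `(h, j₂)`, the square root is an analytic map near the unit
`g`, and integration is linear and continuous; no differentiation under the integral is needed. -/
theorem analyticAt_ellipticIntegral :
    AnalyticAt ℝ (fun x : ℝ × ℝ => (ellipticIntegral x.1 x.2).re) 0 := by
  let S := Metric.sphere (1 : ℂ) (1 / 4)
  have hS : ∀ ζ : S, ‖(ζ : ℂ) - 1‖ = 1 / 4 := fun ζ => mem_sphere_iff_norm.mp ζ.2
  have hne : ∀ ζ : S, (ζ : ℂ) - 1 ≠ 0 := fun ζ h => by
    have := hS ζ
    rw [h, norm_zero] at this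
    norm_num at this
  have hne2 : ∀ ζ : S, 2 + ((ζ : ℂ) - 1) ≠ 0 := fun ζ h => by
    have := hS ζ
    rw [show (ζ : ℂ) - 1 = -2 by linear_combination h] at this
    norm_num at this
  have hpos : ∀ ζ : S, 0 < (4 + 2 * ((ζ : ℂ) - 1)).re := fun ζ => by
    have := (abs_le.mp ((Complex.abs_re_le_norm ((ζ : ℂ) - 1)).trans (hS ζ).le)).1
    have e : (4 + 2 * ((ζ : ℂ) - 1)).re = 4 + 2 * ((ζ : ℂ) - 1).re := by simp
    rw [e]
    linarith
  let g : C(S, ℂ) := ⟨fun ζ => (4 + 2 * ((ζ : ℂ) - 1)) ^ (1 / 2 : ℂ), by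
    refine Continuous.cpow (by fun_prop) (by fun_prop) fun ζ => Or.inl (hpos ζ)⟩
  have hg_re : ∀ ζ : S, 0 < (g ζ).re := fun ζ => re_sqrt_pos (hpos ζ)
  have hg_sq : ∀ ζ : S, g ζ ^ 2 = 4 + 2 * ((ζ : ℂ) - 1) := fun ζ => by
    change ((4 + 2 * ((ζ : ℂ) - 1)) ^ (1 / 2 : ℂ)) ^ 2 = _
    rw [← Complex.cpow_nat_mul]
    norm_num
  have hg : IsUnit g := by
    rw [ContinuousMap.isUnit_iff_forall_ne_zero]
    intro ζ h
    have := hg_re ζ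
    rw [h] at this
    simp at this
  obtain ⟨s, hs, hs0, hsq⟩ := exists_analytic_sqrt hg
  let k₁ : C(S, ℂ) := ⟨fun ζ => -((4 + 2 * ((ζ : ℂ) - 1)) / ((ζ : ℂ) - 1)),
    by fun_prop (disch := exact hne _)⟩
  let k₂ : C(S, ℂ) := ⟨fun ζ => -(1 / ((ζ : ℂ) - 1)) ^ 2, by fun_prop (disch := exact hne _)⟩
  let k₃ : C(S, ℂ) := ⟨fun ζ => -(1 / (2 + ((ζ : ℂ) - 1))), by fun_prop (disch := exact hne2 _)⟩
  let t : ℝ × ℝ → C(S, ℂ) := fun x => x.1 • k₁ + x.2 ^ 2 • k₂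
  have ht : AnalyticAt ℝ t 0 := by fun_prop
  have ht0 : t 0 = 0 := by simp [t]
  have hst : AnalyticAt ℝ (fun x => s (t x)) 0 := AnalyticAt.fun_comp (by rwa [ht0]) ht
  obtain ⟨l, hl⟩ := exists_circleIntegral_clm (1 : ℂ) (ρ := 1 / 4) (by norm_num)
  have hA : AnalyticAt ℝ (fun x => (2 * ((2 * Real.pi * Complex.I)⁻¹ * l (k₃ * (g + s (t x))))).re)
      0 := by
    have h0 : AnalyticAt ℝ (fun x => k₃ * (g + s (t x))) 0 :=
      analyticAt_const.fun_mul (analyticAt_const.fun_add hst)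
    have h1 : AnalyticAt ℝ (fun x => l (k₃ * (g + s (t x)))) 0 := (l.analyticAt _).fun_comp h0
    have h2 : AnalyticAt ℝ (fun x => 2 * ((2 * Real.pi * Complex.I)⁻¹ *
        l (k₃ * (g + s (t x))))) 0 :=
      analyticAt_const.fun_mul (analyticAt_const.fun_mul h1)
    exact (Complex.reCLM.analyticAt _).comp h2
  refine hA.congr ?_
  -- Positivity of the real part is an open condition in the uniform topology, and it identifies the
  -- root found by the inverse function theorem with the principal one.
  have hmaps : ∀ᶠ x in 𝓝 (0 : ℝ × ℝ), ∀ ζ : S, 0 < ((g + s (t x)) ζ).re := by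
    have ho : IsOpen {f : C(S, ℂ) | Set.MapsTo f Set.univ {z : ℂ | 0 < z.re}} :=
      ContinuousMap.isOpen_setOfPred_mapsTo isCompact_univ
        (isOpen_lt continuous_const Complex.continuous_re)
    have hc : ContinuousAt (fun x => g + s (t x)) 0 := (analyticAt_const.add hst).continuousAt
    have h0 : g + s (t 0) ∈ {f : C(S, ℂ) | Set.MapsTo f Set.univ {z : ℂ | 0 < z.re}} := by
      rw [ht0, hs0, add_zero]
      exact fun ζ _ => hg_re ζ
    filter_upwards [hc.eventually (ho.mem_nhds h0)] with x hx ζ using hx (Set.mem_univ ζ)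
  have htt : Tendsto t (𝓝 0) (𝓝 0) := by simpa [ContinuousAt, ht0] using ht.continuousAt
  filter_upwards [hmaps, htt.eventually hsq, eventually_abs_le (ε := (1 / 4 : ℝ) ^ 2) (by norm_num)]
    with x hx hsx hle
  rw [ellipticIntegral_eq (by norm_num) le_rfl hle.1 hle.2]
  congr 3
  apply hl
  intro ζ
  have h2 : (4 + 2 * ((ζ : ℂ) - 1)) * (1 - x.1 / ((ζ : ℂ) - 1)) - (x.2 / ((ζ : ℂ) - 1)) ^ 2 =
      ((g + s (t x)) ζ) ^ 2 := by
    have h3 := congrArg (fun f : C(S, ℂ) => f ζ) hsx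
    simp only [ContinuousMap.pow_apply] at h3
    rw [h3, ContinuousMap.add_apply, ContinuousMap.pow_apply, hg_sq]
    simp only [t, k₁, k₂, ContinuousMap.add_apply, ContinuousMap.smul_apply, ContinuousMap.coe_mk,
      Complex.real_smul]
    have := hne ζ
    push_cast
    field_simp
    ring
  simp only [branch, Matrix.cons_val_zero, Matrix.cons_val_one, Matrix.cons_val]
  rw [h2, sqrt_eq_of_sq rfl (hx ζ), ContinuousMap.mul_apply]
  simp only [k₃, ContinuousMap.coe_mk]
  ring

/-- Conjugation maps a circle with real centre to itself by `θ ↦ 2π - θ` and so reverses its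
orientation. -/
theorem conj_circleIntegral {c ρ : ℝ} {f : ℂ → ℂ} (hρ : 0 ≤ ρ)
    (hf : ∀ ζ ∈ Metric.sphere (c : ℂ) ρ, f (starRingEnd ℂ ζ) = starRingEnd ℂ (f ζ)) :
    starRingEnd ℂ (∮ ζ in C(c, ρ), f ζ) = -∮ ζ in C(c, ρ), f ζ := by
  have hc : ∀ θ : ℝ, circleMap c ρ (2 * Real.pi - θ) = starRingEnd ℂ (circleMap c ρ θ) := by
    intro θ
    simp only [circleMap, map_add, map_mul, Complex.conj_ofReal, ← Complex.exp_conj, Complex.conj_I]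
    congr 2
    push_cast
    rw [sub_mul, sub_eq_add_neg, Complex.exp_add, Complex.exp_two_pi_mul_I, one_mul, mul_neg]
  have hd : ∀ θ : ℝ, starRingEnd ℂ (deriv (circleMap c ρ) θ) =
      -deriv (circleMap c ρ) (2 * Real.pi - θ) := by
    intro θ
    have h1 : ∀ θ : ℝ, circleMap 0 ρ θ = circleMap c ρ θ - c := fun θ => by simp [circleMap]
    simp only [deriv_circleMap, map_mul, Complex.conj_I, h1, hc, map_sub, Complex.conj_ofReal]
    ring
  rw [circleIntegral, ← intervalIntegral.intervalIntegral_conj, ← intervalIntegral.integral_neg]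
  have h2 := intervalIntegral.integral_comp_sub_left (a := 0) (b := 2 * Real.pi)
    (fun θ => -(deriv (circleMap c ρ) θ • f (circleMap c ρ θ))) (2 * Real.pi)
  rw [sub_self, sub_zero] at h2
  rw [← h2]
  refine intervalIntegral.integral_congr fun θ _ => ?_
  simp only [smul_eq_mul, map_mul, hd, hc, hf _ (circleMap_mem_sphere _ hρ θ)]
  ring

/-- The contour integral changes sign under conjugation, and so does the prefactor `1 / (2πi)`. -/
theorem ellipticIntegral_im {h j : ℝ} (hh : |h| ≤ (1 / 4) ^ 2) (hj : |j| ≤ (1 / 4) ^ 2) :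
    (ellipticIntegral h j).im = 0 := by
  rw [← Complex.conj_eq_iff_im, ellipticIntegral_eq (by norm_num) le_rfl hh hj]
  have h1 := conj_circleIntegral (c := 1) (ρ := 1 / 4)
    (f := fun ζ => branch ![ζ - 1, h / (ζ - 1), j / (ζ - 1)]) (by norm_num) ?_
  · simp only [Complex.ofReal_one] at h1
    simp only [map_mul, map_inv₀, h1, Complex.conj_ofReal, Complex.conj_I, map_ofNat]
    simp only [mul_neg, inv_neg, neg_mul, neg_neg]
  · intro ζ hζ
    rw [mem_sphere_iff_norm, Complex.ofReal_one] at hζ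
    have h2 := re_radicand_pos (y := ζ - 1) (by norm_num) le_rfl hh hj hζ.ge (by rw [hζ]; norm_num)
    simp only [branch, Matrix.cons_val_zero, Matrix.cons_val_one, Matrix.cons_val]
    simp only [map_div₀, map_neg, map_add, map_sub, map_ofNat, map_one]
    congr 2
    have harg : ((4 + 2 * (ζ - 1)) * (1 - h / (ζ - 1)) - (j / (ζ - 1)) ^ 2).arg ≠ Real.pi := by
      intro ha
      have := Complex.abs_arg_lt_pi_div_two_iff.mpr (Or.inl h2)
      rw [ha, abs_of_pos Real.pi_pos] at this
      linarith [Real.pi_pos]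
    have h3 := Complex.conj_cpow _ (1 / 2) harg
    simpa only [map_sub, map_mul, map_add, map_div₀, map_pow, map_ofNat, map_one,
      Complex.conj_ofReal] using h3

/-! ### The Taylor expansion of the elliptic integral. -/

theorem re_residueSum (s : Finset (Fin 3 →₀ ℕ)) (c : (Fin 3 →₀ ℕ) → ℂ) (h j : ℝ) :
    (residueSum s c (h : ℂ) (j : ℂ)).re = residueSum s (fun μ => (c μ).re) h j := by
  simp only [residueSum, Complex.re_sum]
  refine Finset.sum_congr rfl fun μ _ => ?_
  rw [← Complex.ofReal_pow, ← Complex.ofReal_pow, ← Complex.ofReal_mul, Complex.re_mul_ofReal]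

/-- The Taylor expansion of `realBranch` determines that of the elliptic integral by taking
residues. -/
theorem exists_residue_expansion (K : ℕ) :
    ∃ (s : Finset (Fin 3 →₀ ℕ)) (c : (Fin 3 →₀ ℕ) → ℝ),
      ((fun x : Fin 3 → ℝ => realBranch x - ∑ μ ∈ s, c μ * (x 0 ^ μ 0 * x 1 ^ μ 1 * x 2 ^ μ 2))
        =O[𝓝 0] fun x => ‖x‖ ^ (2 * K)) ∧
      (fun x : ℝ × ℝ => (ellipticIntegral x.1 x.2).re - 2 * residueSum s c x.1 x.2)
        =O[𝓝 0] fun x => ‖x‖ ^ K := by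
  -- The radius will be `√‖x‖`, so order `2 K` in the radius becomes order `K` in `x`.
  obtain ⟨P, hP⟩ := exists_taylor analyticAt_branch (2 * K)
  refine ⟨P.support, fun μ => (P.coeff μ).re, ?_, ?_⟩
  · obtain ⟨C, hC⟩ := hP.bound
    have ht : Tendsto (fun (x : Fin 3 → ℝ) i => (x i : ℂ)) (𝓝 0) (𝓝 0) := by
      have : Continuous (fun (x : Fin 3 → ℝ) i => (x i : ℂ)) := by fun_prop
      exact this.tendsto' _ _ (by ext; simp)
    have hpos : ∀ᶠ x : Fin 3 → ℝ in 𝓝 0, 0 < (4 + 2 * x 0) * (1 - x 1) - x 2 ^ 2 := by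
      have : ContinuousAt (fun x : Fin 3 → ℝ => (4 + 2 * x 0) * (1 - x 1) - x 2 ^ 2) 0 := by
        fun_prop
      exact continuousAt_const.eventually_lt this (by simp)
    refine IsBigO.of_bound C ?_
    filter_upwards [ht.eventually hC, hpos] with x hx hxp
    have hn : ‖fun i => (x i : ℂ)‖ = ‖x‖ := by simp [Pi.norm_def]
    rw [hn, branch_ofReal hxp, MvPolynomial.eval_eq'] at hx
    refine le_trans ?_ hx
    refine le_trans (le_of_eq ?_) (Complex.abs_re_le_norm _)
    rw [Real.norm_eq_abs]
    congr 1
    simp only [Complex.sub_re, Complex.ofReal_re, Complex.re_sum, Fin.prod_univ_three]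
    congr 1
    refine Finset.sum_congr rfl fun μ _ => ?_
    rw [← Complex.ofReal_pow, ← Complex.ofReal_pow, ← Complex.ofReal_pow, ← Complex.ofReal_mul,
      ← Complex.ofReal_mul, Complex.re_mul_ofReal]
  · obtain ⟨C, ρ₀, hC, h0, hest⟩ := ellipticIntegral_estimate hP
    have hest' : ∀ ρ, 0 < ρ → ρ < ρ₀ → ∀ h j : ℝ, |h| ≤ ρ ^ 2 → |j| ≤ ρ ^ 2 →
        |(ellipticIntegral h j).re - 2 * residueSum P.support (fun μ => (P.coeff μ).re) h j| ≤
          C * ρ ^ (2 * K + 1) := by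
      intro ρ h1 h2 h j hh hj
      refine le_trans (le_of_eq ?_) ((Complex.abs_re_le_norm _).trans (hest ρ h1 h2 h j hh hj))
      congr 1
      rw [Complex.sub_re, show (2 : ℂ) = ((2 : ℝ) : ℂ) by simp, Complex.re_ofReal_mul,
        re_residueSum]
    refine IsBigO.of_bound (C * 1) ?_
    have hs : ∀ᶠ x : ℝ × ℝ in 𝓝 0, √‖x‖ < min ρ₀ 1 := by
      have : ContinuousAt (fun x : ℝ × ℝ => √‖x‖) 0 := by fun_prop
      exact this.eventually_lt continuousAt_const (by simp [h0])
    filter_upwards [hs] with x hx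
    rw [Real.norm_eq_abs, Real.norm_eq_abs, abs_of_nonneg (by positivity : 0 ≤ ‖x‖ ^ K)]
    rcases eq_or_ne x 0 with rfl | hx0
    -- At `x = 0` the radius `√‖x‖` degenerates; the estimate holds for every small `ρ` and is
    -- passed to the limit instead.
    · have hlim : Tendsto (fun ρ : ℝ => C * ρ ^ (2 * K + 1)) (𝓝[>] 0) (𝓝 0) := by
        have : Continuous fun ρ : ℝ => C * ρ ^ (2 * K + 1) := by fun_prop
        exact (this.tendsto' 0 0 (by simp)).mono_left nhdsWithin_le_nhds
      refine le_trans (ge_of_tendsto hlim ?_) (by positivity)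
      filter_upwards [Ioo_mem_nhdsGT h0] with ρ hρ
      exact hest' ρ hρ.1 hρ.2 _ _ (by simp; positivity) (by simp; positivity)
    · have hxp : 0 < ‖x‖ := norm_pos_iff.mpr hx0
      have hsq : √‖x‖ ^ 2 = ‖x‖ := Real.sq_sqrt hxp.le
      refine (hest' (√‖x‖) (Real.sqrt_pos.mpr hxp) (hx.trans_le (min_le_left _ _)) _ _
        (by rw [hsq]; exact norm_fst_le x) (by rw [hsq]; exact norm_snd_le x)).trans ?_
      rw [pow_succ, pow_mul, hsq, mul_assoc, mul_comm (‖x‖ ^ K)]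
      gcongr
      exact (hx.trans_le (min_le_right _ _)).le

/-! ### The derivation `s ∂ₛ - 2 τ ∂_τ`. -/

section EulerDerivation

variable {F G : ℝ × ℝ → ℝ} {x : ℝ × ℝ}

theorem eulerD_apply (F : ℝ × ℝ → ℝ) (x : ℝ × ℝ) :
    eulerD F x = fderiv ℝ F x (x.1, -2 * x.2) := by
  have : (x.1, -2 * x.2) = x.1 • ((1, 0) : ℝ × ℝ) + (-2 * x.2) • ((0, 1) : ℝ × ℝ) := by simp
  rw [this, map_add, map_smul, map_smul, eulerD, pd₁, pd₂, smul_eq_mul, smul_eq_mul]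
  ring

theorem eulerD_congr (h : F =ᶠ[𝓝 x] G) : eulerD F =ᶠ[𝓝 x] eulerD G := by
  filter_upwards [h.fderiv (𝕜 := ℝ)] with y hy
  rw [eulerD_apply, eulerD_apply, hy]

theorem eulerD_add (hF : DifferentiableAt ℝ F x) (hG : DifferentiableAt ℝ G x) :
    eulerD (fun x => F x + G x) x = eulerD F x + eulerD G x := by
  simp [eulerD_apply, fderiv_fun_add hF hG]

theorem eulerD_mul (hF : DifferentiableAt ℝ F x) (hG : DifferentiableAt ℝ G x) :
    eulerD (fun x => F x * G x) x = eulerD F x * G x + F x * eulerD G x := by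
  simp [eulerD_apply, fderiv_fun_mul hF hG]; ring

theorem eulerD_comp {f : ℝ → ℝ} {f' : ℝ} (hf : HasDerivAt f f' (F x))
    (hF : DifferentiableAt ℝ F x) : eulerD (fun x => f (F x)) x = f' * eulerD F x := by
  have := (hf.comp_hasFDerivAt x hF.hasFDerivAt).fderiv
  rw [Function.comp_def] at this
  simp [eulerD_apply, this]

theorem eulerD_const (c : ℝ) : eulerD (fun _ => c) x = 0 := by
  simp [eulerD_apply]

theorem eulerD_fst : eulerD (fun x => x.1) x = x.1 := by
  simp [eulerD]

theorem eulerD_snd : eulerD (fun x => x.2) x = -2 * x.2 := by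
  simp [eulerD]

theorem eulerD_pow (hF : DifferentiableAt ℝ F x) (n : ℕ) :
    eulerD (fun x => F x ^ n) x = n * F x ^ (n - 1) * eulerD F x :=
  eulerD_comp (hasDerivAt_pow n _) hF

theorem eulerD_monomial (a b : ℕ) :
    eulerD (fun x => x.1 ^ a * x.2 ^ b) x = ((a : ℝ) - 2 * b) * (x.1 ^ a * x.2 ^ b) := by
  rw [eulerD_mul (by fun_prop) (by fun_prop), eulerD_pow (by fun_prop), eulerD_pow (by fun_prop),
    eulerD_fst, eulerD_snd]
  have h : ∀ (t : ℝ) (n : ℕ), n * t ^ (n - 1) * t = n * t ^ n := by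
    intro t n
    cases n with
    | zero => simp
    | succ n => rw [Nat.add_sub_cancel, pow_succ]; ring
  rw [h, show (b : ℝ) * x.2 ^ (b - 1) * (-2 * x.2) = -2 * (b * x.2 ^ (b - 1) * x.2) by ring, h]
  ring

/-- The weights `1` and `-2` make `s² τ` a first integral of the field, so functions of it behave as
constants. -/
theorem eulerD_resonant {f : ℝ → ℝ} (hf : DifferentiableAt ℝ f (x.1 ^ 2 * x.2)) :
    eulerD (fun x => f (x.1 ^ 2 * x.2)) x = 0 := by
  rw [eulerD_comp hf.hasDerivAt (F := fun x => x.1 ^ 2 * x.2) (by fun_prop)]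
  have := eulerD_monomial (x := x) 2 1
  simp only [pow_one] at this
  rw [this]
  norm_num

theorem analyticAt_resonant {f : ℝ → ℝ} (hf : AnalyticAt ℝ f 0) :
    AnalyticAt ℝ (fun x : ℝ × ℝ => f (x.1 ^ 2 * x.2)) 0 := by
  refine AnalyticAt.fun_comp (f := fun x : ℝ × ℝ => x.1 ^ 2 * x.2) ?_ (by fun_prop)
  simpa using hf

theorem eulerD_sq_mul (hF : DifferentiableAt ℝ F x) :
    eulerD (fun x => x.1 ^ 2 * F x) x = x.1 ^ 2 * (2 * F x + eulerD F x) := by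
  rw [eulerD_mul (by fun_prop) hF, eulerD_pow (by fun_prop), eulerD_fst]
  norm_num
  ring

end EulerDerivation

/-! ### Residues as resonant Taylor coefficients. -/

section ResidueCalculus

variable {Y : ℝ × ℝ → ℝ} {b : ℝ → ℝ}

/-- With `y = s² Y`, energy `t b(t)` and momentum `k t`, where `t = s² τ`, the expression is `(t b)ʲ
(k t)^q y^(i - j - q)` times the derivative of `y`. If the exponent is `-1`, then `dy / y`
contributes `2` plus the derivative of `log (-Y)`; the `2` says that `y` winds twice while `s` winds
once. Otherwise the expression is the derivative of a power and has no resonant part. -/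
theorem jet_residue_monomial (hY : AnalyticAt ℝ Y 0) (hY0 : Y 0 < 0) (hb : AnalyticAt ℝ b 0)
    (k : ℝ) (i j q n : ℕ) :
    jet (2 * n) n (fun x => (x.1 ^ 2 * Y x) ^ i * (x.2 * b (x.1 ^ 2 * x.2) / Y x) ^ j *
        (k * x.2 / Y x) ^ q * eulerD (fun x => x.1 ^ 2 * Y x) x) =
      if i + 1 = j + q then
        2 * jet (2 * n) n (fun x => (x.1 ^ 2 * x.2 * b (x.1 ^ 2 * x.2)) ^ j *
          (k * (x.1 ^ 2 * x.2)) ^ q)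
      else 0 := by
  have hneg : ∀ᶠ x in 𝓝 0, Y x < 0 := hY.continuousAt.eventually_lt continuousAt_const hY0
  have hana := hY.eventually_analyticAt
  have hη : Tendsto (fun x : ℝ × ℝ => x.1 ^ 2 * x.2) (𝓝 0) (𝓝 0) := by
    have : Continuous (fun x : ℝ × ℝ => x.1 ^ 2 * x.2) := by fun_prop
    exact this.tendsto' _ _ (by simp)
  have hbana := hη.eventually hb.eventually_analyticAt
  have hbη := analyticAt_resonant hb
  split_ifs with hk
  · let f : ℝ → ℝ := fun t => (t * b t) ^ j * (k * t) ^ q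
    have hf : AnalyticAt ℝ f 0 := by fun_prop
    have hfη := analyticAt_resonant hf
    have hfana := hη.eventually hf.eventually_analyticAt
    have hlog : AnalyticAt ℝ (fun x => Real.log (-Y x)) 0 :=
      AnalyticAt.fun_comp (f := fun x => -Y x) (analyticAt_log (by simpa using hY0)) hY.fun_neg
    have hS : AnalyticAt ℝ (fun x => f (x.1 ^ 2 * x.2) * Real.log (-Y x)) 0 := hfη.fun_mul hlog
    have e : (fun x => (x.1 ^ 2 * Y x) ^ i * (x.2 * b (x.1 ^ 2 * x.2) / Y x) ^ j *
        (k * x.2 / Y x) ^ q * eulerD (fun x => x.1 ^ 2 * Y x) x) =ᶠ[𝓝 0]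
        fun x => 2 * f (x.1 ^ 2 * x.2) +
          eulerD (fun x => f (x.1 ^ 2 * x.2) * Real.log (-Y x)) x := by
      filter_upwards [hneg, hana, hfana] with x h1 h2 h3
      have h4 : HasDerivAt (fun t => Real.log (-t)) ((Y x)⁻¹) (Y x) := by
        have := ((hasDerivAt_id (Y x)).neg).log (by simpa using h1.ne)
        simpa [neg_div_neg_eq] using this
      have h5 : DifferentiableAt ℝ (fun x => f (x.1 ^ 2 * x.2)) x :=
        h3.differentiableAt.comp x (f := fun x : ℝ × ℝ => x.1 ^ 2 * x.2) (by fun_prop)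
      have h6 : DifferentiableAt ℝ (fun x => Real.log (-Y x)) x :=
        h4.differentiableAt.comp x h2.differentiableAt
      rw [eulerD_sq_mul h2.differentiableAt, eulerD_mul h5 h6,
        eulerD_resonant h3.differentiableAt, eulerD_comp h4 h2.differentiableAt]
      have h7 : (x.1 ^ 2) ^ (i + 1) = (x.1 ^ 2) ^ (j + q) := by rw [hk]
      have h8 : Y x ^ (i + 1) = Y x ^ (j + q) := by rw [hk]
      have h9 : Y x ≠ 0 := h1.ne
      simp only [f, div_pow, mul_pow, zero_mul, zero_add]
      have h10 : (x.1 ^ 2) ^ i * Y x ^ i * (x.2 ^ j * b (x.1 ^ 2 * x.2) ^ j / Y x ^ j) *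
          (k ^ q * x.2 ^ q / Y x ^ q) * (x.1 ^ 2 * (2 * Y x + eulerD Y x)) =
          (x.1 ^ 2) ^ (i + 1) * (Y x ^ (i + 1)) / Y x ^ (j + q) * (x.2 ^ j * b (x.1 ^ 2 * x.2) ^ j *
            (k ^ q * x.2 ^ q)) * (2 + (Y x)⁻¹ * eulerD Y x) := by
        field_simp
        ring
      rw [h10, h7, h8]
      field_simp
      ring
    rw [jet_congr e, jet_add (analyticAt_const.fun_mul hfη) (analyticAt_eulerD hS), jet_eulerD hS,
      jet_const_mul _ hfη, add_zero]
  · let k' : ℤ := (i : ℤ) + 1 - j - q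
    have hk' : (k' : ℝ) ≠ 0 := by
      have : k' ≠ 0 := by omega
      exact_mod_cast this
    let f : ℝ → ℝ := fun t => (k' : ℝ)⁻¹ * (b t ^ j * k ^ q)
    have hf : AnalyticAt ℝ f 0 := by fun_prop
    have hfη := analyticAt_resonant hf
    have hfana := hη.eventually hf.eventually_analyticAt
    -- This is `(t b)ʲ (k t)^q y^k' / k'`, regrouped so that no negative power of `s` appears: only
    -- `Y`, which is nonzero at `0`, may carry one.
    let S : ℝ × ℝ → ℝ := fun x =>
      f (x.1 ^ 2 * x.2) * ((x.1 ^ (2 * i + 2) * x.2 ^ (j + q)) * Y x ^ k')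
    have hS : AnalyticAt ℝ S 0 := by
      refine hfη.fun_mul (AnalyticAt.fun_mul (by fun_prop) ?_)
      exact hY.fun_zpow hY0.ne
    have e : (fun x => (x.1 ^ 2 * Y x) ^ i * (x.2 * b (x.1 ^ 2 * x.2) / Y x) ^ j *
        (k * x.2 / Y x) ^ q * eulerD (fun x => x.1 ^ 2 * Y x) x) =ᶠ[𝓝 0] eulerD S := by
      filter_upwards [hneg, hana, hfana] with x h1 h2 h3
      have h9 : Y x ≠ 0 := h1.ne
      have h4 := hasDerivAt_zpow k' (Y x) (Or.inl h9)
      have h5 : DifferentiableAt ℝ (fun x => f (x.1 ^ 2 * x.2)) x :=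
        h3.differentiableAt.comp x (f := fun x : ℝ × ℝ => x.1 ^ 2 * x.2) (by fun_prop)
      have h6 : DifferentiableAt ℝ (fun x => Y x ^ k') x :=
        h4.differentiableAt.comp x h2.differentiableAt
      rw [eulerD_sq_mul h2.differentiableAt, eulerD_mul h5 (by fun_prop),
        eulerD_resonant h3.differentiableAt, eulerD_mul (by fun_prop) h6, eulerD_monomial,
        eulerD_comp h4 h2.differentiableAt]
      have h10 : Y x ^ k' = Y x ^ (i + 1) / (Y x ^ j * Y x ^ q) := by
        simp only [k']
        rw [zpow_sub₀ h9, zpow_sub₀ h9, div_div]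
        norm_cast
      have h11 : Y x ^ (k' - 1) = Y x ^ i / (Y x ^ j * Y x ^ q) := by
        rw [zpow_sub_one₀ h9, h10, pow_succ]
        field_simp
      have h12 : ((2 * i + 2 : ℕ) : ℝ) - 2 * ((j + q : ℕ) : ℝ) = 2 * k' := by
        simp only [k']; push_cast; ring
      rw [h10, h11, h12]
      simp only [f, div_pow]
      field_simp
      ring
    rw [jet_congr e, jet_eulerD hS]

theorem analyticAt_realBranch : AnalyticAt ℝ realBranch 0 := by
  unfold realBranch
  refine AnalyticAt.fun_div (AnalyticAt.fun_neg ?_) (by fun_prop) (by simp)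
  have h1 : AnalyticAt ℝ Real.sqrt 4 := (Real.contDiffAt_sqrt (by norm_num)).analyticAt
  refine AnalyticAt.fun_comp (f := fun x : Fin 3 → ℝ => (4 + 2 * x 0) * (1 - x 1) - x 2 ^ 2) ?_
    (by fun_prop)
  simpa using h1

theorem analyticAt_vec3 {E : Type*} [NormedAddCommGroup E] [NormedSpace ℝ E] {f g h : E → ℝ}
    {x : E} (hf : AnalyticAt ℝ f x) (hg : AnalyticAt ℝ g x) (hh : AnalyticAt ℝ h x) :
    AnalyticAt ℝ (fun x => ![f x, g x, h x]) x := by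
  rw [analyticAt_pi_iff]
  intro i
  fin_cases i
  · exact hf
  · exact hg
  · exact hh

theorem isBigO_of_analyticAt {E F : Type*} [NormedAddCommGroup E] [NormedSpace ℝ E]
    [NormedAddCommGroup F] [NormedSpace ℝ F] {f : E → F} (hf : AnalyticAt ℝ f 0) (h0 : f 0 = 0) :
    f =O[𝓝 0] fun x => ‖x‖ := by
  have := hf.differentiableAt.isBigO_sub
  simpa [h0] using this.norm_right

/-- The resonant Taylor coefficients of the reduced action form. -/
theorem jet_realBranch (hY : AnalyticAt ℝ Y 0) (hY0 : Y 0 < 0) (hb : AnalyticAt ℝ b 0)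
    (k : ℝ) (n : ℕ) :
    jet (2 * n) n (fun x => realBranch ![x.1 ^ 2 * Y x, x.2 * b (x.1 ^ 2 * x.2) / Y x,
        k * x.2 / Y x] * eulerD (fun x => x.1 ^ 2 * Y x) x) =
      jet (2 * n) n (fun x => (ellipticIntegral (x.1 ^ 2 * x.2 * b (x.1 ^ 2 * x.2))
        (k * (x.1 ^ 2 * x.2))).re) := by
  classical
  -- The coefficient in question has total degree `3 n` in `(s, τ)`; the order `2 (2 n + 1)` of the
  -- Taylor remainder exceeds it.
  obtain ⟨s, c, h1, h2⟩ := exists_residue_expansion (2 * n + 1)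
  have hbη := analyticAt_resonant hb
  let V : ℝ × ℝ → Fin 3 → ℝ := fun x =>
    ![x.1 ^ 2 * Y x, x.2 * b (x.1 ^ 2 * x.2) / Y x, k * x.2 / Y x]
  have hV : AnalyticAt ℝ V 0 := by
    refine analyticAt_vec3 (by fun_prop) (AnalyticAt.fun_div (analyticAt_snd.fun_mul hbη) hY hY0.ne)
      (AnalyticAt.fun_div (by fun_prop) hY hY0.ne)
  have hV0 : V 0 = 0 := by
    ext i; fin_cases i <;> simp [V]
  have hVt : Tendsto V (𝓝 0) (𝓝 0) := by simpa [ContinuousAt, hV0] using hV.continuousAt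
  have hE : AnalyticAt ℝ (eulerD (fun x => x.1 ^ 2 * Y x)) 0 := analyticAt_eulerD (by fun_prop)
  let T : (Fin 3 →₀ ℕ) → ℝ × ℝ → ℝ := fun μ x =>
    c μ * ((x.1 ^ 2 * Y x) ^ μ 0 * (x.2 * b (x.1 ^ 2 * x.2) / Y x) ^ μ 1 *
        (k * x.2 / Y x) ^ μ 2 * eulerD (fun x => x.1 ^ 2 * Y x) x)
  have hu : AnalyticAt ℝ (fun x => x.2 * b (x.1 ^ 2 * x.2) / Y x) 0 :=
    AnalyticAt.fun_div (analyticAt_snd.fun_mul hbη) hY hY0.ne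
  have hv : AnalyticAt ℝ (fun x => k * x.2 / Y x) 0 := AnalyticAt.fun_div (by fun_prop) hY hY0.ne
  have hT' : ∀ μ : Fin 3 →₀ ℕ, AnalyticAt ℝ (fun x =>
      (x.1 ^ 2 * Y x) ^ μ 0 * (x.2 * b (x.1 ^ 2 * x.2) / Y x) ^ μ 1 *
        (k * x.2 / Y x) ^ μ 2 * eulerD (fun x => x.1 ^ 2 * Y x) x) 0 := fun μ => by fun_prop
  have hT : ∀ μ, AnalyticAt ℝ (T μ) 0 := fun μ => analyticAt_const.fun_mul (hT' μ)
  have hR : AnalyticAt ℝ (fun x => realBranch (V x)) 0 :=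
    AnalyticAt.fun_comp (by rw [hV0]; exact analyticAt_realBranch) hV
  have hL : AnalyticAt ℝ (fun x => realBranch (V x) * eulerD (fun x => x.1 ^ 2 * Y x) x) 0 :=
    hR.fun_mul hE
  have hsum : AnalyticAt ℝ (fun x => ∑ μ ∈ s, T μ x) 0 :=
    Finset.analyticAt_fun_sum _ fun μ _ => hT μ
  have hrem : jet (2 * n) n (fun x => realBranch (V x) * eulerD (fun x => x.1 ^ 2 * Y x) x -
      ∑ μ ∈ s, T μ x) = 0 := by
    refine jet_eq_zero_of_isBigO (hL.fun_sub hsum) (k := 2 * (2 * n + 1)) (by omega) ?_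
    have h3 := (h1.comp_tendsto hVt).trans ((isBigO_of_analyticAt hV hV0).norm_left.pow _)
    have h4 := h3.mul (hE.continuousAt.isBigO_one ℝ)
    simp only [mul_one] at h4
    refine h4.congr_left fun x => ?_
    simp only [Function.comp_apply, sub_mul, Finset.sum_mul, T, mul_assoc]
    rfl
  rw [jet_sub hL hsum, sub_eq_zero, jet_sum s fun μ _ => hT μ] at hrem
  refine hrem.trans ?_
  have hM : ∀ μ : Fin 3 →₀ ℕ, AnalyticAt ℝ (fun x : ℝ × ℝ =>
      (x.1 ^ 2 * x.2 * b (x.1 ^ 2 * x.2)) ^ μ 1 * (k * (x.1 ^ 2 * x.2)) ^ μ 2) 0 := fun μ =>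
    analyticAt_resonant (f := fun t => (t * b t) ^ μ 1 * (k * t) ^ μ 2) (by fun_prop)
  have hjt : ∀ μ, jet (2 * n) n (T μ) = if μ 0 + 1 = μ 1 + μ 2 then
      2 * jet (2 * n) n (fun x => c μ * ((x.1 ^ 2 * x.2 * b (x.1 ^ 2 * x.2)) ^ μ 1 *
          (k * (x.1 ^ 2 * x.2)) ^ μ 2)) else 0 := by
    intro μ
    simp only [T]
    rw [jet_const_mul _ (hT' μ), jet_residue_monomial hY hY0 hb, jet_const_mul _ (hM μ)]
    split_ifs <;> ring
  simp only [hjt]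
  rw [← Finset.sum_filter, ← Finset.mul_sum, ← jet_sum _ (fun μ _ => analyticAt_const.fun_mul (hM μ)),
    ← jet_const_mul _ (Finset.analyticAt_fun_sum _ fun μ _ => analyticAt_const.fun_mul (hM μ))]
  let D : ℝ → ℝ × ℝ := fun t => (t * b t, k * t)
  have hD : AnalyticAt ℝ D 0 := AnalyticAt.prod (by fun_prop) (by fun_prop)
  have hD0 : D 0 = 0 := by simp [D]
  have hDt : Tendsto D (𝓝 0) (𝓝 0) := by simpa [ContinuousAt, hD0] using hD.continuousAt
  have hell : AnalyticAt ℝ (fun t => (ellipticIntegral (t * b t) (k * t)).re) 0 := by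
    have h : AnalyticAt ℝ (fun x : ℝ × ℝ => (ellipticIntegral x.1 x.2).re) (D 0) := by
      rw [hD0]; exact analyticAt_ellipticIntegral
    exact h.fun_comp hD
  have hres : AnalyticAt ℝ (fun t => 2 * residueSum s c (t * b t) (k * t)) 0 := by
    unfold residueSum
    exact analyticAt_const.fun_mul (Finset.analyticAt_fun_sum _ fun μ _ => by fun_prop)
  have hO := (h2.comp_tendsto hDt).trans ((isBigO_of_analyticAt hD hD0).norm_left.pow _)
  have h5 := jet_eq_zero_of_isBigO_fst (analyticAt_resonant (hell.fun_sub hres)) (m := 2 * n) (n := n)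
    (k := 2 * (2 * n + 1)) (by omega) (isBigO_fst_of_comp hO)
  rw [jet_sub (analyticAt_resonant hell) (analyticAt_resonant hres), sub_eq_zero] at h5
  rw [h5]
  simp only [residueSum]

end ResidueCalculus

/-! ### The action form of the pendulum on a surface through the equilibrium. -/

theorem frequency_pos {g l : ℝ} (hg : 0 < g) (hl : 0 < l) : 0 < frequency g l :=
  Real.sqrt_pos.mpr (div_pos hg hl)

theorem frequency_sq {g l : ℝ} (hg : 0 < g) (hl : 0 < l) : l * frequency g l ^ 2 = g := by
  rw [frequency, Real.sq_sqrt (div_pos hg hl).le]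
  field_simp

theorem kappa_pos {m g l : ℝ} (hm : 0 < m) (hg : 0 < g) (hl : 0 < l) : 0 < kappa m g l := by
  have := frequency_pos hg hl
  unfold kappa
  positivity

theorem kappa_mul {m g l : ℝ} (hm : 0 < m) (hg : 0 < g) (hl : 0 < l) :
    kappa m g l * (m * l ^ 2 * frequency g l) = 1 := by
  have := frequency_pos hg hl
  unfold kappa
  field_simp

/-- The resonant Taylor coefficients of the action form `p dr` along a surface on which the
symplectic form is `α s ds ∧ dτ`. -/
theorem jet_action_form {r p : Fin 3 → ℝ × ℝ → ℝ} (hr : ∀ i, AnalyticAt ℝ (r i) 0)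
    (hp : ∀ i, AnalyticAt ℝ (p i) 0) {α : ℝ}
    (hω : ∀ᶠ x in 𝓝 (0 : ℝ × ℝ),
      ∑ i, (pd₁ (r i) x * pd₂ (p i) x - pd₂ (r i) x * pd₁ (p i) x) = x.1 * α) (n : ℕ) :
    jet (2 * n) n (fun x => ∑ i, p i x * eulerD (r i) x) =
      jet (2 * n) n (fun x => α * (x.1 ^ 2 * x.2)) := by
  have h1 : ∀ i, AnalyticAt ℝ (fun x => p i x * pd₁ (r i) x) 0 := fun i =>
    (hp i).fun_mul (analyticAt_pd₁ (hr i))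
  have h2 : ∀ i, AnalyticAt ℝ (fun x => p i x * pd₂ (r i) x) 0 := fun i =>
    (hp i).fun_mul (analyticAt_pd₂ (hr i))
  have hlin : AnalyticAt ℝ (fun x : ℝ × ℝ => α * (x.1 * x.2)) 0 := by fun_prop
  -- Since `d(α s τ ds) = -α s ds ∧ dτ = d(p dr)`, the form `p dr - α s τ ds` is closed.
  have hM : AnalyticAt ℝ (fun x => ∑ i, p i x * pd₁ (r i) x - α * (x.1 * x.2)) 0 :=
    (Finset.analyticAt_fun_sum _ fun i _ => h1 i).fun_sub hlin
  have hK : AnalyticAt ℝ (fun x => ∑ i, p i x * pd₂ (r i) x) 0 :=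
    Finset.analyticAt_fun_sum _ fun i _ => h2 i
  have hclosed : pd₂ (fun x => ∑ i, p i x * pd₁ (r i) x - α * (x.1 * x.2)) =ᶠ[𝓝 0]
      pd₁ (fun x => ∑ i, p i x * pd₂ (r i) x) := by
    have hcomm : ∀ᶠ x in 𝓝 (0 : ℝ × ℝ), ∀ i, pd₂ (pd₁ (r i)) x = pd₁ (pd₂ (r i)) x :=
      eventually_all.mpr fun i => pd₂_pd₁_comm (hr i)
    have hra : ∀ᶠ x in 𝓝 (0 : ℝ × ℝ), ∀ i, AnalyticAt ℝ (r i) x :=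
      eventually_all.mpr fun i => (hr i).eventually_analyticAt
    have hpa : ∀ᶠ x in 𝓝 (0 : ℝ × ℝ), ∀ i, AnalyticAt ℝ (p i) x :=
      eventually_all.mpr fun i => (hp i).eventually_analyticAt
    filter_upwards [hω, hcomm, hra, hpa] with x hx hc hra hpa
    have d1 : ∀ i, DifferentiableAt ℝ (pd₁ (r i)) x := fun i =>
      (analyticAt_pd₁ (hra i)).differentiableAt
    have d2 : ∀ i, DifferentiableAt ℝ (pd₂ (r i)) x := fun i =>
      (analyticAt_pd₂ (hra i)).differentiableAt
    have d3 : ∀ i, DifferentiableAt ℝ (p i) x := fun i => (hpa i).differentiableAt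
    have e1 : pd₂ (fun x => ∑ i, p i x * pd₁ (r i) x - α * (x.1 * x.2)) x =
        ∑ i, (pd₂ (p i) x * pd₁ (r i) x + p i x * pd₂ (pd₁ (r i)) x) - α * x.1 := by
      have e3 : ∀ i, fderiv ℝ (fun x => p i x * pd₁ (r i) x) x ((0, 1) : ℝ × ℝ) =
          pd₂ (p i) x * pd₁ (r i) x + p i x * pd₂ (pd₁ (r i)) x := fun i => pd₂_mul (d3 i) (d1 i)
      have e4 : fderiv ℝ (fun x : ℝ × ℝ => α * (x.1 * x.2)) x ((0, 1) : ℝ × ℝ) = α * x.1 := by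
        rw [fderiv_const_mul (by fun_prop), fderiv_fun_mul (by fun_prop) (by fun_prop)]
        simp [fderiv_fst, fderiv_snd]
      rw [pd₂, fderiv_fun_sub (DifferentiableAt.fun_sum fun i _ => (d3 i).fun_mul (d1 i))
        (by fun_prop), fderiv_fun_sum fun i _ => (d3 i).fun_mul (d1 i)]
      rw [sub_apply, sum_apply, e4]
      simp only [e3]
    have e2 : pd₁ (fun x => ∑ i, p i x * pd₂ (r i) x) x =
        ∑ i, (pd₁ (p i) x * pd₂ (r i) x + p i x * pd₁ (pd₂ (r i)) x) := by
      have e3 : ∀ i, fderiv ℝ (fun x => p i x * pd₂ (r i) x) x ((1, 0) : ℝ × ℝ) =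
          pd₁ (p i) x * pd₂ (r i) x + p i x * pd₁ (pd₂ (r i)) x := fun i => pd₁_mul (d3 i) (d2 i)
      rw [pd₁, fderiv_fun_sum fun i _ => (d3 i).fun_mul (d2 i), sum_apply]
      simp only [e3]
    rw [e1, e2, mul_comm α, ← hx, ← Finset.sum_sub_distrib]
    refine Finset.sum_congr rfl fun i _ => ?_
    rw [hc i]
    ring
  have h := jet_closed hM hK hclosed n
  have hE : AnalyticAt ℝ (fun x => ∑ i, p i x * eulerD (r i) x) 0 :=
    Finset.analyticAt_fun_sum _ fun i _ => (hp i).fun_mul (analyticAt_eulerD (hr i))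
  have e : (fun x => x.1 * (∑ i, p i x * pd₁ (r i) x - α * (x.1 * x.2)) -
      2 * (x.2 * ∑ i, p i x * pd₂ (r i) x)) =
      fun x => (∑ i, p i x * eulerD (r i) x) - α * (x.1 ^ 2 * x.2) := by
    ext x
    simp only [eulerD, mul_sub, Finset.mul_sum, Finset.sum_sub_distrib]
    have e1 : ∀ i, x.1 * (p i x * pd₁ (r i) x) = p i x * (x.1 * pd₁ (r i) x) := fun i => by ring
    have e2 : ∀ i, 2 * (x.2 * (p i x * pd₂ (r i) x)) = p i x * (2 * (x.2 * pd₂ (r i) x)) :=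
      fun i => by ring
    simp only [e1, e2]
    ring
  rw [e, jet_sub hE (by fun_prop), sub_eq_zero] at h
  exact h

theorem eulerD_fst_mul {F : ℝ × ℝ → ℝ} {x : ℝ × ℝ} (hF : DifferentiableAt ℝ F x) :
    eulerD (fun x => x.1 * F x) x = x.1 * (F x + eulerD F x) := by
  rw [eulerD_mul (by fun_prop) hF, eulerD_fst]
  ring

/-- The polar angle of a nonvanishing planar vector. -/
theorem exists_polar_angle {U V : ℝ × ℝ → ℝ} (hU : AnalyticAt ℝ U 0) (hV : AnalyticAt ℝ V 0)
    (h0 : 0 < U 0 ^ 2 + V 0 ^ 2) :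
    ∃ φ : ℝ × ℝ → ℝ, AnalyticAt ℝ φ 0 ∧ ∀ᶠ x in 𝓝 0,
      (U x ^ 2 + V x ^ 2) * eulerD φ x = U x * eulerD V x - V x * eulerD U x := by
  -- After the rotation and dilation that take `(U 0, V 0)` to the positive axis the vector is `(C,
  -- A)` with `C > 0` near `0`, so its angle is an arctangent without branch cut.
  let A : ℝ × ℝ → ℝ := fun x => U 0 * V x - V 0 * U x
  let C : ℝ × ℝ → ℝ := fun x => U 0 * U x + V 0 * V x
  have hA : AnalyticAt ℝ A 0 := by fun_prop
  have hC : AnalyticAt ℝ C 0 := by fun_prop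
  have hC0 : 0 < C 0 := by simp only [C]; nlinarith
  have hAC : AnalyticAt ℝ (fun x => A x / C x) 0 := hA.fun_div hC hC0.ne'
  have hpos : ∀ᶠ x in 𝓝 0, 0 < C x := continuousAt_const.eventually_lt hC.continuousAt hC0
  refine ⟨fun x => Real.arctan (A x / C x),
    AnalyticAt.fun_comp Real.contDiff_arctan.contDiffAt.analyticAt hAC, ?_⟩
  filter_upwards [hpos, hU.eventually_analyticAt, hV.eventually_analyticAt] with x h1 h2 h3
  have dU := h2.differentiableAt
  have dV := h3.differentiableAt
  have dA : DifferentiableAt ℝ A x := by fun_prop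
  have dC : DifferentiableAt ℝ C x := by fun_prop
  have dI : DifferentiableAt ℝ (fun x => (C x)⁻¹) x := dC.fun_inv h1.ne'
  have eA : eulerD A x = U 0 * eulerD V x - V 0 * eulerD U x := by
    simp only [eulerD_apply, A]
    rw [fderiv_fun_sub (by fun_prop) (by fun_prop), fderiv_const_mul dV, fderiv_const_mul dU]
    simp
  have eC : eulerD C x = U 0 * eulerD U x + V 0 * eulerD V x := by
    simp only [eulerD_apply, C]
    rw [fderiv_fun_add (by fun_prop) (by fun_prop), fderiv_const_mul dV, fderiv_const_mul dU]
    simp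
  have e1 : eulerD (fun x => A x / C x) x = eulerD A x * (C x)⁻¹ - A x * (C x ^ 2)⁻¹ * eulerD C x := by
    simp only [div_eq_mul_inv]
    rw [eulerD_mul dA dI, eulerD_comp (hasDerivAt_inv h1.ne') dC]
    ring
  have dQ : DifferentiableAt ℝ (fun x => A x / C x) x := by
    simpa only [div_eq_mul_inv] using dA.fun_mul dI
  rw [eulerD_comp (Real.hasDerivAt_arctan _) dQ, e1, eA, eC]
  have hne : C x ≠ 0 := h1.ne'
  have h4 : C x ^ 2 + A x ^ 2 ≠ 0 := by positivity
  have h5 : C x ^ 2 + A x ^ 2 = (U 0 ^ 2 + V 0 ^ 2) * (U x ^ 2 + V x ^ 2) := by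
    simp only [A, C]; ring
  have h6 : 1 / (1 + (A x / C x) ^ 2) = C x ^ 2 / (C x ^ 2 + A x ^ 2) := by
    field_simp
  rw [h6]
  have h7 : C x ^ 2 / (C x ^ 2 + A x ^ 2) * ((U 0 * eulerD V x - V 0 * eulerD U x) * (C x)⁻¹ -
      A x * (C x ^ 2)⁻¹ * (U 0 * eulerD U x + V 0 * eulerD V x)) =
      (C x * (U 0 * eulerD V x - V 0 * eulerD U x) -
      A x * (U 0 * eulerD U x + V 0 * eulerD V x)) / (C x ^ 2 + A x ^ 2) := by
    field_simp
  rw [h7, mul_div_assoc', div_eq_iff h4, h5]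
  simp only [A, C]
  ring

/-- The action form of the pendulum in cylindrical coordinates: `W` is the reduced momentum. -/
theorem action_identity {l s τ β κ X₀ X₁ P₀ P₁ p₂ E₀ E₁ EZ Z W Eφ : ℝ}
    (hl : 0 < l) (hZ : 0 < Z) (hρ : 0 < X₀ ^ 2 + X₁ ^ 2)
    (ha : s ^ 2 * (X₀ * (X₀ + E₀) + X₁ * (X₁ + E₁)) + Z * EZ = 0)
    (hb : s ^ 2 * (X₀ * P₀ + X₁ * P₁) + Z * p₂ = 0)
    (hc : s ^ 2 * (X₀ * P₁ - X₁ * P₀) = s ^ 2 * τ * β)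
    (hd : s ^ 2 * (X₀ ^ 2 + X₁ ^ 2) + Z ^ 2 = l ^ 2)
    (hW : W * (Z * (X₀ ^ 2 + X₁ ^ 2)) = κ * l ^ 2 * (l + Z) * (X₀ * P₀ + X₁ * P₁))
    (hφ : (X₀ ^ 2 + X₁ ^ 2) * Eφ = X₀ * E₁ - X₁ * E₀) :
    κ * (s ^ 2 * P₀ * (X₀ + E₀) + s ^ 2 * P₁ * (X₁ + E₁) + p₂ * EZ) =
      -W / (1 + Z / l) * (EZ / l) + κ * β * (s ^ 2 * τ) * Eφ := by
  have h1 : -W / (1 + Z / l) * (EZ / l) = -W * EZ / (l + Z) := by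
    have : l + Z ≠ 0 := by positivity
    field_simp
  have hW' : W = κ * l ^ 2 * (l + Z) * (X₀ * P₀ + X₁ * P₁) / (Z * (X₀ ^ 2 + X₁ ^ 2)) := by
    rw [eq_div_iff (by positivity), hW]
  have hlZ : l + Z ≠ 0 := by positivity
  have h2 : -W * EZ / (l + Z) =
      -(κ * l ^ 2 * (X₀ * P₀ + X₁ * P₁) * EZ) / (Z * (X₀ ^ 2 + X₁ ^ 2)) := by
    rw [hW']
    field_simp
  have hρ' : X₀ ^ 2 + X₁ ^ 2 ≠ 0 := hρ.ne'
  have hφ' : Eφ = (X₀ * E₁ - X₁ * E₀) / (X₀ ^ 2 + X₁ ^ 2) := by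
    rw [eq_div_iff hρ', mul_comm, hφ]
  rw [h1, h2, hφ']
  have hne : Z * (X₀ ^ 2 + X₁ ^ 2) ≠ 0 := by positivity
  rw [← sub_eq_zero]
  have : (κ * (s ^ 2 * P₀ * (X₀ + E₀) + s ^ 2 * P₁ * (X₁ + E₁) + p₂ * EZ) -
      (-(κ * l ^ 2 * (X₀ * P₀ + X₁ * P₁) * EZ) / (Z * (X₀ ^ 2 + X₁ ^ 2)) +
        κ * β * (s ^ 2 * τ) * ((X₀ * E₁ - X₁ * E₀) / (X₀ ^ 2 + X₁ ^ 2)))) *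
      (Z * (X₀ ^ 2 + X₁ ^ 2)) = 0 := by
    have e : (κ * (s ^ 2 * P₀ * (X₀ + E₀) + s ^ 2 * P₁ * (X₁ + E₁) + p₂ * EZ) -
      (-(κ * l ^ 2 * (X₀ * P₀ + X₁ * P₁) * EZ) / (Z * (X₀ ^ 2 + X₁ ^ 2)) +
        κ * β * (s ^ 2 * τ) * ((X₀ * E₁ - X₁ * E₀) / (X₀ ^ 2 + X₁ ^ 2)))) *
      (Z * (X₀ ^ 2 + X₁ ^ 2)) =
      κ * (s ^ 2 * P₀ * (X₀ + E₀) + s ^ 2 * P₁ * (X₁ + E₁) + p₂ * EZ) * (Z * (X₀ ^ 2 + X₁ ^ 2)) +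
      κ * l ^ 2 * (X₀ * P₀ + X₁ * P₁) * EZ - κ * β * (s ^ 2 * τ) * (X₀ * E₁ - X₁ * E₀) * Z := by
      field_simp
      ring
    rw [e]
    linear_combination κ * (X₀ * P₀ + X₁ * P₁) * Z * ha + κ * EZ * (X₀ ^ 2 + X₁ ^ 2) * hb
      + κ * (X₀ * E₁ - X₁ * E₀) * Z * hc - κ * (X₀ * P₀ + X₁ * P₁) * EZ * hd
  exact (mul_eq_zero.mp this).resolve_right hne

/-- The equation of the elliptic curve. -/
theorem curve_identity {m g l ν κ s τ β X₀ X₁ P₀ P₁ P₂ Z W Y : ℝ} (hm : 0 < m)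
    (hl : 0 < l) (hν : 0 < ν) (hκ : κ * (m * l ^ 2 * ν) = 1) (hg : l * ν ^ 2 = g) (hs : s ≠ 0)
    (hZ : 0 < Z) (hρ : 0 < X₀ ^ 2 + X₁ ^ 2)
    (hb : s ^ 2 * (X₀ * P₀ + X₁ * P₁) + Z * (s * P₂) = 0)
    (hc : s ^ 2 * (X₀ * P₁ - X₁ * P₀) = s ^ 2 * τ * β)
    (hd : s ^ 2 * (X₀ ^ 2 + X₁ ^ 2) + Z ^ 2 = l ^ 2)
    (hW : W * (Z * (X₀ ^ 2 + X₁ ^ 2)) = κ * l ^ 2 * (l + Z) * (X₀ * P₀ + X₁ * P₁))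
    (hY : Y = -(X₀ ^ 2 + X₁ ^ 2) / (l * (l + Z))) :
    (4 + 2 * (s ^ 2 * Y)) * (1 - κ / ν * ((P₀ ^ 2 + P₁ ^ 2 + P₂ ^ 2) / (2 * m) + m * g * l * Y) / Y)
      - (κ * β * τ / Y) ^ 2 = W ^ 2 := by
  have hlZ : 0 < l + Z := by positivity
  set R := X₀ ^ 2 + X₁ ^ 2 with hR
  set D := X₀ * P₀ + X₁ * P₁ with hD
  have hW' : W = κ * l ^ 2 * (l + Z) * D / (Z * R) := by
    rw [eq_div_iff (by positivity), hW]
  have hP₂ : P₂ = -(s * D) / Z := by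
    rw [eq_div_iff hZ.ne']
    have : s * (P₂ * Z + s * D) = 0 := by linear_combination hb
    linarith [(mul_eq_zero.mp this).resolve_left hs]
  have hτ : X₀ * P₁ - X₁ * P₀ = τ * β := by
    have h2 : s ^ 2 ≠ 0 := pow_ne_zero _ hs
    apply mul_left_cancel₀ h2
    rw [hc]; ring
  -- Lagrange's identity separates the horizontal momentum into its radial and angular parts.
  have hP : (P₀ ^ 2 + P₁ ^ 2) * R = D ^ 2 + (τ * β) ^ 2 := by
    rw [← hτ]; simp only [hR, hD]; ring
  have hP' : P₀ ^ 2 + P₁ ^ 2 = (D ^ 2 + (τ * β) ^ 2) / R := by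
    rw [eq_div_iff hρ.ne', hP]
  have hκ' : κ = 1 / (m * l ^ 2 * ν) := by
    rw [eq_div_iff (by positivity), hκ]
  have hs2 : s ^ 2 = (l ^ 2 - Z ^ 2) / R := by
    rw [eq_div_iff hρ.ne']; linarith
  have e1 : s ^ 2 * Y = (Z - l) / l := by
    rw [hY, hs2]
    field_simp
    ring
  have e2 : P₂ ^ 2 = (l ^ 2 - Z ^ 2) / R * D ^ 2 / Z ^ 2 := by
    rw [hP₂, div_pow, neg_sq, mul_pow, hs2]
  rw [e1, e2, hP', hW', hY, hκ', ← hg]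
  field_simp
  ring

/-- The action integral of the pendulum over the vanishing cycle is invariant under symplectic
maps, expressed through resonant Taylor coefficients along the surface with position
`(s X₀, s X₁, l + s X₂)` and momentum `s P`. -/
theorem jet_action {m g l : ℝ} (hm : 0 < m) (hg : 0 < g) (hl : 0 < l)
    {X P : Fin 3 → ℝ × ℝ → ℝ} (hX : ∀ i, AnalyticAt ℝ (X i) 0) (hP : ∀ i, AnalyticAt ℝ (P i) 0)
    {α β : ℝ} {b : ℝ → ℝ} (hb : AnalyticAt ℝ b 0) {N : ℕ} (hN : 1 ≤ N)
    (h1 : ∀ᶠ x in 𝓝 (0 : ℝ × ℝ),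
      x.1 ^ 2 * (X 0 x ^ 2 + X 1 x ^ 2) + (l + x.1 * X 2 x) ^ 2 = l ^ 2)
    (h2 : ∀ᶠ x in 𝓝 (0 : ℝ × ℝ),
      x.1 ^ 2 * (X 0 x * P 0 x + X 1 x * P 1 x) + (l + x.1 * X 2 x) * (x.1 * P 2 x) = 0)
    (h3 : ∀ᶠ x in 𝓝 (0 : ℝ × ℝ),
      x.1 ^ 2 * (X 0 x * P 1 x - X 1 x * P 0 x) = x.1 ^ 2 * x.2 * β)
    (h4 : (fun x : ℝ × ℝ => x.1 ^ 2 * (P 0 x ^ 2 + P 1 x ^ 2 + P 2 x ^ 2) / (2 * m) +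
      m * g * (x.1 * X 2 x) - x.1 ^ 2 * x.2 * b (x.1 ^ 2 * x.2)) =O[𝓝 0]
        fun x => |x.1| ^ (2 * N + 1))
    (h5 : ∀ᶠ x in 𝓝 (0 : ℝ × ℝ),
      ∑ i, (pd₁ (fun x => ![0, 0, l] i + x.1 * X i x) x * pd₂ (fun x => x.1 * P i x) x -
        pd₂ (fun x => ![0, 0, l] i + x.1 * X i x) x * pd₁ (fun x => x.1 * P i x) x) = x.1 * α)
    (h6 : 0 < X 0 0 * P 0 0 + X 1 0 * P 1 0) (n : ℕ) (hn : n ≤ N) :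
    jet (2 * n) n (fun x => (ellipticIntegral
        (x.1 ^ 2 * x.2 * (kappa m g l / frequency g l * b (x.1 ^ 2 * x.2)))
        (kappa m g l * β * (x.1 ^ 2 * x.2))).re) =
      jet (2 * n) n (fun x => kappa m g l * α * (x.1 ^ 2 * x.2)) := by
  set ν := frequency g l with hνdef
  set κ := kappa m g l with hκdef
  have hν : 0 < ν := frequency_pos hg hl
  have hκ : κ * (m * l ^ 2 * ν) = 1 := kappa_mul hm hg hl
  have hgν : l * ν ^ 2 = g := frequency_sq hg hl
  have hκ0 : 0 < κ := kappa_pos hm hg hl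
  have hρ0 : 0 < X 0 0 ^ 2 + X 1 0 ^ 2 := by
    by_contra hcon
    have e0 : X 0 0 = 0 := by nlinarith [sq_nonneg (X 0 0), sq_nonneg (X 1 0)]
    have e1 : X 1 0 = 0 := by nlinarith [sq_nonneg (X 0 0), sq_nonneg (X 1 0)]
    rw [e0, e1] at h6
    simp at h6
  have hX0 := hX 0
  have hX1 := hX 1
  have hX2 := hX 2
  have hP0 := hP 0
  have hP1 := hP 1
  have hP2 := hP 2
  let R : ℝ × ℝ → ℝ := fun x => X 0 x ^ 2 + X 1 x ^ 2
  let D : ℝ × ℝ → ℝ := fun x => X 0 x * P 0 x + X 1 x * P 1 x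
  let Z : ℝ × ℝ → ℝ := fun x => l + x.1 * X 2 x
  -- By the constraint `l² - Z² = s² R` the height `y = Z / l - 1` equals `s² Y`, and this formula
  -- makes `Y` analytic and negative at `s = 0`. The function `W` below will be the positive square
  -- root of the radicand in `realBranch`; its sign is that of `D`.
  let Y : ℝ × ℝ → ℝ := fun x => -R x / (l * (l + Z x))
  let W : ℝ × ℝ → ℝ := fun x => κ * l ^ 2 * (l + Z x) * D x / (Z x * R x)
  let H : ℝ × ℝ → ℝ := fun x =>
    κ / ν * ((P 0 x ^ 2 + P 1 x ^ 2 + P 2 x ^ 2) / (2 * m) + m * g * l * Y x)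
  let b' : ℝ → ℝ := fun t => κ / ν * b t
  have hb' : AnalyticAt ℝ b' 0 := by fun_prop
  have hR : AnalyticAt ℝ R 0 := by fun_prop
  have hD : AnalyticAt ℝ D 0 := by fun_prop
  have hZ : AnalyticAt ℝ Z 0 := by fun_prop
  have hZ0 : Z 0 = l := by simp [Z]
  have hY : AnalyticAt ℝ Y 0 :=
    hR.fun_neg.fun_div (by fun_prop) (by rw [hZ0]; positivity)
  have hY0 : Y 0 < 0 := by
    simp only [Y, hZ0]
    exact div_neg_of_neg_of_pos (neg_neg_of_pos hρ0) (by positivity)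
  have hW : AnalyticAt ℝ W 0 := by
    refine AnalyticAt.fun_div (by fun_prop) (by fun_prop) ?_
    rw [hZ0]; exact (mul_pos hl hρ0).ne'
  have hW0 : 0 < W 0 := by
    simp only [W, hZ0]
    have : 0 < D 0 := h6
    have : 0 < R 0 := hρ0
    positivity
  have hH : AnalyticAt ℝ H 0 := by
    have : AnalyticAt ℝ (fun x => (P 0 x ^ 2 + P 1 x ^ 2 + P 2 x ^ 2) / (2 * m)) 0 := by
      simp only [div_eq_mul_inv]; fun_prop
    fun_prop
  have hbη := analyticAt_resonant hb'
  have evZ : ∀ᶠ x in 𝓝 0, 0 < Z x :=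
    continuousAt_const.eventually_lt hZ.continuousAt (by rw [hZ0]; exact hl)
  have evR : ∀ᶠ x in 𝓝 0, 0 < R x := continuousAt_const.eventually_lt hR.continuousAt hρ0
  have evW : ∀ᶠ x in 𝓝 0, 0 < W x := continuousAt_const.eventually_lt hW.continuousAt hW0
  have evY : ∀ᶠ x in 𝓝 0, Y x < 0 := hY.continuousAt.eventually_lt continuousAt_const hY0
  -- the height above the equilibrium
  have ey : ∀ᶠ x in 𝓝 (0 : ℝ × ℝ), x.1 ^ 2 * Y x = l⁻¹ * (Z x - l) := by
    filter_upwards [h1, evZ] with x hx hz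
    have : l + Z x ≠ 0 := by positivity
    simp only [Y]
    field_simp
    simp only [Z, R] at hx ⊢
    linear_combination -hx
  -- the energy
  have eH : ∀ᶠ x in 𝓝 (0 : ℝ × ℝ), x.1 ^ 2 * H x = κ / ν *
      (x.1 ^ 2 * (P 0 x ^ 2 + P 1 x ^ 2 + P 2 x ^ 2) / (2 * m) + m * g * (x.1 * X 2 x)) := by
    filter_upwards [ey] with x hx
    have h7 : l * (x.1 ^ 2 * Y x) = x.1 * X 2 x := by
      rw [hx, ← mul_assoc, mul_inv_cancel₀ hl.ne']; simp [Z]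
    simp only [H]
    linear_combination κ / ν * m * g * h7
  have hHO : (fun x : ℝ × ℝ => x.1 ^ 2 * H x - x.1 ^ 2 * x.2 * b' (x.1 ^ 2 * x.2)) =O[𝓝 0]
      fun x => |x.1| ^ (2 * N + 1) := by
    refine (h4.const_mul_left (κ / ν)).congr' ?_ EventuallyEq.rfl
    filter_upwards [eH] with x hx
    rw [hx]
    simp only [b']
    ring
  -- On the axis `τ = 0` the energy estimate reads `s² H = O(s³)`, because `N ≥ 1`. Without `H 0 =
  -- 0` the arguments of `realBranch` would not tend to the point where it is expanded.
  have hH0 : H 0 = 0 := by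
    have h8 : Tendsto (fun s : ℝ => ((s, 0) : ℝ × ℝ)) (𝓝 0) (𝓝 0) := by
      have : Continuous (fun s : ℝ => ((s, 0) : ℝ × ℝ)) := by fun_prop
      exact this.tendsto' _ _ rfl
    have h9 : AnalyticAt ℝ (fun s : ℝ => H (s, 0)) 0 :=
      AnalyticAt.fun_comp (f := fun s : ℝ => ((s, 0) : ℝ × ℝ)) hH (by fun_prop)
    have h10 := hHO.comp_tendsto h8
    have h11 : (fun s : ℝ => s ^ 2 * H (s, 0)) =O[𝓝 0] fun s => ‖s‖ ^ 3 := by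
      have h12 : (fun s : ℝ => |s| ^ (2 * N + 1)) =O[𝓝 0] fun s => ‖s‖ ^ 3 :=
        isBigO_norm_pow_le (E := ℝ) (by omega)
      refine (IsBigO.trans ?_ h12)
      refine h10.congr_left fun s => ?_
      simp
    obtain ⟨C, hC⟩ := h11.bound
    have h13 : ∀ᶠ s : ℝ in 𝓝[≠] 0, ‖H (s, 0)‖ ≤ C * |s| := by
      filter_upwards [hC.filter_mono nhdsWithin_le_nhds, self_mem_nhdsWithin] with s hs hs0
      have hs0' : 0 < |s| := abs_pos.mpr hs0
      rw [norm_mul, norm_pow, norm_pow, norm_norm, Real.norm_eq_abs s] at hs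
      have : |s| ^ 2 * ‖H (s, 0)‖ ≤ |s| ^ 2 * (C * |s|) := by linarith
      exact le_of_mul_le_mul_left this (by positivity)
    have h14 : Tendsto (fun s : ℝ => ‖H (s, 0)‖) (𝓝[≠] 0) (𝓝 ‖H (0, 0)‖) :=
      (h9.continuousAt.norm.tendsto).mono_left nhdsWithin_le_nhds
    have h15 : Tendsto (fun s : ℝ => C * |s|) (𝓝[≠] 0) (𝓝 0) := by
      have : Continuous fun s : ℝ => C * |s| := by fun_prop
      exact (this.tendsto' 0 0 (by simp)).mono_left nhdsWithin_le_nhds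
    have := le_of_tendsto_of_tendsto h14 h15 h13
    exact norm_le_zero_iff.mp this
  -- the arguments of the reduced action form
  let V : ℝ × ℝ → Fin 3 → ℝ := fun x => ![x.1 ^ 2 * Y x, H x / Y x, κ * β * x.2 / Y x]
  let V₀ : ℝ × ℝ → Fin 3 → ℝ := fun x =>
    ![x.1 ^ 2 * Y x, x.2 * b' (x.1 ^ 2 * x.2) / Y x, κ * β * x.2 / Y x]
  have hv : AnalyticAt ℝ (fun x => κ * β * x.2 / Y x) 0 := AnalyticAt.fun_div (by fun_prop) hY hY0.ne
  have hV : AnalyticAt ℝ V 0 := analyticAt_vec3 (by fun_prop) (hH.fun_div hY hY0.ne) hv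
  have hV₀ : AnalyticAt ℝ V₀ 0 :=
    analyticAt_vec3 (by fun_prop) ((analyticAt_snd.fun_mul hbη).fun_div hY hY0.ne) hv
  have hV0 : V 0 = 0 := by ext i; fin_cases i <;> simp [V, hH0]
  have hV₀0 : V₀ 0 = 0 := by ext i; fin_cases i <;> simp [V₀]
  have hG : AnalyticAt ℝ (fun x => realBranch (V x)) 0 :=
    AnalyticAt.fun_comp (by rw [hV0]; exact analyticAt_realBranch) hV
  have hG₀ : AnalyticAt ℝ (fun x => realBranch (V₀ x)) 0 :=
    AnalyticAt.fun_comp (by rw [hV₀0]; exact analyticAt_realBranch) hV₀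
  have hE : AnalyticAt ℝ (eulerD (fun x => x.1 ^ 2 * Y x)) 0 := analyticAt_eulerD (by fun_prop)
  obtain ⟨φ, hφ, hφE⟩ := exists_polar_angle hX0 hX1 hρ0
  -- positions and momenta
  let r : Fin 3 → ℝ × ℝ → ℝ := fun i x => ![0, 0, l] i + x.1 * X i x
  let p : Fin 3 → ℝ × ℝ → ℝ := fun i x => x.1 * P i x
  have hr : ∀ i, AnalyticAt ℝ (r i) 0 := fun i =>
    analyticAt_const.fun_add (analyticAt_fst.fun_mul (hX i))
  have hp : ∀ i, AnalyticAt ℝ (p i) 0 := fun i => analyticAt_fst.fun_mul (hP i)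
  have hpr : AnalyticAt ℝ (fun x => ∑ i, p i x * eulerD (r i) x) 0 :=
    Finset.analyticAt_fun_sum _ fun i _ => (hp i).fun_mul (analyticAt_eulerD (hr i))
  have hid : (fun x => κ * ∑ i, p i x * eulerD (r i) x) =ᶠ[𝓝 0]
      fun x => realBranch (V x) * eulerD (fun x => x.1 ^ 2 * Y x) x +
        eulerD (fun x => κ * β * (x.1 ^ 2 * x.2) * φ x) x := by
    have eyD := eulerD_congr (x := 0) ey
    have h1D := eulerD_congr (x := 0) (F := fun x : ℝ × ℝ =>
      x.1 ^ 2 * (X 0 x ^ 2 + X 1 x ^ 2) + (l + x.1 * X 2 x) ^ 2) (G := fun _ => l ^ 2) h1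
    filter_upwards [h1, h2, h3, evZ, evR, evW, evY, eyD, h1D, hφE, hX0.eventually_analyticAt,
      hX1.eventually_analyticAt, hX2.eventually_analyticAt, hY.eventually_analyticAt,
      hφ.eventually_analyticAt, ey] with x a1 a2 a3 z1 r1 w1 y1 eyD h1D hφE dX0 dX1 dX2 dY dφ ey
    have dX0 := dX0.differentiableAt
    have dX1 := dX1.differentiableAt
    have dX2 := dX2.differentiableAt
    have dY := dY.differentiableAt
    have dφ := dφ.differentiableAt
    have dZ : DifferentiableAt ℝ Z x := by fun_prop
    have eφ : eulerD (fun x => κ * β * (x.1 ^ 2 * x.2) * φ x) x =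
        κ * β * (x.1 ^ 2 * x.2) * eulerD φ x := by
      rw [eulerD_mul (by fun_prop) dφ]
      have := eulerD_resonant (x := x) (f := fun t => κ * β * t) (by fun_prop)
      rw [this]
      ring
    have e0 : eulerD (r 0) x = x.1 * (X 0 x + eulerD (X 0) x) := by
      rw [← eulerD_fst_mul dX0]
      congr 1
      ext y
      simp [r]
    have e1 : eulerD (r 1) x = x.1 * (X 1 x + eulerD (X 1) x) := by
      rw [← eulerD_fst_mul dX1]
      congr 1
      ext y
      simp [r]
    have e2 : eulerD (r 2) x = eulerD Z x := by
      congr 1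
    have eyE : eulerD (fun x => x.1 ^ 2 * Y x) x = eulerD Z x / l := by
      rw [eyD]
      have := eulerD_comp (x := x) (F := Z) (f := fun t => l⁻¹ * (t - l)) (f' := l⁻¹)
        (by simpa using ((hasDerivAt_id (Z x)).sub_const l).const_mul l⁻¹) dZ
      rw [this]
      ring
    have hcon : x.1 ^ 2 * (X 0 x * (X 0 x + eulerD (X 0) x) + X 1 x * (X 1 x + eulerD (X 1) x)) +
        Z x * eulerD Z x = 0 := by
      rw [eulerD_const, eulerD_add (by fun_prop) (by fun_prop),
        eulerD_sq_mul (F := fun x => X 0 x ^ 2 + X 1 x ^ 2) (by fun_prop),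
        eulerD_add (by fun_prop) (by fun_prop), eulerD_pow dX0, eulerD_pow dX1,
        eulerD_pow (F := fun x : ℝ × ℝ => l + x.1 * X 2 x) dZ] at h1D
      simp only [Nat.cast_ofNat, Nat.add_one_sub_one, pow_one] at h1D
      change _ + 2 * Z x * eulerD Z x = 0 at h1D
      linarith
    have hWx : W x * (Z x * (X 0 x ^ 2 + X 1 x ^ 2)) =
        κ * l ^ 2 * (l + Z x) * (X 0 x * P 0 x + X 1 x * P 1 x) := by
      simp only [W]
      rw [div_mul_cancel₀]
      exact (mul_pos z1 r1).ne'
    rw [eφ, eyE, Fin.sum_univ_three, e0, e1, e2]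
    simp only [p]
    rcases eq_or_ne x.1 0 with hs | hs
    -- `curve_identity` divides by `s`; on the axis `s = 0` both sides vanish separately.
    · have hEZ : eulerD Z x = 0 := by
        have h20 := eulerD_sq_mul dY
        rw [eyE, hs] at h20
        field_simp at h20
        simpa using h20
      rw [hs, hEZ]
      simp
    -- Positivity of `W`, inherited from `h6`, selects the branch of the square root.
    · have hbr : realBranch (V x) = -W x / (1 + Z x / l) := by
        have := curve_identity (κ := κ) (τ := x.2) (β := β) hm hl hν hκ hgν hs z1 r1 a2 a3 a1 hWx rfl
        simp only [realBranch, V, Matrix.cons_val_zero, Matrix.cons_val_one, Matrix.cons_val]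
        change -√((4 + 2 * (x.1 ^ 2 * Y x)) * (1 - H x / Y x) - (κ * β * x.2 / Y x) ^ 2) /
          (2 + x.1 ^ 2 * Y x) = _
        change (4 + 2 * (x.1 ^ 2 * Y x)) * (1 - H x / Y x) - (κ * β * x.2 / Y x) ^ 2 = _ at this
        rw [this, Real.sqrt_sq w1.le, ey]
        congr 1
        field_simp
        ring
      rw [hbr, ← action_identity hl z1 r1 hcon a2 a3 a1 hWx hφE]
      ring
  -- comparison of Taylor coefficients
  have hφ' : AnalyticAt ℝ (fun x => κ * β * (x.1 ^ 2 * x.2) * φ x) 0 := by fun_prop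
  have j1 := jet_congr hid (2 * n) n
  rw [jet_const_mul _ hpr, jet_action_form hr hp h5, jet_add (hG.fun_mul hE) (analyticAt_eulerD hφ'),
    jet_eulerD hφ', add_zero, ← jet_const_mul _ (by fun_prop)] at j1
  -- The derivative of `y` supplies a factor `s²`, so the energy error enters only through `s² H`,
  -- which is known up to `O(|s| ^ (2 N + 1))`. This does not reach the `s`-degree `2 n ≤ 2 N`.
  have hdiff : jet (2 * n) n (fun x => realBranch (V x) * eulerD (fun x => x.1 ^ 2 * Y x) x -
      realBranch (V₀ x) * eulerD (fun x => x.1 ^ 2 * Y x) x) = 0 := by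
    refine jet_eq_zero_of_isBigO_fst ((hG.fun_mul hE).fun_sub (hG₀.fun_mul hE))
      (k := 2 * N + 1) (by omega) ?_
    have k1 := analyticAt_realBranch.hasStrictFDerivAt.isBigO_sub
    have k2 : Tendsto (fun x => (V x, V₀ x)) (𝓝 0) (𝓝 ((0 : Fin 3 → ℝ), (0 : Fin 3 → ℝ))) := by
      have : ContinuousAt (fun x => (V x, V₀ x)) 0 := hV.continuousAt.prodMk hV₀.continuousAt
      simpa [ContinuousAt, hV0, hV₀0] using this
    have k3 := k1.comp_tendsto k2
    have k4 : (fun x => V x - V₀ x) =O[𝓝 0]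
        fun x => H x / Y x - x.2 * b' (x.1 ^ 2 * x.2) / Y x := by
      refine IsBigO.of_bound 1 (Eventually.of_forall fun x => ?_)
      rw [one_mul, pi_norm_le_iff_of_nonneg (norm_nonneg _)]
      intro i
      fin_cases i <;> simp [V, V₀]
    have k5 := k3.trans k4
    have k6 : eulerD (fun x => x.1 ^ 2 * Y x) =O[𝓝 0] fun x : ℝ × ℝ => x.1 ^ 2 := by
      have k7 : AnalyticAt ℝ (fun x => 2 * Y x + eulerD Y x) 0 :=
        (analyticAt_const.fun_mul hY).fun_add (analyticAt_eulerD hY)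
      have k8 := (isBigO_refl (fun x : ℝ × ℝ => x.1 ^ 2) (𝓝 0)).mul (k7.continuousAt.isBigO_one ℝ)
      simp only [mul_one] at k8
      refine k8.congr' ?_ EventuallyEq.rfl
      filter_upwards [hY.eventually_analyticAt] with x hx
      rw [eulerD_sq_mul hx.differentiableAt]
    have k9 := k5.mul k6
    have k10 : (fun x => (Y x)⁻¹) =O[𝓝 0] fun _ => (1 : ℝ) :=
      (hY.continuousAt.inv₀ hY0.ne).isBigO_one ℝ
    have k11 := k10.mul hHO
    simp only [one_mul] at k11
    refine (k9.congr' ?_ ?_).trans k11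
    · exact Eventually.of_forall fun x => by simp only [Function.comp_apply, sub_mul]
    · filter_upwards [evY] with x hx
      have := hx.ne
      field_simp
  rw [jet_sub (hG.fun_mul hE) (hG₀.fun_mul hE), sub_eq_zero] at hdiff
  rw [hdiff, jet_realBranch hY hY0 hb' (κ * β) n] at j1
  rw [← j1]
  simp only [mul_assoc]

/-! ### The linearisation at the equilibrium and the sign of the branch. -/

theorem hamiltonian_eq {m g l : ℝ} (hm : 0 < m) (hl : 0 < l) {x : Phase 3}
    (hx : x ∈ cotangentSphere l) :
    hamiltonian m g l x = x.2 ⬝ᵥ x.2 / (2 * m) + m * g * (x.1 2 - l) := by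
  obtain ⟨h1, h2⟩ := hx
  have h3 : angularMomentum x ⬝ᵥ angularMomentum x = l ^ 2 * (x.2 ⬝ᵥ x.2) := by
    rw [angularMomentum, cross_dot_cross, h1, dotProduct_comm x.2 x.1, h2]
    ring
  rw [hamiltonian, h3, h1, Real.sqrt_sq hl.le]
  field_simp

theorem angularMomentumZ_eq (x : Phase 3) :
    angularMomentumZ x = x.1 0 * x.2 1 - x.1 1 * x.2 0 := by
  simp [angularMomentumZ, angularMomentum, cross_apply]

theorem hamiltonian_upperEquilibrium {m g l : ℝ} (hm : 0 < m) (hl : 0 < l) :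
    hamiltonian m g l (upperEquilibrium l) = 0 := by
  rw [hamiltonian_eq hm hl]
  · simp [upperEquilibrium]
  · constructor <;> simp [upperEquilibrium, pow_two]

theorem eq_zero_of_pow_mul_isBigO {G : ℝ → ℝ} (hG : ContinuousAt G 0) {k : ℕ}
    (h : (fun s => s ^ k * G s) =O[𝓝 0] fun s => |s| ^ (k + 1)) : G 0 = 0 := by
  have h1 : G =O[𝓝[≠] 0] fun s => |s| := by
    have h2 := (isBigO_refl (fun s : ℝ => (s ^ k)⁻¹) (𝓝[≠] 0)).mul (h.mono nhdsWithin_le_nhds)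
    refine (h2.congr' ?_ EventuallyEq.rfl).trans (IsBigO.of_bound 1 (Eventually.of_forall fun s => ?_))
    · filter_upwards [self_mem_nhdsWithin] with s hs
      have : s ≠ 0 := hs
      field_simp
    · by_cases hs : s = 0
      · simp [hs]
      · simp only [norm_mul, norm_inv, norm_pow, Real.norm_eq_abs, abs_abs, one_mul, pow_succ]
        rw [inv_mul_cancel_left₀ (pow_ne_zero _ (abs_ne_zero.mpr hs))]
  have h3 : Tendsto (fun s : ℝ => |s|) (𝓝[≠] 0) (𝓝 0) := by
    have : ContinuousAt (fun s : ℝ => |s|) 0 := by fun_prop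
    simpa [ContinuousAt] using this.tendsto.mono_left nhdsWithin_le_nhds
  exact tendsto_nhds_unique (hG.tendsto.mono_left nhdsWithin_le_nhds) (h1.trans_tendsto h3)

theorem analyticAt_clm_apply {E F G : Type*} [NormedAddCommGroup E] [NormedSpace ℝ E]
    [NormedAddCommGroup F] [NormedSpace ℝ F] [NormedAddCommGroup G] [NormedSpace ℝ G]
    {L : G → E →L[ℝ] F} {c : G → E} {x : G} (hL : AnalyticAt ℝ L x) (hc : AnalyticAt ℝ c x) :
    AnalyticAt ℝ (fun y => L y (c y)) x :=
  ((ContinuousLinearMap.id ℝ (E →L[ℝ] F)).analyticAt_bilinear (L x, c x)).comp₂ hL hc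

theorem map_zero_of_isNormalFormUpTo {m g l : ℝ} (hm : 0 < m) (hl : 0 < l) {N : ℕ}
    {B : ℝ × ℝ → ℝ} (hB : IsNormalFormUpTo m g l N B) : B 0 = 0 := by
  obtain ⟨-, Φ, hΦ, -, h⟩ := hB
  have h1 := eq_zero_of_isBigO_norm_pow h (by omega)
  rw [hΦ.map_zero, hamiltonian_upperEquilibrium hm hl] at h1
  have h2 : ((quadJ₁ 0, quadJ₂ 0) : ℝ × ℝ) = 0 := by simp [quadJ₁, quadJ₂]
  rw [h2] at h1
  linarith

/-- By `hpar` and `hQ` the momentum `(c, d)` is `±mν` times the position `(a, b)`. The sign is `+`: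
with the other sign `hmix` and `hω` would contradict each other. -/
theorem parallel_positive {m ν : ℝ} (hm : 0 < m) (hν : 0 < ν) {a b c d a' b' c' d' : ℝ}
    (hpar : a * d - b * c = 0) (hQ : c ^ 2 + d ^ 2 = (m * ν) ^ 2 * (a ^ 2 + b ^ 2))
    (hmix : c * c' + d * d' - (m * ν) ^ 2 * (a * a' + b * b') = m * ν)
    (hω : a * c' + b * d' - (a' * c + b' * d) = 1) : 0 < a * c + b * d := by
  have hS : 0 < a ^ 2 + b ^ 2 := by
    rcases (add_nonneg (sq_nonneg a) (sq_nonneg b)).lt_or_eq with h | h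
    · exact h
    · exfalso
      have ha : a = 0 := by nlinarith [sq_nonneg a, sq_nonneg b]
      have hb : b = 0 := by nlinarith [sq_nonneg a, sq_nonneg b]
      rw [← h] at hQ
      have hc : c = 0 := by nlinarith [sq_nonneg c, sq_nonneg d]
      have hd : d = 0 := by nlinarith [sq_nonneg c, sq_nonneg d]
      subst ha hb hc hd
      norm_num at hω
  have hc : c * (a ^ 2 + b ^ 2) = (a * c + b * d) * a := by linear_combination -b * hpar
  have hd : d * (a ^ 2 + b ^ 2) = (a * c + b * d) * b := by linear_combination a * hpar
  have hT : (a * c + b * d) ^ 2 = (m * ν) ^ 2 * (a ^ 2 + b ^ 2) ^ 2 := by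
    linear_combination (a ^ 2 + b ^ 2) * hQ - (a * d - b * c) * hpar
  have h2 : (a ^ 2 + b ^ 2) * (a * c + b * d) = (a ^ 2 + b ^ 2) * (m * ν * (a ^ 2 + b ^ 2)) := by
    have e : (a ^ 2 + b ^ 2) ^ 2 * (m * ν) = (a ^ 2 + b ^ 2) * (a * c + b * d) := by
      rw [← hmix]
      linear_combination (a^2+b^2) * (c' * hc + d' * hd) - (a * a' + b * b') * (-1) * hT
         + (a^2+b^2) * (a * c + b * d) * hω + (a * c + b * d) * (a' * hc + b' * hd)
    linear_combination -e
  have h3 := mul_left_cancel₀ hS.ne' h2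
  rw [h3]
  positivity

theorem eq_zero_of_eventually_pow_mul {G : ℝ → ℝ} (hG : ContinuousAt G 0) (k : ℕ)
    (h : ∀ᶠ s in 𝓝 0, s ^ k * G s = 0) : G 0 = 0 :=
  eq_zero_of_pow_mul_isBigO (k := k) hG 
    ((isBigO_zero _ _).congr' (h.mono fun _ hs => hs.symm) EventuallyEq.rfl)

/-- The quadratic part of a normal form, seen in the linearised coordinates. -/
theorem linearised_normalForm {m g l : ℝ} (hm : 0 < m) (hl : 0 < l) {B : ℝ × ℝ → ℝ}
    (hB : AnalyticAt ℝ B 0) (hB0 : B 0 = 0) {Φ : Phase 2 → Phase 3}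
    (hΦ : IsSymplecticCoordinates l Φ)
    (hL : ∀ᶠ z in 𝓝 (0 : Phase 2), angularMomentumZ (Φ z) = quadJ₂ z)
    (hH : (fun z : Phase 2 => hamiltonian m g l (Φ z) - B (quadJ₁ z, quadJ₂ z))
      =O[𝓝 0] fun z => ‖z‖ ^ 3) (v : Phase 2) :
    (fderiv ℝ Φ 0 v).1 2 = 0 ∧ (fderiv ℝ Φ 0 v).2 2 = 0 ∧
    (fderiv ℝ Φ 0 v).1 0 * (fderiv ℝ Φ 0 v).2 1 - (fderiv ℝ Φ 0 v).1 1 * (fderiv ℝ Φ 0 v).2 0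
      = quadJ₂ v ∧
    ((fderiv ℝ Φ 0 v).2 0 ^ 2 + (fderiv ℝ Φ 0 v).2 1 ^ 2) / (2 * m)
      - m * g / (2 * l) * ((fderiv ℝ Φ 0 v).1 0 ^ 2 + (fderiv ℝ Φ 0 v).1 1 ^ 2)
      = fderiv ℝ B 0 (quadJ₁ v, quadJ₂ v) := by
  obtain ⟨L, hLa, hL0, hLΦ⟩ := hadamard hΦ.analytic
  obtain ⟨K, hKa, hK0, hKB⟩ := hadamard hB
  have hline : Tendsto (fun s : ℝ => s • v) (𝓝 0) (𝓝 0) := by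
    have : ContinuousAt (fun s : ℝ => s • v) 0 := by fun_prop
    simpa [ContinuousAt] using this
  have hline2 : Tendsto (fun s : ℝ => (s ^ 2 * quadJ₁ v, s ^ 2 * quadJ₂ v)) (𝓝 0) (𝓝 0) := by
    have : ContinuousAt (fun s : ℝ => (s ^ 2 * quadJ₁ v, s ^ 2 * quadJ₂ v)) 0 := by fun_prop
    simpa [ContinuousAt, ← Prod.zero_eq_mk] using this
  set w : ℝ → Phase 3 := fun s => L (s • v) v with hw
  have hwc : ContinuousAt w 0 := by
    have : ContinuousAt L (0 : Phase 2) := hLa.continuousAt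
    exact ContinuousAt.clm_apply (ContinuousAt.comp (by simpa using this) (by fun_prop))
      continuousAt_const
  have hw0 : w 0 = fderiv ℝ Φ 0 v := by simp [hw, hL0]
  have hw1 : ∀ i, ContinuousAt (fun s => (w s).1 i) 0 := fun i => by fun_prop
  have hw2 : ∀ i, ContinuousAt (fun s => (w s).2 i) 0 := fun i => by fun_prop
  have e0 := hline.eventually hLΦ
  have e1 := hline.eventually hΦ.mem
  have e2 := hline.eventually hL
  have e3 := hline2.eventually hKB
  have hΦw : ∀ᶠ s in 𝓝 (0 : ℝ), Φ (s • v) = upperEquilibrium l + s • w s := by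
    filter_upwards [e0] with s hs
    rw [hs, hΦ.map_zero]
    simp [hw]
  have hr : ∀ᶠ s in 𝓝 (0 : ℝ), s * (s * ((w s).1 0 ^ 2 + (w s).1 1 ^ 2 + (w s).1 2 ^ 2)
      + 2 * l * (w s).1 2) = 0 ∧ s * (s * ((w s).1 0 * (w s).2 0 + (w s).1 1 * (w s).2 1
        + (w s).1 2 * (w s).2 2) + l * (w s).2 2) = 0 := by
    filter_upwards [hΦw, e1] with s hs hs'
    rw [hs] at hs'
    obtain ⟨h1, h2⟩ := hs'
    simp [upperEquilibrium, dotProduct, Fin.sum_univ_three] at h1 h2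
    constructor <;> linarith
  have z1 : (w 0).1 2 = 0 := by
    have := eq_zero_of_eventually_pow_mul (G := fun s => s * ((w s).1 0 ^ 2 + (w s).1 1 ^ 2 +
      (w s).1 2 ^ 2) + 2 * l * (w s).1 2) (by fun_prop) 1 (hr.mono fun s hs => by simpa using hs.1)
    simpa [hl.ne'] using this
  have z2 : (w 0).2 2 = 0 := by
    have := eq_zero_of_eventually_pow_mul (G := fun s => s * ((w s).1 0 * (w s).2 0 +
      (w s).1 1 * (w s).2 1 + (w s).1 2 * (w s).2 2) + l * (w s).2 2) (by fun_prop) 1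
      (hr.mono fun s hs => by simpa using hs.2)
    simpa [hl.ne'] using this
  have hJ₁ : ∀ s : ℝ, quadJ₁ (s • v) = s ^ 2 * quadJ₁ v := fun s => by
    simp only [quadJ₁, Prod.smul_fst, Prod.smul_snd, Pi.smul_apply, smul_eq_mul]; ring
  have hJ₂ : ∀ s : ℝ, quadJ₂ (s • v) = s ^ 2 * quadJ₂ v := fun s => by
    simp only [quadJ₂, Prod.smul_fst, Prod.smul_snd, Pi.smul_apply, smul_eq_mul]; ring
  have z3 : (w 0).1 0 * (w 0).2 1 - (w 0).1 1 * (w 0).2 0 = quadJ₂ v := by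
    have := eq_zero_of_eventually_pow_mul (G := fun s => (w s).1 0 * (w s).2 1 -
      (w s).1 1 * (w s).2 0 - quadJ₂ v) (by fun_prop) 2 (by
        filter_upwards [hΦw, e2] with s hs hs'
        rw [hs, hJ₂, angularMomentumZ_eq] at hs'
        simp [upperEquilibrium] at hs'
        linarith)
    linarith
  rw [hw0] at z1 z2 z3
  refine ⟨z1, z2, z3, ?_⟩
  have hKc : ContinuousAt (fun s : ℝ => K (s ^ 2 * quadJ₁ v, s ^ 2 * quadJ₂ v)
      (quadJ₁ v, quadJ₂ v)) 0 := by
    have : ContinuousAt K (0 : ℝ × ℝ) := hKa.continuousAt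
    exact ContinuousAt.clm_apply (ContinuousAt.comp
      (by simpa [← Prod.zero_eq_mk] using this) (by fun_prop))
      continuousAt_const
  have h4 := eq_zero_of_pow_mul_isBigO (k := 2) (G := fun s => ((w s).2 0 ^ 2 + (w s).2 1 ^ 2
      + (w s).2 2 ^ 2) / (2 * m) - m * g / (2 * l) * ((w s).1 0 ^ 2 + (w s).1 1 ^ 2 +
      (w s).1 2 ^ 2) - K (s ^ 2 * quadJ₁ v, s ^ 2 * quadJ₂ v) (quadJ₁ v, quadJ₂ v))
      (ContinuousAt.sub (by fun_prop (disch := positivity)) hKc) (by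
        have h5 := hH.comp_tendsto hline
        have h6 : (fun s : ℝ => ‖s • v‖ ^ 3) =O[𝓝 0] fun s : ℝ => |s| ^ 3 := by
          refine IsBigO.of_bound (‖v‖ ^ 3) (Eventually.of_forall fun t => ?_)
          simp [norm_smul, mul_pow, mul_comm]
        refine (h5.trans h6).congr' ?_ EventuallyEq.rfl
        filter_upwards [hΦw, e1, e3, hr] with s hs hs1 hs3 hs4
        simp only [Function.comp_apply]
        rw [hamiltonian_eq hm hl hs1, hJ₁, hJ₂, hs3, hB0, hs]
        have h7 : ((s ^ 2 * quadJ₁ v, s ^ 2 * quadJ₂ v) : ℝ × ℝ) = s ^ 2 • (quadJ₁ v, quadJ₂ v) := by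
          simp
        have h8 : ∀ A : ℝ × ℝ →L[ℝ] ℝ, A (s ^ 2 * quadJ₁ v, s ^ 2 * quadJ₂ v)
            = s ^ 2 * A (quadJ₁ v, quadJ₂ v) := fun A => by
          rw [h7, map_smul, smul_eq_mul]
        rw [h8]
        simp [upperEquilibrium, dotProduct, Fin.sum_univ_three]
        -- The sphere constraint turns the linear height term into the quadratic term `-(m g / 2 l)
        -- |r - l e_z|²`.
        have h9 := hs4.1
        field_simp
        linear_combination m ^ 2 * g * h9)
  simp only [hw0, z1, z2] at h4
  have h10 : K ((0:ℝ) ^ 2 * quadJ₁ v, (0:ℝ) ^ 2 * quadJ₂ v) = fderiv ℝ B 0 := by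
    rw [← hK0]; congr 1; simp
  rw [h10] at h4
  linear_combination h4

/-- The image of the `q₁`-axis lies in the unstable direction, where position and momentum are
positively parallel. This rests on the leading coefficient being `+ν` and on symplecticity, and it
decides which root of the elliptic curve occurs. -/
theorem dot_linearised_pos {m g l : ℝ} (hm : 0 < m) (hg : 0 < g) (hl : 0 < l) {B : ℝ × ℝ → ℝ}
    (hB : AnalyticAt ℝ B 0) (hB0 : B 0 = 0) (hB1 : fderiv ℝ B 0 (1, 0) = frequency g l)
    {Φ : Phase 2 → Phase 3} (hΦ : IsSymplecticCoordinates l Φ)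
    (hL : ∀ᶠ z in 𝓝 (0 : Phase 2), angularMomentumZ (Φ z) = quadJ₂ z)
    (hH : (fun z : Phase 2 => hamiltonian m g l (Φ z) - B (quadJ₁ z, quadJ₂ z))
      =O[𝓝 0] fun z => ‖z‖ ^ 3) :
    0 < (fderiv ℝ Φ 0 (![1, 0], 0)).1 0 * (fderiv ℝ Φ 0 (![1, 0], 0)).2 0 +
      (fderiv ℝ Φ 0 (![1, 0], 0)).1 1 * (fderiv ℝ Φ 0 (![1, 0], 0)).2 1 := by
  have h := linearised_normalForm hm hl hB hB0 hΦ hL hH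
  have hω := hΦ.symplectic.self_of_nhds (![1, 0], 0) (0, ![1, 0])
  obtain ⟨e1, e2, e3, e4⟩ := h (![1, 0], 0)
  obtain ⟨f1, f2, f3, f4⟩ := h (0, ![1, 0])
  obtain ⟨-, -, -, s4⟩ := h ((![1, 0], 0) + (0, ![1, 0]))
  rw [map_add] at s4
  generalize fderiv ℝ Φ 0 (![1, 0], 0) = D at *
  generalize fderiv ℝ Φ 0 (0, ![1, 0]) = D' at *
  have hν := frequency_pos hg hl
  have hν2 := frequency_sq hg hl
  set ν := frequency g l
  have z0 : fderiv ℝ B 0 (0, 0) = 0 := map_zero _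
  simp [quadJ₁, quadJ₂, canonicalForm, dotProduct, Fin.sum_univ_three, hB1, z0, e1, e2, f1, f2,
    ← hν2] at e3 e4 f3 f4 s4 hω
  have e4' : D.2 0 ^ 2 + D.2 1 ^ 2 = (m * ν) ^ 2 * (D.1 0 ^ 2 + D.1 1 ^ 2) := by
    field_simp at e4
    linear_combination e4
  have f4' : D'.2 0 ^ 2 + D'.2 1 ^ 2 = (m * ν) ^ 2 * (D'.1 0 ^ 2 + D'.1 1 ^ 2) := by
    field_simp at f4
    linear_combination f4
  refine parallel_positive (a' := D'.1 0) (b' := D'.1 1) (c' := D'.2 0) (d' := D'.2 1) hm hν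
    (by linear_combination e3) e4' ?_ (by linear_combination hω)
  field_simp at s4
  linear_combination s4 / 2 - e4' / 2 - f4' / 2

theorem pd_comp_fst {F : ℝ × ℝ → Phase 3} {x : ℝ × ℝ} (hF : DifferentiableAt ℝ F x) (i : Fin 3) :
    pd₁ (fun y => (F y).1 i) x = (fderiv ℝ F x (1, 0)).1 i ∧
      pd₂ (fun y => (F y).1 i) x = (fderiv ℝ F x (0, 1)).1 i := by
  have h := hasFDerivAt_pi'.mp hF.hasFDerivAt.fst i
  rw [pd₁, pd₂, h.fderiv]
  exact ⟨rfl, rfl⟩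

theorem pd_comp_snd {F : ℝ × ℝ → Phase 3} {x : ℝ × ℝ} (hF : DifferentiableAt ℝ F x) (i : Fin 3) :
    pd₁ (fun y => (F y).2 i) x = (fderiv ℝ F x (1, 0)).2 i ∧
      pd₂ (fun y => (F y).2 i) x = (fderiv ℝ F x (0, 1)).2 i := by
  have h := hasFDerivAt_pi'.mp hF.hasFDerivAt.snd i
  rw [pd₁, pd₂, h.fderiv]
  exact ⟨rfl, rfl⟩

/-! ### From a normal form of finite order to the inverse of the action. -/

/-- The surface `q = (s, 0)`, `p = s τ (α, β)`, on which `J₁ = s² τ α` and `J₂ = s² τ β`. -/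
def testSurface (α β : ℝ) (x : ℝ × ℝ) : Phase 2 := (![x.1, 0], ![x.1 * x.2 * α, x.1 * x.2 * β])

theorem analyticAt_vec2 {E : Type*} [NormedAddCommGroup E] [NormedSpace ℝ E] {f g : E → ℝ}
    {x : E} (hf : AnalyticAt ℝ f x) (hg : AnalyticAt ℝ g x) :
    AnalyticAt ℝ (fun x => ![f x, g x]) x := by
  rw [analyticAt_pi_iff]
  intro i
  fin_cases i
  · exact hf
  · exact hg

theorem analyticAt_testSurface (α β : ℝ) (x : ℝ × ℝ) : AnalyticAt ℝ (testSurface α β) x :=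
  (analyticAt_vec2 (by fun_prop) (by fun_prop)).prod (analyticAt_vec2 (by fun_prop) (by fun_prop))

theorem fderiv_testSurface (α β : ℝ) (x v : ℝ × ℝ) : fderiv ℝ (testSurface α β) x v =
    (![v.1, 0], ![(v.1 * x.2 + x.1 * v.2) * α, (v.1 * x.2 + x.1 * v.2) * β]) := by
  have hd := (analyticAt_testSurface α β x).differentiableAt.hasFDerivAt
  have h2 : HasFDerivAt (fun y : ℝ × ℝ => y.1 * y.2) (x.1 • ContinuousLinearMap.snd ℝ ℝ ℝ +
      x.2 • ContinuousLinearMap.fst ℝ ℝ ℝ) x := hasFDerivAt_fst.mul hasFDerivAt_snd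
  have e1 : ∀ i, (fderiv ℝ (testSurface α β) x v).1 i =
      fderiv ℝ (fun y => (testSurface α β y).1 i) x v := fun i => by
    rw [(hasFDerivAt_pi'.mp hd.fst i).fderiv]; rfl
  have e2 : ∀ i, (fderiv ℝ (testSurface α β) x v).2 i =
      fderiv ℝ (fun y => (testSurface α β y).2 i) x v := fun i => by
    rw [(hasFDerivAt_pi'.mp hd.snd i).fderiv]; rfl
  ext i
  · rw [e1]
    fin_cases i
    · change fderiv ℝ (fun y : ℝ × ℝ => y.1) x v = v.1
      rw [hasFDerivAt_fst.fderiv]; rfl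
    · change fderiv ℝ (fun y : ℝ × ℝ => (0 : ℝ)) x v = 0
      simp
  · rw [e2]
    fin_cases i
    · change fderiv ℝ (fun y : ℝ × ℝ => y.1 * y.2 * α) x v = (v.1 * x.2 + x.1 * v.2) * α
      rw [(h2.mul_const α).fderiv]
      simp; ring
    · change fderiv ℝ (fun y : ℝ × ℝ => y.1 * y.2 * β) x v = (v.1 * x.2 + x.1 * v.2) * β
      rw [(h2.mul_const β).fderiv]
      simp; ring

/-- `jet_action` is applied to the image of the test surface. Along it the error of the normal form
is `O(|s| ^ (2 N + 1))`, and the canonical form pulls back to `α s ds ∧ dτ`. -/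
theorem jet_normalForm {m g l : ℝ} (hm : 0 < m) (hg : 0 < g) (hl : 0 < l) {B : ℝ × ℝ → ℝ}
    (hB : AnalyticAt ℝ B 0) {N : ℕ} (hN : 1 ≤ N) (hBN : IsNormalFormUpTo m g l N B) {α β : ℝ}
    {b : ℝ → ℝ} (hb : AnalyticAt ℝ b 0) (hbB : ∀ᶠ t in 𝓝 (0 : ℝ), B (t * α, t * β) = t * b t)
    (n : ℕ) (hn : n ≤ N) :
    jet (2 * n) n (fun x => (ellipticIntegral
        (x.1 ^ 2 * x.2 * (kappa m g l / frequency g l * b (x.1 ^ 2 * x.2)))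
        (kappa m g l * β * (x.1 ^ 2 * x.2))).re) =
      jet (2 * n) n (fun x => kappa m g l * α * (x.1 ^ 2 * x.2)) := by
  have hB0 := map_zero_of_isNormalFormUpTo hm hl hBN
  obtain ⟨hB1, Φ, hΦ, hL, hH⟩ := hBN
  have hpos := dot_linearised_pos hm hg hl hB hB0 hB1 hΦ hL
    (hH.trans (isBigO_norm_pow_le (by omega)))
  obtain ⟨K, hK, hK0, hKΦ⟩ := hadamard hΦ.analytic
  set z := testSurface α β with hz
  -- The surface is `s` times `c`, so Hadamard's lemma splits a factor `s` off the displacement from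
  -- the equilibrium; the cofactor at `0` is the derivative of `Φ` along `q₁`.
  let c : ℝ × ℝ → Phase 2 := fun x => (![1, 0], ![x.2 * α, x.2 * β])
  have hzc : ∀ x, z x = x.1 • c x := fun x => by
    ext i <;> fin_cases i <;> simp [hz, testSurface, c] <;> ring
  have hc : AnalyticAt ℝ c 0 :=
    (analyticAt_vec2 (by fun_prop) (by fun_prop)).prod
      (analyticAt_vec2 (by fun_prop) (by fun_prop))
  have hza : ∀ x, AnalyticAt ℝ z x := analyticAt_testSurface α β
  have hz0 : z 0 = 0 := by rw [hzc]; simp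
  have ht : Tendsto z (𝓝 0) (𝓝 0) := by simpa [ContinuousAt, hz0] using (hza 0).continuousAt
  let w : ℝ × ℝ → Phase 3 := fun x => K (z x) (c x)
  have hw : AnalyticAt ℝ w 0 :=
    analyticAt_clm_apply (AnalyticAt.fun_comp (by rwa [hz0]) (hza 0)) hc
  have hw0 : w 0 = fderiv ℝ Φ 0 (![1, 0], 0) := by
    have : c 0 = (![1, 0], 0) := by simp [c]
    simp only [w, hz0, hK0, this]
  have eΦ : ∀ᶠ x in 𝓝 (0 : ℝ × ℝ), Φ (z x) = upperEquilibrium l + x.1 • w x := by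
    filter_upwards [ht.eventually hKΦ] with x hx
    rw [hx, hΦ.map_zero]
    simp only [w]
    rw [← map_smul, ← hzc]
  have e0 : ∀ x : ℝ × ℝ, (upperEquilibrium l + x.1 • w x).1 = ![x.1 * (w x).1 0, x.1 * (w x).1 1,
      l + x.1 * (w x).1 2] := fun x => by
    ext i; fin_cases i <;> simp [upperEquilibrium]
  have e1 : ∀ x : ℝ × ℝ, (upperEquilibrium l + x.1 • w x).2 = ![x.1 * (w x).2 0, x.1 * (w x).2 1,
      x.1 * (w x).2 2] := fun x => by
    ext i; fin_cases i <;> simp [upperEquilibrium]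
  have hQ₁ : ∀ x, quadJ₁ (z x) = x.1 ^ 2 * x.2 * α := fun x => by
    simp [quadJ₁, hz, testSurface]; ring
  have hQ₂ : ∀ x, quadJ₂ (z x) = x.1 ^ 2 * x.2 * β := fun x => by
    simp [quadJ₂, hz, testSurface]; ring
  refine jet_action hm hg hl (X := fun i x => (w x).1 i) (P := fun i x => (w x).2 i)
    (fun i => by fun_prop) (fun i => by fun_prop) hb hN ?_ ?_ ?_ ?_ ?_ ?_ n hn
  · filter_upwards [eΦ, ht.eventually hΦ.mem] with x hx hx'
    rw [hx] at hx'
    have := hx'.1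
    rw [e0] at this
    simp [dotProduct, Fin.sum_univ_three] at this
    linear_combination this
  · filter_upwards [eΦ, ht.eventually hΦ.mem] with x hx hx'
    rw [hx] at hx'
    have := hx'.2
    rw [e0, e1] at this
    simp [dotProduct, Fin.sum_univ_three] at this
    linear_combination this
  · filter_upwards [eΦ, ht.eventually hL] with x hx hx'
    rw [hx, angularMomentumZ_eq, e0, e1, hQ₂] at hx'
    simp at hx'
    linear_combination hx'
  · have h5 := hH.comp_tendsto ht
    have h6 : (fun x : ℝ × ℝ => ‖z x‖ ^ (2 * N + 1)) =O[𝓝 0]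
        fun x : ℝ × ℝ => |x.1| ^ (2 * N + 1) := by
      have h7 : z =O[𝓝 0] fun x : ℝ × ℝ => x.1 * (1 : ℝ) := by
        have := (isBigO_refl (fun x : ℝ × ℝ => x.1) (𝓝 0)).smul (hc.continuousAt.isBigO_one ℝ)
        exact this.congr_left fun x => (hzc x).symm
      simpa using (h7.norm_norm).pow (2 * N + 1)
    have hs : Tendsto (fun x : ℝ × ℝ => x.1 ^ 2 * x.2) (𝓝 0) (𝓝 0) := by
      have : Continuous (fun x : ℝ × ℝ => x.1 ^ 2 * x.2) := by fun_prop
      exact this.tendsto' _ _ (by simp)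
    refine (h5.trans h6).congr' ?_ EventuallyEq.rfl
    filter_upwards [eΦ, ht.eventually hΦ.mem, hs.eventually hbB] with x hx hx' hxb
    simp only [Function.comp_apply]
    rw [hamiltonian_eq hm hl hx', hQ₁, hQ₂, hxb, hx, e0, e1]
    simp [dotProduct, Fin.sum_univ_three]
    ring
  · have eΦ' := eΦ.eventually_nhds
    have hd := ht.eventually hΦ.analytic.eventually_analyticAt
    filter_upwards [eΦ', ht.eventually hΦ.symplectic, hd] with x hx hs hd
    have hG : DifferentiableAt ℝ (fun y => Φ (z y)) x :=
      DifferentiableAt.comp x hd.differentiableAt (hza x).differentiableAt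
    have hG' : ∀ v, fderiv ℝ (fun y => Φ (z y)) x v = fderiv ℝ Φ (z x) (fderiv ℝ z x v) := fun v => by
      have := fderiv_comp x hd.differentiableAt (hza x).differentiableAt
      exact DFunLike.congr_fun this v
    have a0 : ∀ i, (fun y : ℝ × ℝ => ![0, 0, l] i + y.1 * (w y).1 i) =ᶠ[𝓝 x]
        fun y => (Φ (z y)).1 i := fun i => by
      filter_upwards [hx] with y hy
      rw [hy]; simp [upperEquilibrium]
    have a1 : ∀ i, (fun y : ℝ × ℝ => y.1 * (w y).2 i) =ᶠ[𝓝 x]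
        fun y => (Φ (z y)).2 i := fun i => by
      filter_upwards [hx] with y hy
      rw [hy]; simp [upperEquilibrium]
    have hω := hs (fderiv ℝ z x (1, 0)) (fderiv ℝ z x (0, 1))
    rw [← hG', ← hG', hz, fderiv_testSurface, fderiv_testSurface] at hω
    rw [Fin.sum_univ_three]
    simp only [fun i => (pd₁_congr (a0 i)).self_of_nhds, fun i => (pd₂_congr (a0 i)).self_of_nhds,
      fun i => (pd₁_congr (a1 i)).self_of_nhds, fun i => (pd₂_congr (a1 i)).self_of_nhds,
      fun i => (pd_comp_fst hG i).1, fun i => (pd_comp_fst hG i).2,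
      fun i => (pd_comp_snd hG i).1, fun i => (pd_comp_snd hG i).2]
    simp [canonicalForm, dotProduct, Fin.sum_univ_three] at hω
    linear_combination hω
  · simpa only [hw0] using hpos

theorem ellipticIntegral_zero_re : (ellipticIntegral 0 0).re = 0 := by
  obtain ⟨s, c, -, h⟩ := exists_residue_expansion 1
  have h1 := eq_zero_of_isBigO_norm_pow h one_ne_zero
  have h2 : residueSum s c 0 0 = 0 := by
    refine Finset.sum_eq_zero fun μ hμ => ?_
    rw [Finset.mem_filter] at hμ
    rcases Nat.eq_zero_or_pos (μ 1) with h | h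
    · have : μ 2 ≠ 0 := by omega
      simp [this]
    · simp [h.ne']
  simpa [h2] using h1

theorem analyticAt_imaginaryAction (m g l : ℝ) :
    AnalyticAt ℝ (fun x : ℝ × ℝ => imaginaryAction m g l x.1 x.2) 0 := by
  have h : AnalyticAt ℝ (fun x : ℝ × ℝ => (ellipticIntegral x.1 x.2).re)
      (kappa m g l * (0 : ℝ × ℝ).1 / frequency g l, kappa m g l * (0 : ℝ × ℝ).2) := by
    simpa [← Prod.zero_eq_mk] using analyticAt_ellipticIntegral
  have h2 : AnalyticAt ℝ (fun x : ℝ × ℝ => (kappa m g l * x.1 / frequency g l,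
      kappa m g l * x.2)) 0 :=
    AnalyticAt.prod (by simp only [div_eq_mul_inv]; fun_prop) (by fun_prop)
  have h3 := AnalyticAt.fun_comp (f := fun x : ℝ × ℝ => (kappa m g l * x.1 / frequency g l,
      kappa m g l * x.2)) h h2
  simp only [imaginaryAction, div_eq_mul_inv _ (kappa m g l)]
  exact h3.mul analyticAt_const

theorem imaginaryAction_zero (m g l : ℝ) : imaginaryAction m g l 0 0 = 0 := by
  simp [imaginaryAction, ellipticIntegral_zero_re]

/-- A normal form up to order `N` inverts the imaginary action up to order `N`. -/
theorem imaginaryAction_of_isNormalFormUpTo {m g l : ℝ} (hm : 0 < m) (hg : 0 < g) (hl : 0 < l)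
    {B : ℝ × ℝ → ℝ} (hB : AnalyticAt ℝ B 0) {N : ℕ} (hBN : IsNormalFormUpTo m g l N B) :
    (fun x : ℝ × ℝ => imaginaryAction m g l (B x) x.2 - x.1) =O[𝓝 0] fun x => ‖x‖ ^ (N + 1) := by
  have hB0 := map_zero_of_isNormalFormUpTo hm hl hBN
  have hF : AnalyticAt ℝ (fun x : ℝ × ℝ => imaginaryAction m g l (B x) x.2 - x.1) 0 := by
    refine AnalyticAt.fun_sub ?_ (by fun_prop)
    refine AnalyticAt.fun_comp (g := fun x : ℝ × ℝ => imaginaryAction m g l x.1 x.2)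
      (f := fun x : ℝ × ℝ => (B x, x.2)) ?_ (hB.prod (by fun_prop))
    rw [hB0]
    exact analyticAt_imaginaryAction m g l
  rcases Nat.eq_zero_or_pos N with rfl | hN
  · simpa using isBigO_of_analyticAt hF (by simp [hB0, imaginaryAction_zero])
  -- On a line `(t α, t β)` the energy is a function `t b(t)` of one variable, which is the
  -- situation of the test surface.
  refine isBigO_of_lines hF fun x => ?_
  obtain ⟨α, β⟩ := x
  have hline : AnalyticAt ℝ (fun t : ℝ => (t * α, t * β)) 0 :=
    AnalyticAt.prod (by fun_prop) (by fun_prop)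
  have hBl : AnalyticAt ℝ (fun t : ℝ => B (t * α, t * β)) 0 :=
    AnalyticAt.fun_comp (f := fun t : ℝ => (t * α, t * β)) (by simpa [← Prod.zero_eq_mk] using hB)
      hline
  obtain ⟨K, hK, -, hKB⟩ := hadamard hBl
  have hb : AnalyticAt ℝ (fun t => K t 1) 0 := analyticAt_clm_apply hK analyticAt_const
  have hbB : ∀ᶠ t in 𝓝 (0 : ℝ), B (t * α, t * β) = t * K t 1 := by
    filter_upwards [hKB] with t ht
    rw [ht]
    have h1 : K t t = t * K t 1 := by
      rw [← smul_eq_mul (a := t), ← map_smul, smul_eq_mul, mul_one]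
    simp [h1, ← Prod.zero_eq_mk, hB0]
  set κ := kappa m g l with hκ
  set ν := frequency g l with hν
  have hκ0 : 0 < κ := kappa_pos hm hg hl
  have hE : AnalyticAt ℝ (fun t : ℝ => (ellipticIntegral (t * (κ / ν * K t 1)) (κ * β * t)).re) 0 :=
    AnalyticAt.fun_comp (g := fun x : ℝ × ℝ => (ellipticIntegral x.1 x.2).re)
      (f := fun t : ℝ => (t * (κ / ν * K t 1), κ * β * t))
      (by simpa [← Prod.zero_eq_mk] using analyticAt_ellipticIntegral)
      (AnalyticAt.prod (by fun_prop) (by fun_prop))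
  have hR : AnalyticAt ℝ (fun t : ℝ => κ * α * t) 0 := by fun_prop
  have hcomp : ∀ {f : ℝ → ℝ}, AnalyticAt ℝ f 0 →
      AnalyticAt ℝ (fun x : ℝ × ℝ => f (x.1 ^ 2 * x.2)) 0 := fun {f} hf =>
    AnalyticAt.fun_comp (f := fun x : ℝ × ℝ => x.1 ^ 2 * x.2) (by simpa using hf) (by fun_prop)
  -- The coefficients of degree `0, ..., N` agree, hence the order `N + 1`.
  have h1 := isBigO_of_jet_eq_zero (hE.fun_sub hR) (N := N + 1) (fun n hn => by
    have h2 := jet_sub (hcomp hE) (hcomp hR) (2 * n) n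
    have h3 := jet_normalForm hm hg hl hB hN hBN hb hbB n (by omega)
    rw [← hκ, ← hν] at h3
    rw [h3, sub_self] at h2
    exact h2)
  refine (h1.const_mul_left κ⁻¹).congr' ?_ EventuallyEq.rfl
  filter_upwards [hbB] with t ht
  have h4 : (t • (α, β) : ℝ × ℝ) = (t * α, t * β) := by simp
  rw [h4, ht, imaginaryAction, ← hκ, ← hν]
  simp only
  rw [show κ * (t * K t 1) / ν = t * (κ / ν * K t 1) by ring,
    show κ * (t * β) = κ * β * t by ring]
  field_simp

/-! ### Symplectic maps commuting with rotations. -/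

/-- The rotation invariants `|q|²`, `|p|²`, `(q, p)` on `T*ℝ²`. -/
def invariants (z : Phase 2) : Fin 3 → ℝ :=
  ![z.1 0 ^ 2 + z.1 1 ^ 2, z.2 0 ^ 2 + z.2 1 ^ 2, z.1 0 * z.2 0 + z.1 1 * z.2 1]

/-- The coefficients `α = f_C`, `β = 2 f_B`, `γ = -2 f_A` of the Hamiltonian vector field of
`f(|q|², |p|², (q, p))`. -/
def fieldCoeff (f : (Fin 3 → ℝ) → ℝ) (x : Fin 3 → ℝ) : Fin 3 → ℝ :=
  ![fderiv ℝ f x ![0, 0, 1], 2 * fderiv ℝ f x ![0, 1, 0], -2 * fderiv ℝ f x ![1, 0, 0]]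

/-- The Hamiltonian vector field of `f(|q|², |p|², (q, p))`. -/
def hamiltonianField (f : (Fin 3 → ℝ) → ℝ) (z : Phase 2) : Phase 2 :=
  (fieldCoeff f (invariants z) 0 • z.1 + fieldCoeff f (invariants z) 1 • z.2,
    fieldCoeff f (invariants z) 2 • z.1 - fieldCoeff f (invariants z) 0 • z.2)

/-- The explicit Euler step of size `c` along the Hamiltonian vector field. -/
def eulerStep (f : (Fin 3 → ℝ) → ℝ) (c : ℝ) (z : Phase 2) : Phase 2 :=
  z + c • hamiltonianField f z

/-- The action of the Euler step on the rotation invariants. -/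
def invariantStep (f : (Fin 3 → ℝ) → ℝ) (c : ℝ) (x : Fin 3 → ℝ) : Fin 3 → ℝ :=
  ![(1 + c * fieldCoeff f x 0) ^ 2 * x 0
      + 2 * (1 + c * fieldCoeff f x 0) * (c * fieldCoeff f x 1) * x 2
      + (c * fieldCoeff f x 1) ^ 2 * x 1,
    (c * fieldCoeff f x 2) ^ 2 * x 0
      + 2 * (c * fieldCoeff f x 2) * (1 - c * fieldCoeff f x 0) * x 2
      + (1 - c * fieldCoeff f x 0) ^ 2 * x 1,
    (1 + c * fieldCoeff f x 0) * (c * fieldCoeff f x 2) * x 0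
      + ((1 + c * fieldCoeff f x 0) * (1 - c * fieldCoeff f x 0)
        + c * fieldCoeff f x 1 * (c * fieldCoeff f x 2)) * x 2
      + c * fieldCoeff f x 1 * (1 - c * fieldCoeff f x 0) * x 1]

/-- The step acts on each pair `(qᵢ, pᵢ)` by the same `2 × 2` matrix, whose entries depend on the
invariants alone; so the invariants, being quadratic, transform among themselves. -/
theorem invariants_eulerStep (f : (Fin 3 → ℝ) → ℝ) (c : ℝ) (z : Phase 2) :
    invariants (eulerStep f c z) = invariantStep f c (invariants z) := by
  rw [eulerStep, hamiltonianField, invariantStep]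
  generalize hk : fieldCoeff f (invariants z) = k
  ext i
  fin_cases i <;> simp [invariants] <;> ring

/-- `J₂` is multiplied by the determinant of that matrix. As its generator is traceless, the
determinant is even in `c`, which is why forward and backward half steps scale `J₂` alike. -/
theorem quadJ₂_eulerStep (f : (Fin 3 → ℝ) → ℝ) (c : ℝ) (z : Phase 2) :
    quadJ₂ (eulerStep f c z) = (1 - c ^ 2 * (fieldCoeff f (invariants z) 0 ^ 2 +
      fieldCoeff f (invariants z) 1 * fieldCoeff f (invariants z) 2)) * quadJ₂ z := by
  rw [eulerStep, hamiltonianField]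
  simp [quadJ₂]
  ring

theorem analyticAt_invariants (z : Phase 2) : AnalyticAt ℝ invariants z :=
  analyticAt_vec3 (by fun_prop) (by fun_prop) (by fun_prop)

theorem invariants_zero : invariants 0 = 0 := by
  ext i; fin_cases i <;> simp [invariants]

theorem abs_apply_fst_le (z : Phase 2) (i : Fin 2) : |z.1 i| ≤ ‖z‖ :=
  (norm_le_pi_norm z.1 i).trans (norm_fst_le z)

theorem abs_apply_snd_le (z : Phase 2) (i : Fin 2) : |z.2 i| ≤ ‖z‖ :=
  (norm_le_pi_norm z.2 i).trans (norm_snd_le z)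

theorem norm_invariants_le (z : Phase 2) : ‖invariants z‖ ≤ 2 * ‖z‖ ^ 2 := by
  have a := abs_apply_fst_le z 0
  have b := abs_apply_fst_le z 1
  have c := abs_apply_snd_le z 0
  have d := abs_apply_snd_le z 1
  have hz := norm_nonneg z
  refine (pi_norm_le_iff_of_nonneg (by positivity)).mpr fun i => ?_
  have hmul : ∀ {u v : ℝ}, |u| ≤ ‖z‖ → |v| ≤ ‖z‖ → |u * v| ≤ ‖z‖ ^ 2 := fun hu hv => by
    rw [abs_mul, pow_two]
    exact mul_le_mul hu hv (abs_nonneg _) hz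
  have key : ∀ {u v u' v' : ℝ}, |u| ≤ ‖z‖ → |v| ≤ ‖z‖ → |u'| ≤ ‖z‖ → |v'| ≤ ‖z‖ →
      ‖u * v + u' * v'‖ ≤ 2 * ‖z‖ ^ 2 := fun hu hv hu' hv' => by
    refine (norm_add_le _ _).trans ?_
    have := hmul hu hv
    have := hmul hu' hv'
    rw [Real.norm_eq_abs, Real.norm_eq_abs]
    linarith
  fin_cases i
  · simpa [invariants, pow_two] using key a a b b
  · simpa [invariants, pow_two] using key c c d d
  · simpa [invariants] using key a c b d

theorem isBigO_invariants : invariants =O[𝓝 0] fun z => ‖z‖ ^ 2 :=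
  IsBigO.of_bound 2 (Eventually.of_forall fun z => by simpa using norm_invariants_le z)

theorem fderiv_invariants (z v : Phase 2) : fderiv ℝ invariants z v =
    ![2 * (z.1 0 * v.1 0 + z.1 1 * v.1 1), 2 * (z.2 0 * v.2 0 + z.2 1 * v.2 1),
      v.1 0 * z.2 0 + z.1 0 * v.2 0 + (v.1 1 * z.2 1 + z.1 1 * v.2 1)] := by
  have hd := (analyticAt_invariants z).differentiableAt.hasFDerivAt
  have h1 : ∀ i, HasFDerivAt (fun z : Phase 2 => z.1 i)
      ((ContinuousLinearMap.proj i).comp (ContinuousLinearMap.fst ℝ (Fin 2 → ℝ) (Fin 2 → ℝ))) z :=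
    fun i => ((ContinuousLinearMap.proj (R := ℝ) (φ := fun _ : Fin 2 => ℝ) i).comp
      (ContinuousLinearMap.fst ℝ (Fin 2 → ℝ) (Fin 2 → ℝ))).hasFDerivAt
  have h2 : ∀ i, HasFDerivAt (fun z : Phase 2 => z.2 i)
      ((ContinuousLinearMap.proj i).comp (ContinuousLinearMap.snd ℝ (Fin 2 → ℝ) (Fin 2 → ℝ))) z :=
    fun i => ((ContinuousLinearMap.proj (R := ℝ) (φ := fun _ : Fin 2 => ℝ) i).comp
      (ContinuousLinearMap.snd ℝ (Fin 2 → ℝ) (Fin 2 → ℝ))).hasFDerivAt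
  ext i
  have e : fderiv ℝ invariants z v i = fderiv ℝ (fun y => invariants y i) z v := by
    rw [(hasFDerivAt_pi'.mp hd i).fderiv]; rfl
  rw [e]
  fin_cases i
  · change fderiv ℝ (fun z : Phase 2 => z.1 0 ^ 2 + z.1 1 ^ 2) z v = _
    rw [(((h1 0).pow 2).fun_add ((h1 1).pow 2)).fderiv]
    simp; ring
  · change fderiv ℝ (fun z : Phase 2 => z.2 0 ^ 2 + z.2 1 ^ 2) z v = _
    rw [(((h2 0).pow 2).fun_add ((h2 1).pow 2)).fderiv]
    simp; ring
  · change fderiv ℝ (fun z : Phase 2 => z.1 0 * z.2 0 + z.1 1 * z.2 1) z v = _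
    rw [(((h1 0).fun_mul (h2 0)).fun_add ((h1 1).fun_mul (h2 1))).fderiv]
    simp; ring

theorem clm_vec3 (A : (Fin 3 → ℝ) →L[ℝ] ℝ) (a b c : ℝ) :
    A ![a, b, c] = a * A ![1, 0, 0] + b * A ![0, 1, 0] + c * A ![0, 0, 1] := by
  have : (![a, b, c] : Fin 3 → ℝ) = a • ![1, 0, 0] + b • ![0, 1, 0] + c • ![0, 0, 1] := by
    ext i; fin_cases i <;> simp
  rw [this]
  simp only [map_add, map_smul, smul_eq_mul]

theorem canonicalForm_hamiltonianField {f : (Fin 3 → ℝ) → ℝ} {z : Phase 2}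
    (hf : DifferentiableAt ℝ f (invariants z)) (v : Phase 2) :
    canonicalForm (hamiltonianField f z) v = fderiv ℝ (fun y => f (invariants y)) z v := by
  have h := fderiv_comp z hf (analyticAt_invariants z).differentiableAt
  have h' : fderiv ℝ (fun y => f (invariants y)) z v =
      fderiv ℝ f (invariants z) (fderiv ℝ invariants z v) := DFunLike.congr_fun h v
  rw [h', fderiv_invariants, clm_vec3]
  simp [canonicalForm, hamiltonianField, fieldCoeff, dotProduct, Fin.sum_univ_two]
  ring

theorem analyticAt_fieldCoeff {f : (Fin 3 → ℝ) → ℝ} (hf : AnalyticAt ℝ f 0) (i : Fin 3) :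
    AnalyticAt ℝ (fun x => fieldCoeff f x i) 0 := by
  have h : ∀ e, AnalyticAt ℝ (fun x => fderiv ℝ f x e) 0 := fun e =>
    analyticAt_clm_apply hf.fderiv analyticAt_const
  fin_cases i
  · exact h _
  · exact analyticAt_const.fun_mul (h _)
  · exact analyticAt_const.fun_mul (h _)

theorem analyticAt_hamiltonianField {f : (Fin 3 → ℝ) → ℝ} (hf : AnalyticAt ℝ f 0) :
    AnalyticAt ℝ (hamiltonianField f) 0 := by
  have h : ∀ i, AnalyticAt ℝ (fun z => fieldCoeff f (invariants z) i) 0 := fun i =>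
    AnalyticAt.fun_comp (g := fun x => fieldCoeff f x i) (f := invariants)
      (by rw [invariants_zero]; exact analyticAt_fieldCoeff hf i) (analyticAt_invariants 0)
  have h0 := h 0
  have h1 := h 1
  have h2 := h 2
  exact AnalyticAt.prod (by fun_prop) (by fun_prop)

theorem canonicalForm_add_left {n : ℕ} (u v w : Phase n) :
    canonicalForm (u + v) w = canonicalForm u w + canonicalForm v w := by
  simp [canonicalForm]; ring

theorem canonicalForm_smul_left {n : ℕ} (c : ℝ) (u v : Phase n) :
    canonicalForm (c • u) v = c * canonicalForm u v := by
  simp [canonicalForm]; ring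

theorem canonicalForm_swap {n : ℕ} (u v : Phase n) : canonicalForm u v = -canonicalForm v u := by
  simp [canonicalForm]

/-- The form `u ↦ ω(u, v)` as a continuous linear map. -/
def canonicalFormCLM (v : Phase 2) : Phase 2 →L[ℝ] ℝ :=
  LinearMap.toContinuousLinearMap
    { toFun := fun u => canonicalForm u v
      map_add' := fun u w => canonicalForm_add_left u w v
      map_smul' := fun c u => canonicalForm_smul_left c u v }

theorem canonicalFormCLM_apply (u v : Phase 2) : canonicalFormCLM v u = canonicalForm u v := rfl

/-- The derivative of a Hamiltonian vector field is infinitesimally symplectic. -/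
theorem fderiv_hamiltonianField_skew {f : (Fin 3 → ℝ) → ℝ} (hf : AnalyticAt ℝ f 0) :
    ∀ᶠ z in 𝓝 (0 : Phase 2), ∀ u v, canonicalForm (fderiv ℝ (hamiltonianField f) z u) v +
      canonicalForm u (fderiv ℝ (hamiltonianField f) z v) = 0 := by
  have ht : Tendsto invariants (𝓝 0) (𝓝 0) := by
    simpa [ContinuousAt, invariants_zero] using (analyticAt_invariants 0).continuousAt
  have hF : AnalyticAt ℝ (fun y => f (invariants y)) 0 :=
    AnalyticAt.fun_comp (by rwa [invariants_zero]) (analyticAt_invariants 0)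
  filter_upwards [(ht.eventually hf.eventually_analyticAt).eventually_nhds,
    hF.eventually_analyticAt, (analyticAt_hamiltonianField hf).eventually_analyticAt] with z h1 h2 h3
  have key : ∀ u v, canonicalForm (fderiv ℝ (hamiltonianField f) z u) v =
      fderiv ℝ (fderiv ℝ (fun y => f (invariants y))) z u v := fun u v => by
    have e : (fun y => canonicalFormCLM v (hamiltonianField f y)) =ᶠ[𝓝 z]
        fun y => fderiv ℝ (fun y => f (invariants y)) y v := by
      filter_upwards [h1] with y hy
      rw [canonicalFormCLM_apply, canonicalForm_hamiltonianField hy.differentiableAt]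
    have e2 := congrArg (fun A => A u) (e.fderiv_eq (𝕜 := ℝ))
    have e3 : fderiv ℝ (fun y => canonicalFormCLM v (hamiltonianField f y)) z u =
        canonicalFormCLM v (fderiv ℝ (hamiltonianField f) z u) :=
      DFunLike.congr_fun ((canonicalFormCLM v).hasFDerivAt.comp z
        h3.differentiableAt.hasFDerivAt).fderiv u
    have hd : DifferentiableAt ℝ (fderiv ℝ (fun y => f (invariants y))) z :=
      h2.fderiv.differentiableAt
    have e4 : fderiv ℝ (fun y => fderiv ℝ (fun y => f (invariants y)) y v) z u =
        fderiv ℝ (fderiv ℝ (fun y => f (invariants y))) z u v := by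
      rw [fderiv_clm_apply hd (by fun_prop)]
      simp
    exact (e3.symm.trans e2).trans e4
  intro u v
  have hs : IsSymmSndFDerivAt ℝ (fun y => f (invariants y)) z := by
    apply ContDiffAt.isSymmSndFDerivAt (n := 2) h2.contDiffAt
    simp
  rw [key, canonicalForm_swap u, key, hs.eq u v]
  ring

theorem analyticAt_eulerStep {f : (Fin 3 → ℝ) → ℝ} (hf : AnalyticAt ℝ f 0) (c : ℝ) :
    AnalyticAt ℝ (eulerStep f c) 0 :=
  analyticAt_id.fun_add (analyticAt_const.fun_smul (analyticAt_hamiltonianField hf))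

theorem eulerStep_zero (f : (Fin 3 → ℝ) → ℝ) (c : ℝ) : eulerStep f c 0 = 0 := by
  simp [eulerStep, hamiltonianField]

/-- The terms linear in `c` cancel because the derivative of a Hamiltonian field is skew for the
symplectic form. The remaining defect is even in `c`. -/
theorem canonicalForm_fderiv_eulerStep {f : (Fin 3 → ℝ) → ℝ} (hf : AnalyticAt ℝ f 0) (c : ℝ) :
    ∀ᶠ z in 𝓝 (0 : Phase 2), ∀ u v,
      canonicalForm (fderiv ℝ (eulerStep f c) z u) (fderiv ℝ (eulerStep f c) z v) =
        canonicalForm u v + c ^ 2 * canonicalForm (fderiv ℝ (hamiltonianField f) z u)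
          (fderiv ℝ (hamiltonianField f) z v) := by
  filter_upwards [fderiv_hamiltonianField_skew hf,
    (analyticAt_hamiltonianField hf).eventually_analyticAt] with z h1 h2 u v
  have h3 : fderiv ℝ (eulerStep f c) z =
      ContinuousLinearMap.id ℝ _ + c • fderiv ℝ (hamiltonianField f) z :=
    ((hasFDerivAt_id z).add (h2.differentiableAt.hasFDerivAt.const_smul c)).fderiv
  rw [h3]
  have h4 := h1 u v
  generalize fderiv ℝ (hamiltonianField f) z = D at *
  simp [canonicalForm, dotProduct, Fin.sum_univ_two] at h4 ⊢
  linear_combination c * h4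

theorem tendsto_of_isBigO_norm {E F : Type*} [NormedAddCommGroup E] [NormedAddCommGroup F]
    {y : E → F} (h : y =O[𝓝 0] fun x => ‖x‖) : Tendsto y (𝓝 0) (𝓝 0) := by
  refine h.trans_tendsto ?_
  have : ContinuousAt (fun x : E => ‖x‖) 0 := by fun_prop
  simpa [ContinuousAt] using this

/-- Mean value inequality on a ball of radius proportional to `‖x‖`, where the derivative of `k` is
`O(‖x‖ ^ n)`. -/
theorem isBigO_comp_sub {E F G : Type*} [NormedAddCommGroup E] [NormedSpace ℝ E]
    [NormedAddCommGroup F] [NormedSpace ℝ F] [CompleteSpace F] [NormedAddCommGroup G]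
    {k : E → F} (hk : AnalyticAt ℝ k 0) {n j : ℕ}
    (hkn : k =O[𝓝 0] fun x => ‖x‖ ^ (n + 1)) {y₁ y₂ : G → E} (h₁ : y₁ =O[𝓝 0] fun x => ‖x‖)
    (h₂ : y₂ =O[𝓝 0] fun x => ‖x‖) (h : (fun x => y₁ x - y₂ x) =O[𝓝 0] fun x => ‖x‖ ^ j) :
    (fun x => k (y₁ x) - k (y₂ x)) =O[𝓝 0] fun x => ‖x‖ ^ (n + j) := by
  obtain ⟨C, hC⟩ := (isBigO_fderiv hk hkn).bound
  obtain ⟨δ, hδ, hball⟩ := Metric.eventually_nhds_iff_ball.mp (hC.and hk.eventually_analyticAt)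
  have t₁ := (tendsto_of_isBigO_norm h₁).eventually (Metric.ball_mem_nhds 0 hδ)
  have t₂ := (tendsto_of_isBigO_norm h₂).eventually (Metric.ball_mem_nhds 0 hδ)
  obtain ⟨M₁, hM₁, b₁⟩ := h₁.exists_pos
  obtain ⟨M₂, hM₂, b₂⟩ := h₂.exists_pos
  obtain ⟨M, hM, b⟩ := h.exists_pos
  refine IsBigO.of_bound (|C| * (max M₁ M₂) ^ n * M) ?_
  filter_upwards [t₁, t₂, b₁.bound, b₂.bound, b.bound] with x u₁ u₂ v₁ v₂ v
  rw [norm_norm] at v₁ v₂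
  rw [norm_pow, norm_norm] at v ⊢
  have e₁ : ‖y₁ x‖ ≤ max M₁ M₂ * ‖x‖ := v₁.trans (by gcongr; exact le_max_left _ _)
  have e₂ : ‖y₂ x‖ ≤ max M₁ M₂ * ‖x‖ := v₂.trans (by gcongr; exact le_max_right _ _)
  have hmvt := Convex.norm_image_sub_le_of_norm_fderiv_le (𝕜 := ℝ) (f := k)
    (s := Metric.ball 0 δ ∩ Metric.closedBall 0 (max M₁ M₂ * ‖x‖))
    (C := |C| * (max M₁ M₂ * ‖x‖) ^ n) (x := y₂ x) (y := y₁ x)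
    (fun y hy => (hball y hy.1).2.differentiableAt)
    (fun y hy => by
      refine (hball y hy.1).1.trans ?_
      have hy2 : ‖y‖ ≤ max M₁ M₂ * ‖x‖ := by simpa using hy.2
      rw [norm_pow, norm_norm]
      gcongr
      exact le_abs_self C)
    ((convex_ball _ _).inter (convex_closedBall _ _)) ⟨u₂, by simpa using e₂⟩
    ⟨u₁, by simpa using e₁⟩
  refine hmvt.trans ?_
  calc _ ≤ |C| * (max M₁ M₂ * ‖x‖) ^ n * (M * ‖x‖ ^ j) := by gcongr
    _ = _ := by rw [mul_pow, pow_add]; ring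

theorem fderiv_eq_of_isBigO_sub {E F : Type*} [NormedAddCommGroup E] [NormedSpace ℝ E]
    [NormedAddCommGroup F] [NormedSpace ℝ F] [CompleteSpace F] {f : E → F}
    (hf : AnalyticAt ℝ f 0) (A : E →L[ℝ] F)
    (h : (fun x => f x - A x) =O[𝓝 0] fun x => ‖x‖ ^ 2) : fderiv ℝ f 0 = A := by
  have hA : AnalyticAt ℝ A 0 := A.analyticAt 0
  have h1 := eq_zero_of_isBigO_norm_pow (isBigO_fderiv (k := 1) (hf.fun_sub hA) h) one_ne_zero
  rw [fderiv_fun_sub hf.differentiableAt hA.differentiableAt, A.fderiv] at h1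
  exact sub_eq_zero.mp h1

theorem isBigO_fieldCoeff {f : (Fin 3 → ℝ) → ℝ} (hf : AnalyticAt ℝ f 0) {n : ℕ}
    (hfn : f =O[𝓝 0] fun x => ‖x‖ ^ (n + 1)) (i : Fin 3) :
    (fun x => fieldCoeff f x i) =O[𝓝 0] fun x => ‖x‖ ^ n := by
  have h : ∀ e, (fun x => fderiv ℝ f x e) =O[𝓝 0] fun x => ‖x‖ ^ n := fun e =>
    isBigO_clm_apply (isBigO_fderiv hf hfn) e
  fin_cases i
  · exact h _
  · exact (h _).const_mul_left 2
  · exact (h _).const_mul_left (-2)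

theorem analyticAt_invariantStep {f : (Fin 3 → ℝ) → ℝ} (hf : AnalyticAt ℝ f 0) (c : ℝ) :
    AnalyticAt ℝ (invariantStep f c) 0 := by
  have h0 := analyticAt_fieldCoeff hf 0
  have h1 := analyticAt_fieldCoeff hf 1
  have h2 := analyticAt_fieldCoeff hf 2
  exact analyticAt_vec3 (by fun_prop) (by fun_prop) (by fun_prop)

theorem invariantStep_zero (f : (Fin 3 → ℝ) → ℝ) (c : ℝ) : invariantStep f c 0 = 0 := by
  ext i; fin_cases i <;> simp [invariantStep]

theorem isBigO_invariantStep_sub {f : (Fin 3 → ℝ) → ℝ} (hf : AnalyticAt ℝ f 0) {n : ℕ}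
    (hfn : f =O[𝓝 0] fun x => ‖x‖ ^ (n + 1)) (c : ℝ) :
    (fun x => invariantStep f c x - x) =O[𝓝 0] fun x => ‖x‖ ^ (n + 1) := by
  have a0 := analyticAt_fieldCoeff hf 0
  have a1 := analyticAt_fieldCoeff hf 1
  have a2 := analyticAt_fieldCoeff hf 2
  have mul : ∀ i {u : (Fin 3 → ℝ) → ℝ}, AnalyticAt ℝ u 0 → u 0 = 0 →
      (fun x => fieldCoeff f x i * u x) =O[𝓝 0] fun x => ‖x‖ ^ (n + 1) := fun i u hu hu0 => by
    simpa only [pow_succ] using (isBigO_fieldCoeff hf hfn i).mul (isBigO_of_analyticAt hu hu0)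
  rw [isBigO_pi]
  intro i
  fin_cases i
  · refine ((mul 0 (u := fun x => c * (2 + c * fieldCoeff f x 0) * x 0) (by fun_prop)
      (by simp)).add (mul 1 (u := fun x => c * (2 * (1 + c * fieldCoeff f x 0) * x 2 +
        c * fieldCoeff f x 1 * x 1)) (by fun_prop) (by simp))).congr_left fun x => ?_
    simp [invariantStep]
    ring
  · refine ((mul 2 (u := fun x => c * (c * fieldCoeff f x 2 * x 0 + 2 * (1 - c * fieldCoeff f x 0) *
      x 2)) (by fun_prop) (by simp)).add (mul 0 (u := fun x => c * (c * fieldCoeff f x 0 - 2) * x 1)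
        (by fun_prop) (by simp))).congr_left fun x => ?_
    simp [invariantStep]
    ring
  · refine (((mul 2 (u := fun x => c * ((1 + c * fieldCoeff f x 0) * x 0 + c * fieldCoeff f x 1 *
      x 2)) (by fun_prop) (by simp)).add (mul 0 (u := fun x => -c ^ 2 * fieldCoeff f x 0 * x 2)
        (by fun_prop) (by simp))).add (mul 1 (u := fun x => c * (1 - c * fieldCoeff f x 0) * x 1)
        (by fun_prop) (by simp))).congr_left fun x => ?_
    simp [invariantStep]
    ring

theorem isBigO_hamiltonianField {f : (Fin 3 → ℝ) → ℝ} (hf : AnalyticAt ℝ f 0)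
    (hf2 : f =O[𝓝 0] fun x => ‖x‖ ^ 2) :
    hamiltonianField f =O[𝓝 0] fun z => ‖z‖ ^ 2 := by
  have h : ∀ i, (fun z => fieldCoeff f (invariants z) i) =O[𝓝 0] fun z : Phase 2 => ‖z‖ := fun i => by
    refine isBigO_of_analyticAt ?_ ?_
    · exact AnalyticAt.fun_comp (g := fun x => fieldCoeff f x i) (f := invariants)
        (by rw [invariants_zero]; exact analyticAt_fieldCoeff hf i) (analyticAt_invariants 0)
    · have := eq_zero_of_isBigO_norm_pow (isBigO_fieldCoeff (n := 1) hf hf2 i) one_ne_zero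
      simpa [invariants_zero] using this
  have h1 : (fun z : Phase 2 => z.1) =O[𝓝 0] fun z => ‖z‖ := isBigO_of_analyticAt (by fun_prop) rfl
  have h2 : (fun z : Phase 2 => z.2) =O[𝓝 0] fun z => ‖z‖ := isBigO_of_analyticAt (by fun_prop) rfl
  simp only [pow_two]
  exact IsBigO.prod_left (((h 0).smul h1).add ((h 1).smul h2)) (((h 2).smul h1).sub ((h 0).smul h2))

/-- The midpoint rule turns the Hamiltonian flow of `f(|q|², |p|², (q, p))` into an exactly
symplectic map, which preserves `J₂` and acts on the rotation invariants. -/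
theorem exists_midpoint_map {f : (Fin 3 → ℝ) → ℝ} (hf : AnalyticAt ℝ f 0) {n : ℕ} (hn : 1 ≤ n)
    (hfn : f =O[𝓝 0] fun x => ‖x‖ ^ (n + 1)) :
    ∃ (ψ : Phase 2 → Phase 2) (σ : (Fin 3 → ℝ) → Fin 3 → ℝ), AnalyticAt ℝ ψ 0 ∧ ψ 0 = 0 ∧
      (∀ᶠ z in 𝓝 (0 : Phase 2), ∀ u v : Phase 2,
        canonicalForm (fderiv ℝ ψ z u) (fderiv ℝ ψ z v) = canonicalForm u v) ∧
      (∀ᶠ z in 𝓝 (0 : Phase 2), quadJ₂ (ψ z) = quadJ₂ z) ∧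
      AnalyticAt ℝ σ 0 ∧ σ 0 = 0 ∧
      (∀ᶠ z in 𝓝 (0 : Phase 2), invariants (ψ z) = σ (invariants z)) ∧
      (fun x => σ x - x) =O[𝓝 0] (fun x => ‖x‖ ^ (n + 1)) ∧
      (fun x => σ x 2 - x 2 + 2 * (x 0 * fderiv ℝ f x ![1, 0, 0] - x 1 * fderiv ℝ f x ![0, 1, 0]))
        =O[𝓝 0] (fun x => ‖x‖ ^ (n + 2)) := by
  have hf2 : f =O[𝓝 0] fun x => ‖x‖ ^ 2 := hfn.trans (isBigO_norm_pow_le (by omega))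
  have hpa : AnalyticAt ℝ (eulerStep f (1 / 2)) 0 := analyticAt_eulerStep hf _
  have hma : AnalyticAt ℝ (eulerStep f (-(1 / 2))) 0 := analyticAt_eulerStep hf _
  -- `ξ z` is the midpoint: a backward half step from it gives `z` and a forward half step gives `ψ
  -- z`. Every defect of a half step that is even in its size cancels between the two.
  obtain ⟨ξ, hξa, hξ0, -, hξ⟩ := exists_analytic_inverse hma (eulerStep_zero f _)
    (ContinuousLinearEquiv.refl ℝ (Phase 2)) (by
      refine fderiv_eq_of_isBigO_sub hma _ ?_
      refine ((isBigO_hamiltonianField hf hf2).const_smul_left (-(1 / 2) : ℝ)).congr_left fun z => ?_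
      simp [eulerStep])
  have hPa : AnalyticAt ℝ (invariantStep f (1 / 2)) 0 := analyticAt_invariantStep hf _
  have hMa : AnalyticAt ℝ (invariantStep f (-(1 / 2))) 0 := analyticAt_invariantStep hf _
  have hPs := isBigO_invariantStep_sub hf hfn (1 / 2)
  have hMs := isBigO_invariantStep_sub hf hfn (-(1 / 2))
  obtain ⟨ζ, hζa, hζ0, hζl, hζr⟩ := exists_analytic_inverse hMa (invariantStep_zero f _)
    (ContinuousLinearEquiv.refl ℝ (Fin 3 → ℝ)) (by
      refine fderiv_eq_of_isBigO_sub hMa _ ?_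
      exact hMs.trans (isBigO_norm_pow_le (by omega)))
  have hξt : Tendsto ξ (𝓝 0) (𝓝 0) := by simpa [ContinuousAt, hξ0] using hξa.continuousAt
  have hIt : Tendsto invariants (𝓝 0) (𝓝 0) := by
    simpa [ContinuousAt, invariants_zero] using (analyticAt_invariants 0).continuousAt
  have hζO : ζ =O[𝓝 0] fun x => ‖x‖ := isBigO_of_analyticAt hζa hζ0
  have hζt := tendsto_of_isBigO_norm hζO
  have hpow : ∀ k : ℕ, (fun x => ‖ζ x‖ ^ k) =O[𝓝 0] fun x => ‖x‖ ^ k := fun k => hζO.norm_left.pow k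
  have hσ : (fun x => invariantStep f (1 / 2) (ζ x) - x) =O[𝓝 0] fun x => ‖x‖ ^ (n + 1) := by
    have h1 := ((hPs.sub hMs).comp_tendsto hζt).trans (hpow (n + 1))
    refine h1.congr' ?_ EventuallyEq.rfl
    filter_upwards [hζr] with x hx
    simp only [Function.comp_apply, hx]
    abel
  refine ⟨fun z => eulerStep f (1 / 2) (ξ z), fun x => invariantStep f (1 / 2) (ζ x),
    AnalyticAt.fun_comp (by rwa [hξ0]) hξa, by simp [hξ0, eulerStep_zero], ?_, ?_,
    AnalyticAt.fun_comp (by rwa [hζ0]) hζa, by simp [hζ0, invariantStep_zero], ?_, hσ, ?_⟩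
  · have e1 := canonicalForm_fderiv_eulerStep hf (1 / 2)
    have e2 := canonicalForm_fderiv_eulerStep hf (-(1 / 2))
    filter_upwards [hξt.eventually e1, hξt.eventually e2, hξt.eventually hpa.eventually_analyticAt,
      hξt.eventually hma.eventually_analyticAt, hξa.eventually_analyticAt, hξ.eventually_nhds]
      with z h1 h2 h3 h4 h5 h6 u v
    have d1 : ∀ u, fderiv ℝ (fun z => eulerStep f (1 / 2) (ξ z)) z u =
        fderiv ℝ (eulerStep f (1 / 2)) (ξ z) (fderiv ℝ ξ z u) := fun u =>
      DFunLike.congr_fun (fderiv_comp z h3.differentiableAt h5.differentiableAt) u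
    have d2 : ∀ u, fderiv ℝ (eulerStep f (-(1 / 2))) (ξ z) (fderiv ℝ ξ z u) = u := fun u => by
      have d3 : fderiv ℝ (fun z => eulerStep f (-(1 / 2)) (ξ z)) z u = u := by
        have : (fun z => eulerStep f (-(1 / 2)) (ξ z)) =ᶠ[𝓝 z] id := h6
        rw [this.fderiv_eq (𝕜 := ℝ), fderiv_id]
        rfl
      exact (DFunLike.congr_fun (fderiv_comp z h4.differentiableAt h5.differentiableAt)
        u).symm.trans d3
    rw [d1, d1, h1]
    have h7 := h2 (fderiv ℝ ξ z u) (fderiv ℝ ξ z v)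
    rw [d2, d2] at h7
    rw [h7]
    ring
  · filter_upwards [hξ] with z hz
    rw [quadJ₂_eulerStep]
    conv_rhs => rw [← hz, quadJ₂_eulerStep]
    ring
  · filter_upwards [hξ, (hIt.comp hξt).eventually hζl] with z hz hz'
    rw [invariants_eulerStep]
    have h1 : invariants z = invariantStep f (-(1 / 2)) (invariants (ξ z)) := by
      rw [← invariants_eulerStep, hz]
    simp only [Function.comp_apply] at hz'
    rw [h1, hz']
  · have hE : AnalyticAt ℝ (fun x : Fin 3 → ℝ => x 0 * fieldCoeff f x 2 + x 1 * fieldCoeff f x 1) 0 := by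
      have h1 := analyticAt_fieldCoeff hf 1
      have h2 := analyticAt_fieldCoeff hf 2
      fun_prop
    have hEO : (fun x : Fin 3 → ℝ => x 0 * fieldCoeff f x 2 + x 1 * fieldCoeff f x 1)
        =O[𝓝 0] fun x => ‖x‖ ^ (n + 1) := by
      have mul : ∀ i j, (fun x : Fin 3 → ℝ => x i * fieldCoeff f x j) =O[𝓝 0]
          fun x => ‖x‖ ^ (n + 1) := fun i j => by
        simpa only [pow_succ'] using (isBigO_of_analyticAt (f := fun x : Fin 3 → ℝ => x i)
          (by fun_prop) rfl).mul (isBigO_fieldCoeff hf hfn j)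
      exact (mul 0 2).add (mul 1 1)
    have hζs : (fun x => ζ x - x) =O[𝓝 0] fun x => ‖x‖ ^ 2 := by
      have h1 := ((hMs.comp_tendsto hζt).trans (hpow (n + 1))).trans
        (isBigO_norm_pow_le (show 2 ≤ n + 1 by omega))
      refine h1.neg_left.congr' ?_ EventuallyEq.rfl
      filter_upwards [hζr] with x hx
      simp only [Function.comp_apply, hx]
      abel
    -- The even parts of the two half steps cancel in the third component, leaving exactly `x₀ γ +
    -- x₁ β` at `ζ x` for the field coefficients `β` and `γ`. Moving the argument from `ζ x` to `x`
    -- costs only `O(‖x‖ ^ (n + 2))`.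
    have h2 := isBigO_comp_sub hE hEO hζO (isBigO_refl _ _).norm_right hζs
    refine h2.congr' ?_ EventuallyEq.rfl
    filter_upwards [hζr] with x hx
    have h3 : x 2 = invariantStep f (-(1 / 2)) (ζ x) 2 := by rw [hx]
    rw [h3]
    simp [invariantStep, fieldCoeff]
    ring

/-! ### The homological equation and one step of normalisation. -/

theorem fderiv_monomial (a b c : ℕ) (x : Fin 3 → ℝ) :
    x 0 * fderiv ℝ (fun x : Fin 3 → ℝ => x 0 ^ a * x 1 ^ b * x 2 ^ c) x ![1, 0, 0] =
      a * (x 0 ^ a * x 1 ^ b * x 2 ^ c) ∧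
    x 1 * fderiv ℝ (fun x : Fin 3 → ℝ => x 0 ^ a * x 1 ^ b * x 2 ^ c) x ![0, 1, 0] =
      b * (x 0 ^ a * x 1 ^ b * x 2 ^ c) := by
  have h : ∀ i, HasFDerivAt (fun x : Fin 3 → ℝ => x i)
      (ContinuousLinearMap.proj (R := ℝ) (φ := fun _ : Fin 3 => ℝ) i) x := fun i =>
    (ContinuousLinearMap.proj (R := ℝ) (φ := fun _ : Fin 3 => ℝ) i).hasFDerivAt
  rw [((((h 0).pow a).fun_mul ((h 1).pow b)).fun_mul ((h 2).pow c)).fderiv]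
  constructor
  · rcases a with _ | a
    · simp
    · simp
      ring
  · rcases b with _ | b
    · simp
    · simp
      ring

theorem isBigO_monomial (a b c : ℕ) :
    (fun x : Fin 3 → ℝ => x 0 ^ a * x 1 ^ b * x 2 ^ c) =O[𝓝 0] fun x => ‖x‖ ^ (a + b + c) := by
  have h : ∀ i, (fun x : Fin 3 → ℝ => x i) =O[𝓝 0] fun x => ‖x‖ := fun i =>
    isBigO_of_analyticAt (by fun_prop) rfl
  simp only [pow_add]
  exact (((h 0).pow a).mul ((h 1).pow b)).mul ((h 2).pow c)

/-- The homological equation: a homogeneous polynomial in the rotation invariants is, up to the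
Poisson bracket of `J₁` with another one, a function of `|q|² |p|²` and `(q, p)`. -/
theorem exists_homological_solution {ν : ℝ} (hν : ν ≠ 0) {d : ℕ} {P : MvPolynomial (Fin 3) ℝ}
    (hP : P.IsHomogeneous d) :
    ∃ (f : (Fin 3 → ℝ) → ℝ) (r : ℝ × ℝ → ℝ), AnalyticAt ℝ f 0 ∧ AnalyticAt ℝ r 0 ∧
      f =O[𝓝 0] (fun x => ‖x‖ ^ d) ∧
      (fun x : Fin 3 → ℝ => r (x 0 * x 1, x 2)) =O[𝓝 0] (fun x => ‖x‖ ^ d) ∧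
      ∀ x, MvPolynomial.eval x P =
        2 * ν * (x 0 * fderiv ℝ f x ![1, 0, 0] - x 1 * fderiv ℝ f x ![0, 1, 0]) +
          r (x 0 * x 1, x 2) := by
  classical
  have hdeg : ∀ μ ∈ P.support, μ 0 + μ 1 + μ 2 = d := fun μ hμ => by
    have := hP (MvPolynomial.mem_support_iff.mp hμ)
    simpa [Finsupp.weight_apply, Finsupp.sum_fintype, Fin.sum_univ_three] using this
  let S := P.support.filter fun μ => μ 0 ≠ μ 1
  let R := P.support.filter fun μ => ¬ μ 0 ≠ μ 1
  -- Monomials in `|q|²`, `|p|²`, `(q, p)` are eigenvectors of the bracket with `J₁`, with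
  -- eigenvalue proportional to the difference of the first two exponents. One divides by it where
  -- it is nonzero; the other monomials are functions of `|q|² |p|²` and `(q, p)`.
  let k : (Fin 3 →₀ ℕ) → ℝ := fun μ => P.coeff μ / (2 * ν * ((μ 0 : ℝ) - μ 1))
  refine ⟨fun x => ∑ μ ∈ S, k μ * (x 0 ^ μ 0 * x 1 ^ μ 1 * x 2 ^ μ 2),
    fun y => ∑ μ ∈ R, P.coeff μ * (y.1 ^ μ 0 * y.2 ^ μ 2),
    Finset.analyticAt_fun_sum _ fun μ _ => by fun_prop,
    Finset.analyticAt_fun_sum _ fun μ _ => by fun_prop, ?_, ?_, fun x => ?_⟩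
  · refine IsBigO.fun_sum fun μ hμ => ?_
    rw [← hdeg μ (Finset.mem_filter.mp hμ).1]
    exact (isBigO_monomial _ _ _).const_mul_left _
  · refine IsBigO.fun_sum fun μ hμ => ?_
    obtain ⟨h1, h2⟩ := Finset.mem_filter.mp hμ
    rw [← hdeg μ h1]
    refine ((isBigO_monomial _ _ _).const_mul_left (P.coeff μ)).congr_left fun x => ?_
    rw [mul_pow, not_not.mp h2]
  · have hd : ∀ e, fderiv ℝ (fun x : Fin 3 → ℝ => ∑ μ ∈ S, k μ * (x 0 ^ μ 0 * x 1 ^ μ 1 *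
        x 2 ^ μ 2)) x e = ∑ μ ∈ S, k μ * fderiv ℝ (fun x : Fin 3 → ℝ => x 0 ^ μ 0 * x 1 ^ μ 1 *
        x 2 ^ μ 2) x e := fun e => by
      rw [fderiv_fun_sum fun μ _ => by fun_prop, sum_apply]
      refine Finset.sum_congr rfl fun μ _ => ?_
      rw [fderiv_const_mul (by fun_prop)]
      rfl
    rw [hd, hd, Finset.mul_sum, Finset.mul_sum, ← Finset.sum_sub_distrib, Finset.mul_sum,
      MvPolynomial.eval_eq', ← Finset.sum_filter_add_sum_filter_not P.support fun μ => μ 0 ≠ μ 1]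
    congr 1
    · refine Finset.sum_congr rfl fun μ hμ => ?_
      obtain ⟨h1, h2⟩ := fderiv_monomial (μ 0) (μ 1) (μ 2) x
      have h3 : (μ 0 : ℝ) - μ 1 ≠ 0 := by
        rw [sub_ne_zero]
        exact_mod_cast (Finset.mem_filter.mp hμ).2
      rw [Fin.prod_univ_three, mul_left_comm (x 0), h1, mul_left_comm (x 1), h2]
      simp only [k]
      field_simp
    · refine Finset.sum_congr rfl fun μ hμ => ?_
      have h2 := not_not.mp (Finset.mem_filter.mp hμ).2
      rw [Fin.prod_univ_three, mul_pow, h2]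

/-- Symplectic coordinates in which the pendulum is in normal form up to terms of order `d` in the
rotation invariants. -/
def IsNormalisable (m g l : ℝ) (d : ℕ) : Prop :=
  ∃ (Φ : Phase 2 → Phase 3) (h : (Fin 3 → ℝ) → ℝ) (b : ℝ × ℝ → ℝ),
    IsSymplecticCoordinates l Φ ∧ (∀ᶠ z in 𝓝 (0 : Phase 2), angularMomentumZ (Φ z) = quadJ₂ z) ∧
    AnalyticAt ℝ h 0 ∧ AnalyticAt ℝ b 0 ∧
    (∀ᶠ z in 𝓝 (0 : Phase 2), hamiltonian m g l (Φ z) = h (invariants z)) ∧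
    (fun x : Fin 3 → ℝ => b (x 0 * x 1, x 2) - frequency g l * x 2) =O[𝓝 0] (fun x => ‖x‖ ^ 2) ∧
    (fun x : Fin 3 → ℝ => h x - b (x 0 * x 1, x 2)) =O[𝓝 0] (fun x => ‖x‖ ^ d)

/-- Since `h = ν x₂ + O(‖x‖²)` and `σ - id = O(‖x‖ ^ (n + 1))`, the change of `h` under `σ` is `ν (σ
x 2 - x 2)` up to order `n + 2`. This cancels the nonresonant part of the leading term of `h - b`,
and the resonant part is absorbed into `b`. -/
theorem IsNormalisable.succ {m g l : ℝ} (hg : 0 < g) (hl : 0 < l) {n : ℕ}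
    (hn : 1 ≤ n) (H : IsNormalisable m g l (n + 1)) : IsNormalisable m g l (n + 2) := by
  obtain ⟨Φ, h, b, hΦ, hL, hh, hb, hH, hbν, hhb⟩ := H
  have hν := frequency_pos hg hl
  set ν := frequency g l
  have hba : AnalyticAt ℝ (fun x : Fin 3 → ℝ => b (x 0 * x 1, x 2)) 0 :=
    AnalyticAt.fun_comp (f := fun x : Fin 3 → ℝ => (x 0 * x 1, x 2))
      (by simpa [← Prod.zero_eq_mk] using hb) (AnalyticAt.prod (by fun_prop) (by fun_prop))
  obtain ⟨P, hP, hPO⟩ := exists_homogeneous_part (hh.fun_sub hba) hhb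
  obtain ⟨f, r, hf, hr, hfO, hrO, hPfr⟩ := exists_homological_solution hν.ne' hP
  obtain ⟨ψ, σ, hψ, hψ0, hψs, hψJ, hσ, hσ0, hψσ, hσO, hσ2⟩ := exists_midpoint_map hf hn hfO
  have hψt : Tendsto ψ (𝓝 0) (𝓝 0) := by simpa [ContinuousAt, hψ0] using hψ.continuousAt
  refine ⟨fun z => Φ (ψ z), fun x => h (σ x), fun y => b y + r y, ⟨?_, ?_, ?_, ?_⟩, ?_, ?_,
    hb.fun_add hr, ?_, ?_, ?_⟩
  · exact AnalyticAt.fun_comp (by rw [hψ0]; exact hΦ.analytic) hψ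
  · rw [hψ0, hΦ.map_zero]
  · exact hψt.eventually hΦ.mem
  · filter_upwards [hψs, hψt.eventually hΦ.symplectic, hψ.eventually_analyticAt,
      hψt.eventually hΦ.analytic.eventually_analyticAt] with z h1 h2 h3 h4 u v
    have d1 : ∀ u, fderiv ℝ (fun z => Φ (ψ z)) z u = fderiv ℝ Φ (ψ z) (fderiv ℝ ψ z u) := fun u =>
      DFunLike.congr_fun (fderiv_comp z h4.differentiableAt h3.differentiableAt) u
    rw [d1, d1, h2, h1]
  · filter_upwards [hψt.eventually hL, hψJ] with z h1 h2
    rw [h1, h2]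
  · exact AnalyticAt.fun_comp (by rwa [hσ0]) hσ
  · filter_upwards [hψt.eventually hH, hψσ] with z h1 h2
    rw [h1, h2]
  · refine (hbν.add (hrO.trans (isBigO_norm_pow_le (show 2 ≤ n + 1 by omega)))).congr_left fun x => ?_
    ring
  · have hk : AnalyticAt ℝ (fun x : Fin 3 → ℝ => h x - ν * x 2) 0 := hh.fun_sub (by fun_prop)
    have hkO : (fun x : Fin 3 → ℝ => h x - ν * x 2) =O[𝓝 0] fun x => ‖x‖ ^ (1 + 1) := by
      refine ((hhb.trans (isBigO_norm_pow_le (show 1 + 1 ≤ n + 1 by omega))).add hbν).congr_left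
        fun x => ?_
      ring
    have h1 := isBigO_comp_sub hk hkO (isBigO_of_analyticAt hσ hσ0) (isBigO_refl _ _).norm_right hσO
    rw [show 1 + (n + 1) = n + 2 by ring] at h1
    refine ((h1.add (hσ2.const_mul_left ν)).add hPO).congr_left fun x => ?_
    rw [hPfr]
    ring

/-! ### A Darboux chart of `T*S²` at the north pole. -/

section GraphChart

variable (k l : ℝ)

/-- The height of the pendulum in the chart, as a function of the rotation invariants. -/
def chartHeight (x : Fin 3 → ℝ) : ℝ := √(l ^ 2 - (x 0 + x 1 - 2 * x 2) / k ^ 2)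

/-- The position in the chart with horizontal part `(q - p) / k`. -/
def chartPosition (z : Phase 2) : Fin 3 → ℝ :=
  ![(z.1 0 - z.2 0) / k, (z.1 1 - z.2 1) / k, chartHeight k l (invariants z)]

/-- The horizontal momentum `k (q + p) / 2` conjugate to `(q - p) / k`. -/
def chartMomentum (z : Phase 2) : Fin 3 → ℝ :=
  ![k * (z.1 0 + z.2 0) / 2, k * (z.1 1 + z.2 1) / 2, 0]

/-- The normal component of the horizontal momentum, divided by `l`. -/
def chartNormal (z : Phase 2) : ℝ :=
  (z.1 0 ^ 2 + z.1 1 ^ 2 - (z.2 0 ^ 2 + z.2 1 ^ 2)) / (2 * l ^ 2)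

/-- The cotangent lift of the graph chart of the sphere at the north pole. -/
def chart (z : Phase 2) : Phase 3 :=
  (chartPosition k l z, chartMomentum k z - chartNormal l z • chartPosition k l z)

variable {k l}

theorem analyticAt_chartHeight {x : Fin 3 → ℝ} (hx : 0 < l ^ 2 - (x 0 + x 1 - 2 * x 2) / k ^ 2) :
    AnalyticAt ℝ (chartHeight k l) x := by
  have h : AnalyticAt ℝ (fun x : Fin 3 → ℝ => l ^ 2 - (x 0 + x 1 - 2 * x 2) / k ^ 2) x := by
    simp only [div_eq_mul_inv]
    fun_prop
  exact AnalyticAt.fun_comp (g := Real.sqrt)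
    (f := fun x : Fin 3 → ℝ => l ^ 2 - (x 0 + x 1 - 2 * x 2) / k ^ 2)
    (ContDiffAt.analyticAt (Real.contDiffAt_sqrt hx.ne')) h

theorem chartHeight_sq {x : Fin 3 → ℝ} (hx : 0 < l ^ 2 - (x 0 + x 1 - 2 * x 2) / k ^ 2) :
    chartHeight k l x ^ 2 = l ^ 2 - (x 0 + x 1 - 2 * x 2) / k ^ 2 := Real.sq_sqrt hx.le

theorem chartPosition_sq (hk : 0 < k) {z : Phase 2} (hx : 0 < l ^ 2 - (invariants z 0 +
    invariants z 1 - 2 * invariants z 2) / k ^ 2) :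
    chartPosition k l z ⬝ᵥ chartPosition k l z = l ^ 2 := by
  have h := chartHeight_sq hx
  simp only [chartPosition, dotProduct, Fin.sum_univ_three, Matrix.cons_val]
  rw [← pow_two (chartHeight _ _ _), h]
  simp only [invariants, Matrix.cons_val]
  field_simp
  ring

theorem chartPosition_dot_chartMomentum (hk : 0 < k) (hl : 0 < l) (z : Phase 2) :
    chartPosition k l z ⬝ᵥ chartMomentum k z = chartNormal l z * l ^ 2 := by
  simp only [chartPosition, chartMomentum, chartNormal, dotProduct, Fin.sum_univ_three,
    Matrix.cons_val]
  field_simp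
  ring

theorem analyticAt_chartPosition {z : Phase 2} (hx : 0 < l ^ 2 - (invariants z 0 +
    invariants z 1 - 2 * invariants z 2) / k ^ 2) : AnalyticAt ℝ (chartPosition k l) z := by
  have h := AnalyticAt.fun_comp (analyticAt_chartHeight hx) (analyticAt_invariants z)
  unfold chartPosition
  simp only [div_eq_mul_inv]
  exact analyticAt_vec3 (by fun_prop) (by fun_prop) h

theorem analyticAt_chartMomentum (z : Phase 2) : AnalyticAt ℝ (chartMomentum k) z := by
  unfold chartMomentum
  simp only [div_eq_mul_inv]
  exact analyticAt_vec3 (by fun_prop) (by fun_prop) (by fun_prop)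

theorem analyticAt_chartNormal (z : Phase 2) : AnalyticAt ℝ (chartNormal l) z := by
  unfold chartNormal
  simp only [div_eq_mul_inv]
  fun_prop

theorem fderiv_apply_apply {f : Phase 2 → Fin 3 → ℝ} {z : Phase 2} (hf : DifferentiableAt ℝ f z)
    (u : Phase 2) (i : Fin 3) : fderiv ℝ f z u i = fderiv ℝ (fun y => f y i) z u := by
  rw [(hasFDerivAt_pi'.mp hf.hasFDerivAt i).fderiv]
  rfl

theorem fderiv_linear_coord (a b : ℝ) (i : Fin 2) (z u : Phase 2) :
    fderiv ℝ (fun y : Phase 2 => a * y.1 i + b * y.2 i) z u = a * u.1 i + b * u.2 i := by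
  have h := (a • (ContinuousLinearMap.proj (R := ℝ) (φ := fun _ : Fin 2 => ℝ) i).comp
    (ContinuousLinearMap.fst ℝ (Fin 2 → ℝ) (Fin 2 → ℝ)) +
    b • (ContinuousLinearMap.proj (R := ℝ) (φ := fun _ : Fin 2 => ℝ) i).comp
    (ContinuousLinearMap.snd ℝ (Fin 2 → ℝ) (Fin 2 → ℝ))).hasFDerivAt (x := z)
  exact DFunLike.congr_fun h.fderiv u

theorem fderiv_chartPosition_horizontal {z : Phase 2} (hx : 0 < l ^ 2 - (invariants z 0 +
    invariants z 1 - 2 * invariants z 2) / k ^ 2) (u : Phase 2) :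
    fderiv ℝ (chartPosition k l) z u 0 = (u.1 0 - u.2 0) / k ∧
      fderiv ℝ (chartPosition k l) z u 1 = (u.1 1 - u.2 1) / k := by
  have hd := (analyticAt_chartPosition hx).differentiableAt
  rw [fderiv_apply_apply hd, fderiv_apply_apply hd]
  have e : ∀ i, (fun y : Phase 2 => (y.1 i - y.2 i) / k) = fun y => k⁻¹ * y.1 i + -k⁻¹ * y.2 i :=
    fun i => by ext y; ring
  constructor
  · change fderiv ℝ (fun y : Phase 2 => (y.1 0 - y.2 0) / k) z u = _
    rw [e, fderiv_linear_coord]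
    ring
  · change fderiv ℝ (fun y : Phase 2 => (y.1 1 - y.2 1) / k) z u = _
    rw [e, fderiv_linear_coord]
    ring

theorem fderiv_chartMomentum (z u : Phase 2) :
    fderiv ℝ (chartMomentum k) z u = chartMomentum k u := by
  have hd := (analyticAt_chartMomentum (k := k) z).differentiableAt
  have e : ∀ i, (fun y : Phase 2 => k * (y.1 i + y.2 i) / 2) =
      fun y => k / 2 * y.1 i + k / 2 * y.2 i := fun i => by ext y; ring
  ext i
  rw [fderiv_apply_apply hd]
  fin_cases i
  · change fderiv ℝ (fun y : Phase 2 => k * (y.1 0 + y.2 0) / 2) z u = k * (u.1 0 + u.2 0) / 2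
    rw [e, fderiv_linear_coord]
    ring
  · change fderiv ℝ (fun y : Phase 2 => k * (y.1 1 + y.2 1) / 2) z u = k * (u.1 1 + u.2 1) / 2
    rw [e, fderiv_linear_coord]
    ring
  · change fderiv ℝ (fun y : Phase 2 => (0 : ℝ)) z u = 0
    simp

theorem eventually_chart_domain (hl : 0 < l) : ∀ᶠ z in 𝓝 (0 : Phase 2),
    0 < l ^ 2 - (invariants z 0 + invariants z 1 - 2 * invariants z 2) / k ^ 2 := by
  have h : ContinuousAt (fun z : Phase 2 => l ^ 2 - (invariants z 0 + invariants z 1 -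
      2 * invariants z 2) / k ^ 2) 0 := by
    have h1 : ∀ i, ContinuousAt (fun z => invariants z i) 0 := fun i =>
      (continuous_apply i).continuousAt.comp (analyticAt_invariants 0).continuousAt
    simp only [div_eq_mul_inv]
    fun_prop
  exact h.eventually_const_lt (by simp [invariants_zero]; positivity)

theorem chartPosition_dot_fderiv (hk : 0 < k) (hl : 0 < l) : ∀ᶠ z in 𝓝 (0 : Phase 2), ∀ u,
    chartPosition k l z ⬝ᵥ fderiv ℝ (chartPosition k l) z u = 0 := by
  filter_upwards [(eventually_chart_domain (k := k) hl).eventually_nhds] with z hz u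
  have hd := (analyticAt_chartPosition hz.self_of_nhds).differentiableAt
  have h : ∀ i, HasFDerivAt (fun y => chartPosition k l y i)
      ((ContinuousLinearMap.proj i).comp (fderiv ℝ (chartPosition k l) z)) z :=
    hasFDerivAt_pi'.mp hd.hasFDerivAt
  have h1 := ((((h 0).fun_mul (h 0)).fun_add ((h 1).fun_mul (h 1))).fun_add
    ((h 2).fun_mul (h 2))).fderiv
  have h2 : (fun y => chartPosition k l y 0 * chartPosition k l y 0 + chartPosition k l y 1 *
      chartPosition k l y 1 + chartPosition k l y 2 * chartPosition k l y 2) =ᶠ[𝓝 z]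
      fun _ => l ^ 2 := by
    filter_upwards [hz] with y hy
    rw [← chartPosition_sq hk hy, dotProduct, Fin.sum_univ_three]
  rw [h2.fderiv_eq (𝕜 := ℝ)] at h1
  have h3 := DFunLike.congr_fun h1 u
  simp at h3
  rw [dotProduct, Fin.sum_univ_three]
  linear_combination -h3 / 2

/-- The momentum is the tangential projection of the horizontal momentum. Its normal component is
invisible to `p dr`, because `(r, dr) = 0`, so the form is the planar one in `(q - p) / k` and `k (q
+ p) / 2`, and these are linear symplectic coordinates. -/
theorem isSymplecticCoordinates_chart (hk : 0 < k) (hl : 0 < l) :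
    IsSymplecticCoordinates l (chart k l) := by
  have hdom := eventually_chart_domain (k := k) hl
  refine ⟨?_, ?_, ?_, ?_⟩
  · have h1 := analyticAt_chartPosition hdom.self_of_nhds
    exact h1.prod ((analyticAt_chartMomentum 0).fun_sub ((analyticAt_chartNormal 0).fun_smul h1))
  · have h1 : chartNormal l 0 = 0 := by simp [chartNormal]
    have h2 : chartHeight k l 0 = l := by simp [chartHeight, Real.sqrt_sq hl.le]
    rw [chart, upperEquilibrium, h1, zero_smul, sub_zero, chartPosition, invariants_zero, h2]
    ext i <;> fin_cases i <;> simp [chartMomentum]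
  · filter_upwards [hdom] with z hz
    refine ⟨chartPosition_sq hk hz, ?_⟩
    rw [chart, dotProduct_sub, dotProduct_smul, chartPosition_sq hk hz,
      chartPosition_dot_chartMomentum hk hl, smul_eq_mul, sub_self]
  · filter_upwards [hdom, chartPosition_dot_fderiv hk hl] with z hz hdot u v
    have h1 := (analyticAt_chartPosition hz).differentiableAt.hasFDerivAt
    have h2 := (analyticAt_chartMomentum (k := k) z).differentiableAt.hasFDerivAt
    have h3 := (analyticAt_chartNormal (l := l) z).differentiableAt.hasFDerivAt
    have h4 := (h1.prodMk (h2.fun_sub (h3.fun_smul h1))).fderiv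
    have h5 : ∀ u, fderiv ℝ (chart k l) z u = (fderiv ℝ (chartPosition k l) z u,
        chartMomentum k u - (chartNormal l z • fderiv ℝ (chartPosition k l) z u +
          fderiv ℝ (chartNormal l) z u • chartPosition k l z)) := fun u => by
      rw [← fderiv_chartMomentum z u]
      exact DFunLike.congr_fun h4 u
    rw [h5, h5]
    obtain ⟨u0, u1⟩ := fderiv_chartPosition_horizontal hz u
    obtain ⟨v0, v1⟩ := fderiv_chartPosition_horizontal hz v
    have hu := hdot u
    have hv := hdot v
    have key : (fderiv ℝ (chartPosition k l) z u) ⬝ᵥ chartMomentum k v -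
        (fderiv ℝ (chartPosition k l) z v) ⬝ᵥ chartMomentum k u = canonicalForm u v := by
      simp only [dotProduct, Fin.sum_univ_three, u0, u1, v0, v1, chartMomentum, canonicalForm,
        Fin.sum_univ_two, Matrix.cons_val]
      field_simp
      ring
    rw [← key]
    simp only [canonicalForm, dotProduct_sub, dotProduct_add, dotProduct_smul, smul_eq_mul]
    rw [dotProduct_comm _ (chartPosition k l z), dotProduct_comm _ (chartPosition k l z), hu, hv,
      dotProduct_comm (fderiv ℝ (chartPosition k l) z v) (fderiv ℝ (chartPosition k l) z u)]
    ring

theorem angularMomentumZ_chart (hk : 0 < k) (z : Phase 2) :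
    angularMomentumZ (chart k l z) = quadJ₂ z := by
  rw [angularMomentumZ_eq]
  simp [chart, chartPosition, chartMomentum, quadJ₂]
  field_simp
  ring

end GraphChart

/-! ### Existence of normal forms of every finite order. -/

theorem isNormalisable_two {m g l : ℝ} (hm : 0 < m) (hg : 0 < g) (hl : 0 < l) :
    IsNormalisable m g l 2 := by
  have hν := frequency_pos hg hl
  have hν2 := frequency_sq hg hl
  -- This scaling gives the kinetic and the potential quadratic parts the coefficients `ν / 4` and
  -- `-ν / 4` on `|q + p|²` and `|q - p|²`; their sum is `ν (q, p)`.
  obtain ⟨k, hk, hk2⟩ : ∃ k : ℝ, 0 < k ∧ k ^ 2 = 2 * m * frequency g l :=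
    ⟨√(2 * m * frequency g l), by positivity, Real.sq_sqrt (by positivity)⟩
  set ν := frequency g l with hνdef
  have hdom := eventually_chart_domain (k := k) hl
  have hdom0 : 0 < l ^ 2 - ((0 : Fin 3 → ℝ) 0 + (0 : Fin 3 → ℝ) 1 - 2 * (0 : Fin 3 → ℝ) 2) / k ^ 2 := by
    simp; positivity
  have hSa := analyticAt_chartHeight hdom0
  refine ⟨chart k l, fun x => k ^ 2 / (8 * m) * (x 0 + x 1 + 2 * x 2) -
      1 / (8 * m * l ^ 2) * (x 0 - x 1) ^ 2 + m * g * (chartHeight k l x - l), fun y => ν * y.2,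
    isSymplecticCoordinates_chart hk hl, Eventually.of_forall (angularMomentumZ_chart hk),
    by fun_prop, by fun_prop, ?_,
    (isBigO_zero (E' := ℝ) _ _).congr_left fun x => (sub_self _).symm, ?_⟩
  · filter_upwards [hdom, (isSymplecticCoordinates_chart hk hl).mem] with z hz hmem
    rw [hamiltonian_eq hm hl hmem]
    have h1 : (chart k l z).2 ⬝ᵥ (chart k l z).2 =
        chartMomentum k z ⬝ᵥ chartMomentum k z - chartNormal l z ^ 2 * l ^ 2 := by
      simp only [chart, dotProduct_sub, sub_dotProduct, dotProduct_smul, smul_dotProduct, smul_eq_mul,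
        chartPosition_sq hk hz, chartPosition_dot_chartMomentum hk hl,
        dotProduct_comm (chartMomentum k z) (chartPosition k l z)]
      ring
    rw [h1]
    simp only [chart, chartPosition, chartMomentum, chartNormal, dotProduct, Fin.sum_univ_three,
      Matrix.cons_val]
    generalize chartHeight k l (invariants z) = S
    simp only [invariants, Matrix.cons_val]
    field_simp
    ring
  · have h1 : (fun x => chartHeight k l x - l) =O[𝓝 0] fun x => ‖x‖ :=
      isBigO_of_analyticAt (by fun_prop) (by simp [chartHeight, Real.sqrt_sq hl.le])
    have h2 : (fun x : Fin 3 → ℝ => x 0 - x 1) =O[𝓝 0] fun x => ‖x‖ :=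
      isBigO_of_analyticAt (by fun_prop) (by simp)
    have h3 : ContinuousAt (fun x : Fin 3 → ℝ => l ^ 2 - (x 0 + x 1 - 2 * x 2) / k ^ 2) 0 := by
      simp only [div_eq_mul_inv]
      fun_prop
    -- For the height `S` one has `S - l = (S² - l²) / (2 l) - (S - l)² / (2 l)`, and `S²` is linear
    -- in the invariants; so the error is exactly a combination of these two squares.
    refine (((h2.pow 2).const_mul_left (-(1 / (8 * m * l ^ 2)))).add
      ((h1.pow 2).const_mul_left (-(m * g / (2 * l))))).congr' ?_ EventuallyEq.rfl
    filter_upwards [h3.eventually_const_lt hdom0] with x hx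
    have h4 := chartHeight_sq hx
    rw [hk2] at h4 ⊢
    generalize chartHeight k l x = S at *
    rw [← hν2]
    field_simp at h4 ⊢
    linear_combination -4 * l ^ 2 * m * ν * h4

theorem isNormalisable {m g l : ℝ} (hm : 0 < m) (hg : 0 < g) (hl : 0 < l) (n : ℕ) :
    IsNormalisable m g l (n + 2) := by
  induction n with
  | zero => exact isNormalisable_two hm hg hl
  | succ n ih => exact ih.succ hg hl (by omega)

/-- Existence of a normal form up to every finite order. -/
theorem exists_isNormalFormUpTo {m g l : ℝ} (hm : 0 < m) (hg : 0 < g) (hl : 0 < l) (N : ℕ) :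
    ∃ B : ℝ × ℝ → ℝ, AnalyticAt ℝ B 0 ∧
      (fun x : ℝ × ℝ => B x - frequency g l * x.1) =O[𝓝 0] (fun x => ‖x‖ ^ 2) ∧
      IsNormalFormUpTo m g l N B := by
  obtain ⟨Φ, h, b, hΦ, hL, hh, hb, hH, hbν, hhb⟩ := isNormalisable hm hg hl N
  -- The identity `|q|² |p|² = J₁² + J₂²` turns a function of `|q|² |p|²` and `(q, p)` into one of
  -- `J₁` and `J₂`.
  have hB : AnalyticAt ℝ (fun x : ℝ × ℝ => b (x.1 ^ 2 + x.2 ^ 2, x.1)) 0 :=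
    AnalyticAt.fun_comp (f := fun x : ℝ × ℝ => (x.1 ^ 2 + x.2 ^ 2, x.1))
      (by simpa [← Prod.zero_eq_mk] using hb) (AnalyticAt.prod (by fun_prop) (by fun_prop))
  have hBν : (fun x : ℝ × ℝ => b (x.1 ^ 2 + x.2 ^ 2, x.1) - frequency g l * x.1)
      =O[𝓝 0] fun x => ‖x‖ ^ 2 := by
    -- A point of size `O(‖x‖)` whose first two coordinates have product `j₁² + j₂²`, at which the
    -- estimate for `b` can be read off.
    let y : ℝ × ℝ → Fin 3 → ℝ := fun x => ![√(x.1 ^ 2 + x.2 ^ 2), √(x.1 ^ 2 + x.2 ^ 2), x.1]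
    have hy : y =O[𝓝 0] fun x => ‖x‖ := by
      have hs : ∀ x : ℝ × ℝ, |√(x.1 ^ 2 + x.2 ^ 2)| ≤ 2 * ‖x‖ := fun x => by
        rw [abs_of_nonneg (Real.sqrt_nonneg _)]
        refine Real.sqrt_le_iff.mpr ⟨by positivity, ?_⟩
        have h1 := sq_le_sq' (by linarith [abs_le.mp (norm_fst_le x)]) (abs_le.mp (norm_fst_le x)).2
        have h2 := sq_le_sq' (by linarith [abs_le.mp (norm_snd_le x)]) (abs_le.mp (norm_snd_le x)).2
        nlinarith [sq_nonneg ‖x‖]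
      refine IsBigO.of_bound 2 (Eventually.of_forall fun x => ?_)
      rw [norm_norm]
      refine (pi_norm_le_iff_of_nonneg (by positivity)).mpr fun i => ?_
      fin_cases i
      · exact hs x
      · exact hs x
      · have := norm_fst_le x
        have := norm_nonneg x
        change ‖x.1‖ ≤ _
        linarith
    refine ((hbν.comp_tendsto (tendsto_of_isBigO_norm hy)).trans (hy.norm_left.pow 2)).congr_left
      fun x => ?_
    have h1 : √(x.1 ^ 2 + x.2 ^ 2) * √(x.1 ^ 2 + x.2 ^ 2) = x.1 ^ 2 + x.2 ^ 2 :=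
      Real.mul_self_sqrt (by positivity)
    simp [y, h1]
  refine ⟨_, hB, hBν, ?_, Φ, hΦ, hL, ?_⟩
  · have h1 := fderiv_eq_of_isBigO_sub hB (frequency g l • ContinuousLinearMap.fst ℝ ℝ ℝ) hBν
    rw [h1]
    simp
  · have hI := tendsto_of_isBigO_norm (isBigO_invariants.trans
      ((isBigO_norm_pow_le (show 1 ≤ 2 by norm_num)).trans (by simpa using isBigO_refl _ _)))
    have h1 := (hhb.comp_tendsto hI).trans (isBigO_invariants.norm_left.pow (N + 2))
    have h2 : (fun z : Phase 2 => (‖z‖ ^ 2) ^ (N + 2)) =O[𝓝 0] fun z => ‖z‖ ^ (2 * N + 1) := by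
      simp only [← pow_mul]
      exact isBigO_norm_pow_le (by omega)
    refine (h1.trans h2).congr' ?_ EventuallyEq.rfl
    filter_upwards [hH] with z hz
    have h3 : invariants z 0 * invariants z 1 = quadJ₁ z ^ 2 + quadJ₂ z ^ 2 := by
      simp [invariants, quadJ₁, quadJ₂]
      ring
    have h4 : invariants z 2 = quadJ₁ z := rfl
    simp only [Function.comp_apply]
    rw [hz, h3, h4]

/-! ### Inversion of the action, and uniqueness of the normal form. -/

theorem isBigO_quadJ :
    (fun z : Phase 2 => (quadJ₁ z, quadJ₂ z)) =O[𝓝 0] fun z => ‖z‖ ^ 2 := by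
  have h1 : ∀ i, (fun z : Phase 2 => z.1 i) =O[𝓝 0] fun z => ‖z‖ := fun i =>
    isBigO_of_analyticAt (by fun_prop) rfl
  have h2 : ∀ i, (fun z : Phase 2 => z.2 i) =O[𝓝 0] fun z => ‖z‖ := fun i =>
    isBigO_of_analyticAt (by fun_prop) rfl
  simp only [pow_two]
  exact IsBigO.prod_left (((h1 0).mul (h2 0)).add ((h1 1).mul (h2 1)))
    (((h1 0).mul (h2 1)).sub ((h1 1).mul (h2 0)))

/-- Instead of computing the integral, one differentiates `J₁(B(j₁, j₂), j₂) = j₁ + O(2)` for a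
normal form `B = ν j₁ + O(2)` of order `1`. -/
theorem fderiv_imaginaryAction {m g l : ℝ} (hm : 0 < m) (hg : 0 < g) (hl : 0 < l) (v : ℝ × ℝ) :
    fderiv ℝ (fun x : ℝ × ℝ => imaginaryAction m g l x.1 x.2) 0 v = v.1 / frequency g l := by
  have hν := frequency_pos hg hl
  obtain ⟨B, hB, hBν, hBN⟩ := exists_isNormalFormUpTo hm hg hl 1
  have hB0 := map_zero_of_isNormalFormUpTo hm hl hBN
  have hd := fderiv_eq_of_isBigO_sub hB (frequency g l • ContinuousLinearMap.fst ℝ ℝ ℝ) hBν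
  have hpair : AnalyticAt ℝ (fun x : ℝ × ℝ => (B x, x.2)) 0 := hB.prod (by fun_prop)
  have hpd : HasFDerivAt (fun x : ℝ × ℝ => (B x, x.2))
      ((frequency g l • ContinuousLinearMap.fst ℝ ℝ ℝ).prod (ContinuousLinearMap.snd ℝ ℝ ℝ)) 0 :=
    (hd ▸ hB.differentiableAt.hasFDerivAt).prodMk hasFDerivAt_snd
  have hF : AnalyticAt ℝ (fun x : ℝ × ℝ => imaginaryAction m g l x.1 x.2) (B 0, (0 : ℝ × ℝ).2) := by
    rw [hB0]
    exact analyticAt_imaginaryAction m g l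
  have hc := fderiv_eq_of_isBigO_sub
    (AnalyticAt.fun_comp (f := fun x : ℝ × ℝ => (B x, x.2)) hF hpair) (ContinuousLinearMap.fst ℝ ℝ ℝ)
    (imaginaryAction_of_isNormalFormUpTo hm hg hl hB hBN)
  have hc2 := (hF.differentiableAt.hasFDerivAt.comp (0 : ℝ × ℝ) hpd).fderiv
  have h1 := DFunLike.congr_fun (hc2.symm.trans hc) (v.1 / frequency g l, v.2)
  have h2 : ((B 0, (0 : ℝ × ℝ).2) : ℝ × ℝ) = 0 := by rw [hB0]; rfl
  have h3 : ((frequency g l • ContinuousLinearMap.fst ℝ ℝ ℝ).prod (ContinuousLinearMap.snd ℝ ℝ ℝ))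
      (v.1 / frequency g l, v.2) = v := by
    ext
    · exact mul_div_cancel₀ _ hν.ne'
    · rfl
  rw [h2, ContinuousLinearMap.comp_apply, h3] at h1
  exact h1

/-- The inverse function of the imaginary action with respect to the energy. -/
theorem exists_inverse_imaginaryAction {m g l : ℝ} (hm : 0 < m) (hg : 0 < g) (hl : 0 < l) :
    ∃ B : ℝ × ℝ → ℝ, AnalyticAt ℝ B 0 ∧ B 0 = 0 ∧
      (∀ᶠ x : ℝ × ℝ in 𝓝 0, B (imaginaryAction m g l x.1 x.2, x.2) = x.1) ∧
      (∀ᶠ x : ℝ × ℝ in 𝓝 0, imaginaryAction m g l (B x) x.2 = x.1) := by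
  have hν := frequency_pos hg hl
  have hF := analyticAt_imaginaryAction m g l
  -- Carrying `j₂` along makes inversion in the first argument an ordinary inverse function problem,
  -- with derivative `diag (1 / ν, 1)`.
  have hΨ : AnalyticAt ℝ (fun x : ℝ × ℝ => (imaginaryAction m g l x.1 x.2, x.2)) 0 :=
    hF.prod (by fun_prop)
  obtain ⟨G, hG, hG0, hGl, hGr⟩ := exists_analytic_inverse hΨ (by simp [imaginaryAction_zero])
    ((ContinuousLinearEquiv.smulLeft (Units.mk0 (frequency g l)⁻¹ (inv_ne_zero hν.ne'))).prodCongr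
      (ContinuousLinearEquiv.refl ℝ ℝ)) (by
        rw [(hF.differentiableAt.hasFDerivAt.prodMk hasFDerivAt_snd).fderiv]
        refine ContinuousLinearMap.ext fun v => ?_
        refine Prod.ext ?_ rfl
        refine (fderiv_imaginaryAction hm hg hl v).trans ?_
        rw [div_eq_inv_mul]
        rfl)
  refine ⟨fun x => (G x).1, by fun_prop, by simp [hG0], ?_, ?_⟩
  · filter_upwards [hGl] with x hx
    rw [hx]
  · filter_upwards [hGr] with x hx
    have h1 := congrArg Prod.fst hx
    have h2 := congrArg Prod.snd hx
    simp only at h1 h2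
    rw [← h2, h1]

/-- Every normal form up to order `N` agrees to that order with the inverse of the imaginary
action. -/
theorem isBigO_sub_of_isNormalFormUpTo {m g l : ℝ} (hm : 0 < m) (hg : 0 < g) (hl : 0 < l)
    {B : ℝ × ℝ → ℝ} (hB : AnalyticAt ℝ B 0) (hB0 : B 0 = 0)
    (hBF : ∀ᶠ x : ℝ × ℝ in 𝓝 0, B (imaginaryAction m g l x.1 x.2, x.2) = x.1) {N : ℕ}
    {B' : ℝ × ℝ → ℝ} (hB' : AnalyticAt ℝ B' 0) (hN : IsNormalFormUpTo m g l N B') :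
    (fun x : ℝ × ℝ => B' x - B x) =O[𝓝 0] fun x => ‖x‖ ^ (N + 1) := by
  have hB'0 := map_zero_of_isNormalFormUpTo hm hl hN
  have hpair : AnalyticAt ℝ (fun x : ℝ × ℝ => (B' x, x.2)) 0 := hB'.prod (by fun_prop)
  have hF : AnalyticAt ℝ (fun x : ℝ × ℝ => imaginaryAction m g l x.1 x.2)
      (B' 0, (0 : ℝ × ℝ).2) := by
    rw [hB'0]
    exact analyticAt_imaginaryAction m g l
  have hJ : AnalyticAt ℝ (fun x : ℝ × ℝ => imaginaryAction m g l (B' x) x.2) 0 :=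
    AnalyticAt.fun_comp (f := fun x : ℝ × ℝ => (B' x, x.2)) hF hpair
  have hJ2 : AnalyticAt ℝ (fun x : ℝ × ℝ => (imaginaryAction m g l (B' x) x.2, x.2)) 0 :=
    hJ.prod (by fun_prop)
  have h0 : imaginaryAction m g l (B' 0) (0 : ℝ × ℝ).2 = 0 := by
    rw [hB'0]
    exact imaginaryAction_zero m g l
  have hsub : (fun x : ℝ × ℝ => (imaginaryAction m g l (B' x) x.2, x.2) - x) =O[𝓝 0]
      fun x => ‖x‖ ^ (N + 1) :=
    (imaginaryAction_of_isNormalFormUpTo hm hg hl hB' hN).prod_left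
      ((isBigO_zero (E' := ℝ) _ _).congr_left fun x : ℝ × ℝ => (sub_self x.2).symm)
  have hBO : B =O[𝓝 0] fun x => ‖x‖ ^ (0 + 1) := by simpa using isBigO_of_analyticAt hB hB0
  -- `B` is applied to `(J₁(B' x, x₂), x₂) = x + O(‖x‖ ^ (N + 1))`; the left side gives `B' x`,
  -- since `B` inverts `J₁`.
  have h1 := isBigO_comp_sub hB hBO (isBigO_of_analyticAt hJ2 (by rw [h0]; rfl))
    (isBigO_refl _ _).norm_right hsub
  rw [zero_add] at h1
  have ht : Tendsto (fun x : ℝ × ℝ => (B' x, x.2)) (𝓝 0) (𝓝 0) := by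
    simpa [ContinuousAt, hB'0, ← Prod.zero_eq_mk] using hpair.continuousAt
  refine h1.congr' ?_ EventuallyEq.rfl
  filter_upwards [ht.eventually hBF] with x hx
  rw [hx]

/-- A function that agrees with a normal form up to order `N` is a normal form up to that order. -/
theorem IsNormalFormUpTo.congr {m g l : ℝ} {N : ℕ} {B B' : ℝ × ℝ → ℝ}
    (hN : IsNormalFormUpTo m g l N B') (hd : fderiv ℝ B 0 (1, 0) = frequency g l)
    (hO : (fun x : ℝ × ℝ => B' x - B x) =O[𝓝 0] fun x => ‖x‖ ^ (N + 1)) :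
    IsNormalFormUpTo m g l N B := by
  obtain ⟨-, Φ, hΦ, hL, hH⟩ := hN
  refine ⟨hd, Φ, hΦ, hL, ?_⟩
  have hJ := tendsto_of_isBigO_norm (isBigO_quadJ.trans
    ((isBigO_norm_pow_le (show 1 ≤ 2 by norm_num)).trans (by simpa using isBigO_refl _ _)))
  have h1 := (hO.comp_tendsto hJ).trans (isBigO_quadJ.norm_left.pow (N + 1))
  have h2 : (fun z : Phase 2 => (‖z‖ ^ 2) ^ (N + 1)) =O[𝓝 0] fun z => ‖z‖ ^ (2 * N + 1) := by
    simp only [← pow_mul]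
    exact isBigO_norm_pow_le (by omega)
  exact (hH.add (h1.trans h2)).congr_left fun z => sub_add_sub_cancel _ _ _

end SphericalPendulum

end

theorem theorem2 (m g l : ℝ) (hm : 0 < m) (hg : 0 < g) (hl : 0 < l) :
    -- the elliptic integral is real for small arguments
    (∀ᶠ x : ℝ × ℝ in 𝓝 0, (SphericalPendulum.ellipticIntegral x.1 x.2).im = 0) ∧
    ∃ B : ℝ × ℝ → ℝ,
      -- `B` is the Birkhoff normal form at the focus-focus point, ...
      SphericalPendulum.IsBirkhoffNormalForm m g l B ∧
      -- ... which is unique, order by order ...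
      (∀ (N : ℕ) (B' : ℝ × ℝ → ℝ), AnalyticAt ℝ B' 0 →
        SphericalPendulum.IsNormalFormUpTo m g l N B' →
          (fun x : ℝ × ℝ => B' x - B x) =O[𝓝 0] fun x => ‖x‖ ^ (N + 1)) ∧
      -- ... and is the inverse of the imaginary action with respect to the first argument
      (∀ᶠ x : ℝ × ℝ in 𝓝 0,
        B (SphericalPendulum.imaginaryAction m g l x.1 x.2, x.2) = x.1) ∧
      (∀ᶠ x : ℝ × ℝ in 𝓝 0,
        SphericalPendulum.imaginaryAction m g l (B x) x.2 = x.1) := by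
  open SphericalPendulum in
  obtain ⟨B, hB, hB0, hBF, hFB⟩ := exists_inverse_imaginaryAction hm hg hl
  have unique : ∀ (N : ℕ) (B' : ℝ × ℝ → ℝ), AnalyticAt ℝ B' 0 → IsNormalFormUpTo m g l N B' →
      (fun x : ℝ × ℝ => B' x - B x) =O[𝓝 0] fun x => ‖x‖ ^ (N + 1) :=
    fun N B' hB' hN => isBigO_sub_of_isNormalFormUpTo hm hg hl hB hB0 hBF hB' hN
  refine ⟨?_, B, ⟨hB, fun N => ?_⟩, unique, hBF, hFB⟩
  · filter_upwards [eventually_abs_le (ε := (1 / 4) ^ 2) (by norm_num)] with x hx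
    exact ellipticIntegral_im hx.1 hx.2
  · obtain ⟨B₁, hB₁, hν, hN₁⟩ := exists_isNormalFormUpTo hm hg hl 1
    obtain ⟨B', hB', -, hN⟩ := exists_isNormalFormUpTo hm hg hl N
    -- The order `1` normal form `B₁` agrees with `B` up to second order, so it fixes the linear
    -- part of `B` as `ν j₁`, which the case `N = 0` would not do.
    have hd := fderiv_eq_of_isBigO_sub hB (frequency g l • ContinuousLinearMap.fst ℝ ℝ ℝ)
      ((hν.sub (unique 1 B₁ hB₁ hN₁)).congr_left fun x => by simp)
    exact hN.congr (by rw [hd]; simp) (unique N B' hB' hN)
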